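/- \textbf{Setting.} Let $d\ge1$. Let $h:[0,\infty)\to[0,\infty)$ be convex, $h\in C^1([0,\infty))\cap C^\infty((0,\infty))$, with $h(0)=h'(0)=0$ and $\lim_{s\to\infty}s\,h''(s)=+\infty$; put $P(r)=rh'(r)-h(r)$ and $\widetilde h(s)=s\,h(1/s)$. Let $V\in C^2(\mathbb R^d)$, $V\ge0$. Let $\mathcal P_2^{\rm ac}$ be the set of probability densities on $\mathbb R^d$ with finite second moment, $W_2$ the $L^2$-Wasserstein distance, and $\mathcal E(\rho)=\int_{\mathbb R^d}[h(\rho)+V\rho]\,dx$. Let $\rho^0\in\mathcal P_2^{\rm ac}$, and let $\overline\rho\in\mathcal P_2^{\rm ac}$ be a reference density whose support $K$ is convex and compact. For a finite simplicial decomposition $\mathscr T$ of $K$, let $\overline\rho_{\mathscr T}$ be the density that equals $\frac1{|\Delta|}\int_\Delta\overline\rho$ on each $d$-simplex $\Delta\in\mathscr T$, and let $\mathcal A_{\mathscr T}$ be the set of continuous maps $G:K\to\mathbb R^d$ that on each $d$-simplex are affine with linear part of positive determinant. Put $$\mathbf E(G|\overline\rho_{\mathscr T})=\int_K\Big[\widetilde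 h\Big(\frac{\det \mathrm DG}{\overline\rho_{\mathscr T}}\Big)+V\circ G\Big]\overline\rho_{\mathscr T}\,d\omega .$$ Let a sequence of discretizations $\boxplus=(\mathscr T,\tau)$ be given, with time steps $\tau>0$ tending to zero and with the maximal diameter of the simplices of $\mathscr T$ tending to zero. For each $\boxplus$ let $(G_\boxplus^n)_{n\ge0}$ be a sequence in $\mathcal A_{\mathscr T}$ such that, for each $n\ge1$, $G_\boxplus^n$ is a global minimizer over $\mathcal A_{\mathscr T}$ of $$G\mapsto\frac1{2\tau}\int_K\|G-G_\boxplus^{n-1}\|^2\,\overline\rho_{\mathscr T}\,d\omega+\mathbf E(G|\overline\rho_{\mathscr T}).$$ Let $\rho_\boxplus^n=(G_\boxplus^n)_\#\overline\rho_{\mathscr T}$, and let $\widetilde\rho_\boxplus(t)=\rho_\boxplus^n$ for $t\in((n-1)\tau,n\tau]$. Assume that $\rho_\boxplus^0\to\rho^0$ narrowly and $\sup_\boxplus\mathcal E(\rho_\boxplus^0)<\infty$. Let $T>0$. A \emph{limit trajectory} on $[0,T]$ of a sequence of curves $\widetilde\rho_\boxplus$ is a curve $\rho_*:[0,T]\to\mathcal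 P_2^{\rm ac}$ that is Hölder-$\frac12$-continuous in $W_2$ and satisfies $\widetilde\rho_\boxplus(t)\to\rho_*(t)$ narrowly for each $t\in(0,T]$. \textbf{Statement.} Let $\Omega\subseteq\mathbb R^d$ be open (for instance $\Omega=\mathbb R^d$) and let $p_*\in L^1([0,T]\times\Omega)$. Assume in addition that, with $n$ ranging over the indices $n\ge 0$ with $(n-1)\tau<T$ (that is, those that occur in $\widetilde\rho_\boxplus$ on $[0,T]$): \begin{enumerate} \item $P(\widetilde\rho_\boxplus)\overset{*}{\rightharpoonup}p_*$ in $L^1([0,T]\times\Omega)$, i.e. against all continuous functions with compact support in $[0,T]\times\Omega$; \item each $G_\boxplus^n$ is injective on $K$; \item as $\boxplus\to0$, the images under $G_\boxplus^n$ of the $d$-simplices of $\mathscr T$ have diameters tending to zero uniformly in $n$, and their angles are non-degenerate: there is a $\theta>0$ such that, for all sufficiently fine $\boxplus$ and all $n$, at each vertex of each image simplex, every edge encloses an angle of at least $\theta$ with every nonzero vector of the linear span of the other edges at that vertex (for $d=2$: all interior angles lie in $[\theta,\pi-\theta]$). \end{enumerate} Then a subsequence of $(\widetilde\rho_\boxplus)$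 has a limit trajectory on $[0,T]$; and every limit trajectory $\rho_*$ of a subsequence satisfies $$\partial_t\rho_*=\Delta p_*+\nabla\cdot(\rho_*\nabla V)$$ in the sense of distributions on $(0,T)\times\Omega$, i.e. for all $\varphi\in C_c^\infty((0,T)\times\Omega)$, $$\int_0^T\!\!\int_\Omega\rho_*\,(\partial_t\varphi-\nabla V\cdot\nabla\varphi)\,dx\,dt+\int_0^T\!\!\int_\Omega p_*\,\Delta\varphi\,dx\,dt=0 .$$ -/

import Mathlib

open MeasureTheory Set Filter Topology
open scoped ENNReal NNReal BoundedContinuousFunction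

namespace LagrangianScheme

/-- The Euclidean space of dimension `d`. -/
abbrev Space (d : ℕ) : Type := EuclideanSpace ℝ (Fin d)

/-! ### Probability densities, narrow convergence, Wasserstein distance, entropy -/

/-- Absolutely continuous probability measures with finite second moment
(densities are identified with the measures they define). -/
structure IsP2ac {d : ℕ} (μ : Measure (Space d)) : Prop where
  prob : IsProbabilityMeasure μ
  ac : μ ≪ volume
  moment : ∫⁻ x, ‖x‖ₑ ^ 2 ∂μ < ∞

/-- The Lebesgue density of `μ`. -/
noncomputable def density {d : ℕ} (μ : Measure (Space d)) (x : Space d) : ℝ :=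
  (μ.rnDeriv volume x).toReal

/-- Narrow convergence of a sequence of measures. -/
def NarrowTendsto {d : ℕ} (μ : ℕ → Measure (Space d)) (ν : Measure (Space d)) : Prop :=
  ∀ f : Space d →ᵇ ℝ, Tendsto (fun k => ∫ x, f x ∂(μ k)) atTop (𝓝 (∫ x, f x ∂ν))

/-- The `L²`-Wasserstein distance: infimum of the quadratic cost over all transport plans. -/
noncomputable def W₂ {d : ℕ} (μ ν : Measure (Space d)) : ℝ≥0∞ :=
  (⨅ γ : Measure (Space d × Space d), ⨅ _ : γ.fst = μ ∧ γ.snd = ν,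
    ∫⁻ p, edist p.1 p.2 ^ 2 ∂γ) ^ (1 / 2 : ℝ)

/-- The entropy `∫ (h(ρ) + V ρ) dx` of a measure with density `ρ` (for `h, V ≥ 0`). -/
noncomputable def entropy {d : ℕ} (h : ℝ → ℝ) (V : Space d → ℝ) (μ : Measure (Space d)) : ℝ≥0∞ :=
  ∫⁻ x, ENNReal.ofReal (h (density μ x) + V x * density μ x)

/-! ### The nonlinearity -/

/-- Standing assumptions on the internal energy density `h`. -/
structure IsInternalEnergy (h : ℝ → ℝ) : Prop where
  nonneg : ∀ r, 0 ≤ r → 0 ≤ h r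
  convex : ConvexOn ℝ (Ici 0) h
  contDiff_one : ContDiffOn ℝ 1 h (Ici 0)
  contDiff_infty : ContDiffOn ℝ (⊤ : ℕ∞) h (Ioi 0)
  zero : h 0 = 0
  deriv_zero : derivWithin h (Ici 0) 0 = 0
  growth : Tendsto (fun s => s * iteratedDeriv 2 h s) atTop atTop

/-- The pressure `P(r) = r h'(r) - h(r)`, for `r ≥ 0`. -/
noncomputable def pressure (h : ℝ → ℝ) (r : ℝ) : ℝ :=
  r * derivWithin h (Ici 0) r - h r

/-- `h̃(s) = s h(1/s)`, for `s > 0`. -/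
noncomputable def hTilde (h : ℝ → ℝ) (s : ℝ) : ℝ := s * h s⁻¹

/-! ### Discretization in space -/

/-- A finite simplicial decomposition of `K`. -/
structure Mesh {d : ℕ} (K : Set (Space d)) extends Geometry.SimplicialComplex ℝ (Space d) where
  finite_faces : faces.Finite
  space_eq : toSimplicialComplex.space = K

variable {d : ℕ} {K : Set (Space d)}

/-- The `d`-simplices of a mesh, given by their vertex sets. -/
noncomputable def Mesh.cells (𝒯 : Mesh K) : Finset (Finset (Space d)) :=
  𝒯.finite_faces.toFinset.filter fun s => s.card = d + 1

/-- The closed simplex with vertex set `s`. -/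
def simplex (s : Finset (Space d)) : Set (Space d) := convexHull ℝ (s : Set (Space d))

/-- The piecewise constant approximation of the reference density: its value in (the interior of)
the simplex `Δ` is `ρbar(Δ) / |Δ|`. -/
noncomputable def Mesh.refDensity (𝒯 : Mesh K) (ρbar : Measure (Space d)) (ω : Space d) : ℝ :=
  ∑ s ∈ 𝒯.cells, (interior (simplex s)).indicator
    (fun _ => (ρbar (simplex s)).toReal / (volume (simplex s)).toReal) ω

/-- The measure with density `refDensity`. -/
noncomputable def Mesh.refMeasure (𝒯 : Mesh K) (ρbar : Measure (Space d)) : Measure (Space d) :=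
  volume.withDensity fun ω => ENNReal.ofReal (𝒯.refDensity ρbar ω)

/-- The ansatz space: maps that are continuous on `K`, affine on each `d`-simplex, and orientation
preserving (the values of `G` outside `K` are irrelevant). -/
structure IsAnsatzMap (𝒯 : Mesh K) (G : Space d → Space d) : Prop where
  continuousOn : ContinuousOn G K
  affine : ∀ s ∈ 𝒯.cells, ∃ (A : Space d →L[ℝ] Space d) (b : Space d),
    0 < A.det ∧ ∀ ω ∈ simplex s, G ω = A ω + b

/-- The transformed entropy
`𝐄(G | ρ̄_𝒯) = ∫_K [h̃(det DG / ρ̄_𝒯) + V ∘ G] ρ̄_𝒯 dω`. -/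
noncomputable def transEntropy (h : ℝ → ℝ) (V : Space d → ℝ) (ρbar : Measure (Space d))
    (𝒯 : Mesh K) (G : Space d → Space d) : ℝ :=
  ∫ ω in K, (hTilde h ((fderiv ℝ G ω).det / 𝒯.refDensity ρbar ω) + V (G ω)) * 𝒯.refDensity ρbar ω

/-- The functional `(2τ)⁻¹ ‖G - G'‖²_{L²(K; ρ̄_𝒯)} + 𝐄(G | ρ̄_𝒯)` minimized in each time step. -/
noncomputable def stepEnergy (h : ℝ → ℝ) (V : Space d → ℝ) (ρbar : Measure (Space d))
    (𝒯 : Mesh K) (τ : ℝ) (G G' : Space d → Space d) : ℝ :=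
  1 / (2 * τ) * (∫ ω in K, ‖G ω - G' ω‖ ^ 2 * 𝒯.refDensity ρbar ω) + transEntropy h V ρbar 𝒯 G

/-! ### The fully discrete scheme -/

/-- `(G n)` is a discrete solution: all maps belong to the ansatz space, and each `G (n + 1)` is a
global minimizer of the step energy relative to `G n`. -/
structure IsDiscreteSolution (h : ℝ → ℝ) (V : Space d → ℝ) (ρbar : Measure (Space d))
    (𝒯 : Mesh K) (τ : ℝ) (G : ℕ → Space d → Space d) : Prop where
  ansatz : ∀ n, IsAnsatzMap 𝒯 (G n)
  isMin : ∀ n, ∀ F : Space d → Space d, IsAnsatzMap 𝒯 F →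
    stepEnergy h V ρbar 𝒯 τ (G (n + 1)) (G n) ≤ stepEnergy h V ρbar 𝒯 τ F (G n)

/-- The induced density `ρⁿ = (Gⁿ)_# ρ̄_𝒯`, as a measure. -/
noncomputable def inducedMeasure (ρbar : Measure (Space d)) (𝒯 : Mesh K)
    (G : ℕ → Space d → Space d) (n : ℕ) : Measure (Space d) :=
  (𝒯.refMeasure ρbar).map (G n)

/-- Piecewise constant interpolation in time: the value at `t ∈ ((n-1)τ, nτ]` is `ρⁿ`. -/
noncomputable def interpolation (ρbar : Measure (Space d)) (𝒯 : Mesh K) (τ : ℝ)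
    (G : ℕ → Space d → Space d) (t : ℝ) : Measure (Space d) :=
  inducedMeasure ρbar 𝒯 G ⌈t / τ⌉₊

/-- All angles of the image under `G` of the simplex with vertex set `s` are at least `θ`, in the
following sense: at each vertex `G i`, each edge `G j - G i` encloses an angle at least `θ` with
every nonzero vector `w` of the linear span of the other edges at `G i`. (For triangles, `w` is a
multiple of the other edge at `G i`, of either sign: the interior angles lie in `[θ, π - θ]`.) -/
def AnglesGE (θ : ℝ) (G : Space d → Space d) (s : Finset (Space d)) : Prop :=
  ∀ i ∈ s, ∀ j ∈ s, i ≠ j →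
    ∀ w ∈ Submodule.span ℝ ((fun l => G l - G i) '' ((s : Set (Space d)) \ {i, j})),
      w ≠ 0 → θ ≤ InnerProductGeometry.angle (G j - G i) w

/-! ### Limits -/

/-- `ρ` is a limit trajectory on `[0, T]` of the curves `r k`: it takes values in the absolutely
continuous probability measures of finite second moment, it is Hölder continuous with exponent
`1/2` in the Wasserstein distance, and it is the pointwise narrow limit at all positive times. -/
structure IsLimitTrajectory (T : ℝ) (r : ℕ → ℝ → Measure (Space d)) (ρ : ℝ → Measure (Space d)) :
    Prop where
  mem : ∀ t ∈ Icc 0 T, IsP2ac (ρ t)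
  holder : ∃ C : ℝ, ∀ s ∈ Icc 0 T, ∀ t ∈ Icc 0 T,
    W₂ (ρ s) (ρ t) ≤ ENNReal.ofReal (C * |t - s| ^ (1 / 2 : ℝ))
  narrow : ∀ t ∈ Ioc 0 T, NarrowTendsto (fun k => r k t) (ρ t)

/-- Weak-* convergence `u k ⇀ p` in `L¹([0,T] × Ω)`: convergence against continuous functions with
compact support in `[0,T] × Ω` (every such function is the restriction of some `ψ` as below). -/
def WeakStarTendsto (T : ℝ) (Ω : Set (Space d)) (u : ℕ → ℝ × Space d → ℝ) (p : ℝ × Space d → ℝ) :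
    Prop :=
  ∀ ψ : ℝ × Space d → ℝ, Continuous ψ → HasCompactSupport ψ → tsupport ψ ⊆ univ ×ˢ Ω →
    Tendsto (fun k => ∫ z in Icc 0 T ×ˢ Ω, u k z * ψ z) atTop
      (𝓝 (∫ z in Icc 0 T ×ˢ Ω, p z * ψ z))

/-- `∂ₜρ = Δp + ∇·(ρ ∇V)` in the sense of distributions on `(0,T) × Ω`. -/
def SolvesLimitEq (T : ℝ) (Ω : Set (Space d)) (V : Space d → ℝ) (ρ : ℝ → Measure (Space d))
    (p : ℝ × Space d → ℝ) : Prop :=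
  ∀ φ : ℝ × Space d → ℝ, ContDiff ℝ (⊤ : ℕ∞) φ → HasCompactSupport φ → tsupport φ ⊆ Ioo 0 T ×ˢ Ω →
    (∫ t in Ioo 0 T, ∫ x, (deriv (fun s => φ (s, x)) t
        - inner ℝ (gradient V x) (gradient (fun y => φ (t, y)) x)) ∂(ρ t))
      + ∫ z in Ioo 0 T ×ˢ Ω, p z * Laplacian.laplacian (fun y => φ (z.1, y)) z.2 = 0

end LagrangianScheme

open LagrangianScheme

/-! Positivity of finitely many determinants is an open condition, so a minimizer of a time step can
be varied in every piecewise affine direction `F`. This gives the discrete Euler–Lagrange equation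
`IsDiscreteSolution.eulerLagrange`: the velocity `(Gⁿ - Gⁿ⁻¹)/τ` paired with `F` balances the
pressure on each image simplex times the divergence of `F` in image coordinates, together with the
force `∇V`.

The natural choice `F = ∇φ ∘ Gⁿ`, whose divergence in image coordinates is `Δφ`, is not piecewise
affine, so `F` is taken to be its interpolant at the vertices. The angle condition makes the
gradient of the interpolant close to the Hessian of `φ`, with an error proportional to the diameter
of the image simplices (`norm_le_of_anglesGE`, `exists_interpolant_estimates`). A Taylor expansion
turns the velocity term into the increment of `∫ φ dρⁿ` (`one_step_estimate`), and integration with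
summation by parts in time gives `weak_form_estimate`.

The errors vanish for two reasons. Comparison with the previous iterate bounds the sum of all
squared displacements by `2τ` times the initial energy, and weak-* convergence tested with a cutoff
bounds the pressure near the support of `φ`. What remains is linear in the density and in the
pressure, so narrow and weak-* convergence suffice for the limit.

Injectivity makes the density of `ρⁿ` on an image simplex the single quotient of reference density
and determinant. Hence the cell sums are integrals of `P(ρⁿ)`, and the functional of the scheme is
the entropy of `ρⁿ` (`IsCellwise.entropy_eq`).

For the existence of limit trajectories, the same displacement bound gives Hölder continuity up to
an error `τ`. Tightness is inherited from time zero, a diagonal argument gives narrow limits at all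
times, and the superlinear growth of `h` keeps these limits absolutely continuous. -/

namespace LagrangianScheme

variable {d : ℕ} {K : Set (Space d)}

/-! ### Simplices and meshes -/

lemma isCompact_simplex (s : Finset (Space d)) : IsCompact (simplex s) :=
  s.finite_toSet.isCompact_convexHull (𝕜 := ℝ)

lemma convex_simplex (s : Finset (Space d)) : Convex ℝ (simplex s) := convex_convexHull ℝ _

lemma mem_simplex_of_mem {s : Finset (Space d)} {v : Space d} (hv : v ∈ s) : v ∈ simplex s :=
  subset_convexHull ℝ _ hv

/-- A finite set of at most `d` points spans a proper affine subspace. -/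
lemma affineSpan_ne_top_of_card_le {s : Set (Space d)} (hs : s.Finite) (h : s.ncard ≤ d) :
    affineSpan ℝ s ≠ ⊤ := by
  intro htop
  have := hs.fintype
  have hne : s.Nonempty := by
    rw [← affineSpan_nonempty (k := ℝ), htop]
    exact ⟨0, trivial⟩
  obtain ⟨n, hn⟩ : ∃ n, s.ncard = n + 1 :=
    ⟨s.ncard - 1, by have := (Set.ncard_pos hs).2 hne; omega⟩
  have h1 := finrank_vectorSpan_range_le ℝ ((↑) : s → Space d) (n := n)
    (by rw [← hn, ← Nat.card_eq_fintype_card, Nat.card_coe_set_eq])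
  rw [Subtype.range_coe, ← direction_affineSpan, htop, AffineSubspace.direction_top,
    finrank_top, finrank_euclideanSpace_fin] at h1
  omega

lemma interior_convexHull_eq_empty_of_card_le {s : Set (Space d)} (hs : s.Finite)
    (h : s.ncard ≤ d) : interior (convexHull ℝ s) = ∅ := by
  rw [← Set.not_nonempty_iff_eq_empty, interior_convexHull_nonempty_iff_affineSpan_eq_top]
  exact affineSpan_ne_top_of_card_le hs h

lemma volume_convexHull_eq_zero_of_card_le {s : Set (Space d)} (hs : s.Finite)
    (h : s.ncard ≤ d) : volume (convexHull ℝ s) = 0 :=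
  measure_mono_null (convexHull_subset_affineSpan s)
    (Measure.addHaar_affineSubspace volume _ (affineSpan_ne_top_of_card_le hs h))

namespace Mesh

variable (𝒯 : Mesh K)

lemma mem_cells {s : Finset (Space d)} : s ∈ 𝒯.cells ↔ s ∈ 𝒯.faces ∧ s.card = d + 1 := by
  simp [cells]

lemma simplex_subset {s : Finset (Space d)} (hs : s ∈ 𝒯.faces) : simplex s ⊆ K := by
  rw [← 𝒯.space_eq]
  exact 𝒯.toSimplicialComplex.convexHull_subset_space hs

variable {𝒯}

lemma cell_subset {s : Finset (Space d)} (hs : s ∈ 𝒯.cells) : simplex s ⊆ K :=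
  𝒯.simplex_subset (𝒯.mem_cells.1 hs).1

lemma affineSpan_cell {s : Finset (Space d)} (hs : s ∈ 𝒯.cells) :
    affineSpan ℝ (s : Set (Space d)) = ⊤ := by
  obtain ⟨h1, h2⟩ := 𝒯.mem_cells.1 hs
  have := (𝒯.indep h1).affineSpan_eq_top_iff_card_eq_finrank_add_one.2 (by simp [h2])
  simpa using this

lemma interior_cell_nonempty {s : Finset (Space d)} (hs : s ∈ 𝒯.cells) :
    (interior (simplex s)).Nonempty :=
  interior_convexHull_nonempty_iff_affineSpan_eq_top.2 (affineSpan_cell hs)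

/-- Two simplices of a complex meet inside the hull of their common vertices. For distinct cells
these are at most `d` points, whose hull has empty interior. -/
lemma disjoint_interior_cells {s t : Finset (Space d)} (hs : s ∈ 𝒯.cells) (ht : t ∈ 𝒯.cells)
    (hst : s ≠ t) : Disjoint (interior (simplex s)) (interior (simplex t)) := by
  classical
  obtain ⟨hs1, hs2⟩ := 𝒯.mem_cells.1 hs
  obtain ⟨ht1, ht2⟩ := 𝒯.mem_cells.1 ht
  rw [Set.disjoint_iff_inter_eq_empty, ← interior_inter]
  have hcard : (s ∩ t).card ≤ d := by
    by_contra! hc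
    have h1 : s ∩ t = s := Finset.eq_of_subset_of_card_le Finset.inter_subset_left (by omega)
    have h2 : s ∩ t = t := Finset.eq_of_subset_of_card_le Finset.inter_subset_right (by omega)
    exact hst (h1.symm.trans h2)
  refine Set.subset_eq_empty (interior_mono (𝒯.inter_subset_convexHull hs1 ht1)) ?_
  refine interior_convexHull_eq_empty_of_card_le (s.finite_toSet.inter_of_left _) ?_
  rw [← Finset.coe_inter, Set.ncard_coe_finset]
  exact hcard

lemma volume_interior_simplex (s : Finset (Space d)) :
    volume (interior (simplex s)) = volume (simplex s) :=
  measure_interior_of_null_frontier ((convex_simplex s).addHaar_frontier volume)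

lemma volume_simplex_lt_top (s : Finset (Space d)) : volume (simplex s) < ∞ :=
  (isCompact_simplex s).measure_lt_top

lemma volume_simplex_pos {s : Finset (Space d)} (hs : s ∈ 𝒯.cells) :
    0 < (volume (simplex s)).toReal := by
  rw [← volume_interior_simplex]
  refine ENNReal.toReal_pos (isOpen_interior.measure_pos _ (interior_cell_nonempty hs)).ne' ?_
  rw [volume_interior_simplex]
  exact (volume_simplex_lt_top s).ne

end Mesh

/-- The constant value of the approximate reference density on a simplex. -/
noncomputable def cellWeight (ρbar : Measure (Space d)) (s : Finset (Space d)) : ℝ :=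
  (ρbar (simplex s)).toReal / (volume (simplex s)).toReal

/-! ### The approximate reference measure -/

namespace Mesh

variable {𝒯 : Mesh K} {ρbar : Measure (Space d)}

lemma cellWeight_nonneg (s : Finset (Space d)) : 0 ≤ cellWeight ρbar s := by
  unfold cellWeight; positivity

/-- An open cell is a nonempty open set of points of the support, so it is charged. Positivity
allows the division by the weight in `hTilde`. -/
lemma cellWeight_pos (hρ : IsP2ac ρbar) (hsupp : ρbar.support = K) {s : Finset (Space d)}
    (hs : s ∈ 𝒯.cells) : 0 < cellWeight ρbar s := by
  have := hρ.prob
  refine div_pos (ENNReal.toReal_pos ?_ (measure_ne_top _ _)) (volume_simplex_pos hs)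
  obtain ⟨x, hx⟩ := interior_cell_nonempty hs
  have hxK : x ∈ ρbar.support := hsupp ▸ cell_subset hs (interior_subset hx)
  exact ((Measure.mem_support_iff_forall x).1 hxK _ (mem_interior_iff_mem_nhds.1 hx)).ne'

lemma refDensity_eq_of_mem {s : Finset (Space d)} (hs : s ∈ 𝒯.cells) {ω : Space d}
    (hω : ω ∈ interior (simplex s)) : 𝒯.refDensity ρbar ω = cellWeight ρbar s := by
  unfold refDensity
  rw [Finset.sum_eq_single s]
  · rw [Set.indicator_of_mem hω, cellWeight]
  · intro t ht hts
    exact Set.indicator_of_notMem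
      (fun h => Set.disjoint_left.1 (disjoint_interior_cells hs ht hts.symm) hω h) _
  · exact fun h => absurd hs h

lemma refDensity_nonneg (ω : Space d) : 0 ≤ 𝒯.refDensity ρbar ω :=
  Finset.sum_nonneg fun s _ => Set.indicator_nonneg (fun _ _ => cellWeight_nonneg s) _

lemma refDensity_eq_zero {ω : Space d} (hω : ω ∉ K) : 𝒯.refDensity ρbar ω = 0 :=
  Finset.sum_eq_zero fun _ hs =>
    Set.indicator_of_notMem (fun h => hω (cell_subset hs (interior_subset h))) _

variable (𝒯 ρbar) in
lemma measurable_refDensity : Measurable (𝒯.refDensity ρbar) :=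
  Finset.measurable_fun_sum _ fun _ _ => measurable_const.indicator isOpen_interior.measurableSet

variable (𝒯 ρbar) in
lemma refMeasure_eq_sum : 𝒯.refMeasure ρbar = ∑ s ∈ 𝒯.cells,
    ENNReal.ofReal (cellWeight ρbar s) • volume.restrict (interior (simplex s)) := by
  have : (fun ω => ENNReal.ofReal (𝒯.refDensity ρbar ω)) = fun ω => ∑ s ∈ 𝒯.cells,
      (interior (simplex s)).indicator (fun _ => ENNReal.ofReal (cellWeight ρbar s)) ω := by
    ext ω
    rw [refDensity, ENNReal.ofReal_sum_of_nonneg (fun s _ => Set.indicator_nonneg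
      (fun _ _ => div_nonneg ENNReal.toReal_nonneg ENNReal.toReal_nonneg) _)]
    refine Finset.sum_congr rfl fun s _ => ?_
    by_cases h : ω ∈ interior (simplex s) <;> simp [h, cellWeight]
  ext B hB
  rw [refMeasure, this, withDensity_apply _ hB, lintegral_finsetSum _ (fun s _ =>
    measurable_const.indicator isOpen_interior.measurableSet), Measure.finsetSum_apply]
  refine Finset.sum_congr rfl fun s _ => ?_
  rw [lintegral_indicator_const isOpen_interior.measurableSet, Measure.smul_apply, smul_eq_mul,
    Measure.restrict_apply isOpen_interior.measurableSet, Measure.restrict_apply hB,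
    Set.inter_comm]

lemma ofReal_cellWeight_mul_volume {s : Finset (Space d)} [IsFiniteMeasure ρbar]
    (hs : s ∈ 𝒯.cells) :
    ENNReal.ofReal (cellWeight ρbar s) * volume (interior (simplex s)) = ρbar (simplex s) := by
  rw [volume_interior_simplex, ← ENNReal.ofReal_toReal (volume_simplex_lt_top s).ne,
    ← ENNReal.ofReal_mul (cellWeight_nonneg s), cellWeight,
    div_mul_cancel₀ _ (volume_simplex_pos hs).ne', ENNReal.ofReal_toReal (measure_ne_top _ _)]

lemma card_le_of_mem_faces {s : Finset (Space d)} (hs : s ∈ 𝒯.faces) : s.card ≤ d + 1 := by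
  have h := (𝒯.indep hs).card_le_finrank_succ
  have h2 := Submodule.finrank_le (vectorSpan ℝ (Set.range ((↑) : s → Space d)))
  rw [finrank_euclideanSpace_fin] at h2
  simp only [Fintype.card_coe] at h
  omega

-- Frontiers of simplices, and faces with at most `d` vertices, are Lebesgue null and hence null for
-- `ρbar`. So almost all mass lies in the disjoint open cells.
variable (𝒯) in
lemma sum_measure_cells (hρ : IsP2ac ρbar) (hsupp : ρbar.support = K) :
    ∑ s ∈ 𝒯.cells, ρbar (simplex s) = 1 := by
  have := hρ.prob
  have hnull : ∀ s : Finset (Space d), ρbar (simplex s \ interior (simplex s)) = 0 := fun s =>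
    hρ.ac (by
      rw [← (isCompact_simplex s).isClosed.frontier_eq]
      exact (convex_simplex s).addHaar_frontier volume)
  have h1 : ∀ s : Finset (Space d), ρbar (simplex s) = ρbar (interior (simplex s)) := fun s =>
    le_antisymm (by
      rw [← measure_sdiff_add_inter (simplex s) isOpen_interior.measurableSet, hnull, zero_add]
      exact measure_mono Set.inter_subset_right) (measure_mono interior_subset)
  rw [Finset.sum_congr rfl fun s _ => h1 s, ← measure_biUnion_finset
    (fun s hs t ht hst => disjoint_interior_cells hs ht hst)
    (fun s _ => isOpen_interior.measurableSet)]
  refine le_antisymm prob_le_one ?_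
  have huniv : ρbar (⋃ s ∈ 𝒯.faces, simplex s) = 1 := by
    have : (⋃ s ∈ 𝒯.faces, simplex s) = K := 𝒯.space_eq
    rw [this, ← hsupp, prob_compl_eq_zero_iff Measure.isClosed_support.measurableSet |>.1]
    exact Measure.measure_compl_support
  rw [← huniv]
  refine measure_mono_ae ?_
  have hae : ∀ᵐ x ∂ρbar, ∀ s ∈ 𝒯.faces, x ∉ simplex s \ interior (simplex s) := by
    rw [ae_ball_iff 𝒯.finite_faces.countable]
    exact fun s _ => measure_eq_zero_iff_ae_notMem.1 (hnull s)
  have hae2 : ∀ᵐ x ∂ρbar, ∀ s ∈ 𝒯.faces, s.card ≤ d → x ∉ simplex s := by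
    rw [ae_ball_iff 𝒯.finite_faces.countable]
    intro s _
    by_cases hc : s.card ≤ d
    · have : ρbar (simplex s) = 0 :=
        hρ.ac (volume_convexHull_eq_zero_of_card_le s.finite_toSet (by simpa using hc))
      filter_upwards [measure_eq_zero_iff_ae_notMem.1 this] with x hx _ using hx
    · exact Eventually.of_forall fun x h => absurd h hc
  filter_upwards [hae, hae2] with x hx hx2 hmem
  change x ∈ ⋃ s ∈ 𝒯.faces, simplex s at hmem
  change x ∈ ⋃ s ∈ 𝒯.cells, interior (simplex s)
  simp only [Set.mem_iUnion] at hmem ⊢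
  obtain ⟨s, hs, hxs⟩ := hmem
  have hc : s.card = d + 1 := by
    by_contra hc
    exact hx2 s hs (by have := card_le_of_mem_faces hs; omega) hxs
  exact ⟨s, 𝒯.mem_cells.2 ⟨hs, hc⟩, by_contra fun h => hx s hs ⟨hxs, h⟩⟩

lemma isProbabilityMeasure_refMeasure (hρ : IsP2ac ρbar) (hsupp : ρbar.support = K) :
    IsProbabilityMeasure (𝒯.refMeasure ρbar) := by
  have := hρ.prob
  refine ⟨?_⟩
  rw [refMeasure_eq_sum, Measure.finsetSum_apply, ← 𝒯.sum_measure_cells hρ hsupp]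
  refine Finset.sum_congr rfl fun s hs => ?_
  rw [Measure.smul_apply, smul_eq_mul, Measure.restrict_apply_univ,
    ofReal_cellWeight_mul_volume hs]

lemma ae_refMeasure_mem_interior : ∀ᵐ ω ∂𝒯.refMeasure ρbar,
    ∃ s ∈ 𝒯.cells, ω ∈ interior (simplex s) := by
  have hm : MeasurableSet {ω | ¬ ∃ s ∈ 𝒯.cells, ω ∈ interior (simplex s)} := by
    have : {ω | ¬ ∃ s ∈ 𝒯.cells, ω ∈ interior (simplex s)}
        = (⋃ s ∈ 𝒯.cells, interior (simplex s))ᶜ := by ext; simp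
    rw [this]
    exact (Finset.measurableSet_biUnion _ fun s _ => isOpen_interior.measurableSet).compl
  rw [ae_iff, refMeasure_eq_sum, Measure.finsetSum_apply]
  refine Finset.sum_eq_zero fun s hs => ?_
  rw [Measure.smul_apply, Measure.restrict_apply hm]
  have : {ω | ¬ ∃ s ∈ 𝒯.cells, ω ∈ interior (simplex s)} ∩ interior (simplex s) = ∅ := by
    ext ω
    simp only [Set.mem_inter_iff, Set.mem_ofPred_eq, Set.mem_empty_iff_false, iff_false]
    exact fun h => h.1 ⟨s, hs, h.2⟩
  rw [this]; simp

lemma ae_refMeasure_mem : ∀ᵐ ω ∂𝒯.refMeasure ρbar, ω ∈ K :=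
  ae_refMeasure_mem_interior.mono fun _ ⟨_, hs, h⟩ => cell_subset hs (interior_subset h)

/-- Turns the weighted integrals in `transEntropy` and `stepEnergy` into integrals against one fixed
measure. -/
lemma setIntegral_mul_refDensity (f : Space d → ℝ) :
    ∫ ω in K, f ω * 𝒯.refDensity ρbar ω = ∫ ω, f ω ∂𝒯.refMeasure ρbar := by
  rw [setIntegral_eq_integral_of_forall_compl_eq_zero
    (fun ω hω => by rw [refDensity_eq_zero hω, mul_zero]), refMeasure,
    integral_withDensity_eq_integral_toReal_smul (measurable_refDensity 𝒯 ρbar).ennreal_ofReal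
      (by simp)]
  refine integral_congr_ae (Eventually.of_forall fun ω => ?_)
  simp [ENNReal.toReal_ofReal (refDensity_nonneg ω), mul_comm]

lemma integral_refMeasure {E : Type*} [NormedAddCommGroup E] [NormedSpace ℝ E] {f : Space d → E}
    (hf : Integrable f (𝒯.refMeasure ρbar)) : ∫ ω, f ω ∂𝒯.refMeasure ρbar
      = ∑ s ∈ 𝒯.cells, cellWeight ρbar s • ∫ ω in interior (simplex s), f ω := by
  rw [refMeasure_eq_sum] at hf ⊢
  rw [integral_finsetSum_measure fun s hs => (integrable_finsetSum_measure.1 hf) s hs]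
  refine Finset.sum_congr rfl fun s _ => ?_
  rw [integral_smul_measure, ENNReal.toReal_ofReal (cellWeight_nonneg s)]

end Mesh

/-! ### Ansatz maps -/

/-- `G` is given by `ω ↦ A s ω + b s` on each cell `s`, and `det (A s) > 0`. -/
structure IsCellwise (𝒯 : Mesh K) (G : Space d → Space d)
    (A : Finset (Space d) → Space d →L[ℝ] Space d) (b : Finset (Space d) → Space d) : Prop where
  det_pos : ∀ s ∈ 𝒯.cells, 0 < (A s).det
  eq : ∀ s ∈ 𝒯.cells, ∀ ω ∈ simplex s, G ω = A s ω + b s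

lemma IsAnsatzMap.exists_cellwise {𝒯 : Mesh K} {G : Space d → Space d} (hG : IsAnsatzMap 𝒯 G) :
    ∃ A b, IsCellwise 𝒯 G A b := by
  choose! A b h using hG.affine
  exact ⟨A, b, fun s hs => (h s hs).1, fun s hs => (h s hs).2⟩

namespace Mesh

variable {𝒯 : Mesh K} {ρbar : Measure (Space d)}

lemma restrict_refMeasure (hK : IsCompact K) :
    (𝒯.refMeasure ρbar).restrict K = 𝒯.refMeasure ρbar := by
  have := hK.measurableSet
  exact Measure.restrict_eq_self_of_ae_mem ae_refMeasure_mem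

lemma integrable_refMeasure {E : Type*} [NormedAddCommGroup E] (hK : IsCompact K)
    [IsFiniteMeasure (𝒯.refMeasure ρbar)] {f : Space d → E} (hf : ContinuousOn f K) :
    Integrable f (𝒯.refMeasure ρbar) := by
  rw [← restrict_refMeasure hK]
  exact hf.integrableOn_compact hK

lemma aemeasurable_refMeasure {E : Type*} [TopologicalSpace E] [MeasurableSpace E] [BorelSpace E]
    (hK : IsCompact K) {f : Space d → E} (hf : ContinuousOn f K) :
    AEMeasurable f (𝒯.refMeasure ρbar) := by
  rw [← restrict_refMeasure hK]
  exact hf.aemeasurable hK.measurableSet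

end Mesh

/-- The density of the image of `refMeasure` under a cellwise affine map with linear parts `A`. -/
noncomputable def imageDensity (𝒯 : Mesh K) (ρbar : Measure (Space d)) (G : Space d → Space d)
    (A : Finset (Space d) → Space d →L[ℝ] Space d) (x : Space d) : ℝ :=
  ∑ s ∈ 𝒯.cells, (G '' interior (simplex s)).indicator
    (fun _ => cellWeight ρbar s / (A s).det) x

/-- The internal energy of a cellwise affine map with linear parts `A`. -/
noncomputable def internalPart (h : ℝ → ℝ) (𝒯 : Mesh K) (ρbar : Measure (Space d))
    (A : Finset (Space d) → Space d →L[ℝ] Space d) : ℝ :=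
  ∑ s ∈ 𝒯.cells, cellWeight ρbar s * (volume (simplex s)).toReal
    * hTilde h ((A s).det / cellWeight ρbar s)

/-! ### Pushforward of the reference measure and its entropy -/

namespace IsCellwise

variable {𝒯 : Mesh K} {ρbar : Measure (Space d)} {G : Space d → Space d}
  {A : Finset (Space d) → Space d →L[ℝ] Space d} {b : Finset (Space d) → Space d}

lemma image_eq (hG : IsCellwise 𝒯 G A b) {s : Finset (Space d)} (hs : s ∈ 𝒯.cells)
    {B : Set (Space d)} (hB : B ⊆ simplex s) : G '' B = (fun x => x + b s) '' (A s '' B) := by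
  rw [Set.image_image]
  exact Set.image_congr fun ω hω => hG.eq s hs ω (hB hω)

lemma volume_image (hG : IsCellwise 𝒯 G A b) {s : Finset (Space d)} (hs : s ∈ 𝒯.cells)
    {B : Set (Space d)} (hB : B ⊆ simplex s) :
    volume (G '' B) = ENNReal.ofReal (A s).det * volume B := by
  rw [hG.image_eq hs hB, Set.image_add_right, measure_preimage_add_right,
    Measure.addHaar_image_continuousLinearMap]
  congr 2
  exact abs_of_pos (hG.det_pos s hs)

lemma isOpen_image (hG : IsCellwise 𝒯 G A b) {s : Finset (Space d)} (hs : s ∈ 𝒯.cells) :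
    IsOpen (G '' interior (simplex s)) := by
  rw [hG.image_eq hs interior_subset]
  refine (isOpenMap_add_right (b s)) _ ?_
  exact ((A s).toContinuousLinearEquivOfDetNeZero (hG.det_pos s hs).ne').isOpenMap _
    isOpen_interior

lemma fderiv_eq (hG : IsCellwise 𝒯 G A b) {s : Finset (Space d)} (hs : s ∈ 𝒯.cells)
    {ω : Space d} (hω : ω ∈ interior (simplex s)) : fderiv ℝ G ω = A s := by
  have : G =ᶠ[𝓝 ω] fun x => A s x + b s := by
    filter_upwards [mem_interior_iff_mem_nhds.1 hω] with x hx using hG.eq s hs x hx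
  rw [this.fderiv_eq]
  exact ((A s).hasFDerivAt.add_const (b s)).fderiv

/-- Change of variables on each cell, where the Jacobian is constant. Injectivity is not needed:
where images overlap, their densities add up, as they do in `imageDensity`. -/
lemma map_refMeasure (hG : IsCellwise 𝒯 G A b) (hGc : ContinuousOn G K) (hK : IsCompact K) :
    (𝒯.refMeasure ρbar).map G
      = volume.withDensity fun x => ENNReal.ofReal (imageDensity 𝒯 ρbar G A x) := by
  have : (fun x => ENNReal.ofReal (imageDensity 𝒯 ρbar G A x)) = fun x => ∑ s ∈ 𝒯.cells,
      (G '' interior (simplex s)).indicator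
        (fun _ => ENNReal.ofReal (cellWeight ρbar s / (A s).det)) x := by
    ext x
    rw [imageDensity, ENNReal.ofReal_sum_of_nonneg (fun s hs => Set.indicator_nonneg
      (fun _ _ => div_nonneg (Mesh.cellWeight_nonneg s) (hG.det_pos s hs).le) _)]
    refine Finset.sum_congr rfl fun s _ => ?_
    by_cases h : x ∈ G '' interior (simplex s)
    · rw [Set.indicator_of_mem h, Set.indicator_of_mem h]
    · rw [Set.indicator_of_notMem h, Set.indicator_of_notMem h, ENNReal.ofReal_zero]
  ext B hB
  rw [this, withDensity_apply _ hB, lintegral_finsetSum' _ (fun s hs =>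
    (measurable_const.indicator (hG.isOpen_image hs).measurableSet).aemeasurable),
    Measure.map_apply_of_aemeasurable (Mesh.aemeasurable_refMeasure hK hGc) hB,
    Mesh.refMeasure_eq_sum, Measure.finsetSum_apply]
  refine Finset.sum_congr rfl fun s hs => ?_
  have hpre : B ∩ G '' interior (simplex s) = G '' (G ⁻¹' B ∩ interior (simplex s)) := by
    rw [Set.inter_comm B, ← Set.image_inter_preimage, Set.inter_comm]
  rw [lintegral_indicator_const (hG.isOpen_image hs).measurableSet, Measure.smul_apply,
    smul_eq_mul, Measure.restrict_apply' isOpen_interior.measurableSet,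
    Measure.restrict_apply (hG.isOpen_image hs).measurableSet, Set.inter_comm _ B, hpre,
    hG.volume_image hs (Set.inter_subset_right.trans interior_subset), ← mul_assoc,
    ← ENNReal.ofReal_mul (div_nonneg (Mesh.cellWeight_nonneg s) (hG.det_pos s hs).le),
    div_mul_cancel₀ _ (hG.det_pos s hs).ne']

lemma measurable_imageDensity (hG : IsCellwise 𝒯 G A b) : Measurable (imageDensity 𝒯 ρbar G A) :=
  Finset.measurable_fun_sum _ fun _ hs =>
    measurable_const.indicator (hG.isOpen_image hs).measurableSet

lemma imageDensity_nonneg (hG : IsCellwise 𝒯 G A b) (x : Space d) :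
    0 ≤ imageDensity 𝒯 ρbar G A x :=
  Finset.sum_nonneg fun s hs => Set.indicator_nonneg
    (fun _ _ => div_nonneg (Mesh.cellWeight_nonneg s) (hG.det_pos s hs).le) _

lemma density_map_ae_eq (hG : IsCellwise 𝒯 G A b) (hGc : ContinuousOn G K) (hK : IsCompact K) :
    density ((𝒯.refMeasure ρbar).map G) =ᵐ[volume] imageDensity 𝒯 ρbar G A := by
  rw [hG.map_refMeasure hGc hK]
  filter_upwards [Measure.rnDeriv_withDensity volume
    (hG.measurable_imageDensity (ρbar := ρbar)).ennreal_ofReal] with x hx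
  rw [density, hx, ENNReal.toReal_ofReal (hG.imageDensity_nonneg x)]

/-- Injectivity makes the images of the open cells disjoint, so at most one summand is nonzero at
`x`. Outside all images the condition `F 0 = 0` is needed. -/
lemma _root_.LagrangianScheme.comp_imageDensity (hinj : InjOn G K) (F : ℝ → ℝ) (hF : F 0 = 0)
    (x : Space d) : F (imageDensity 𝒯 ρbar G A x) = ∑ s ∈ 𝒯.cells,
      (G '' interior (simplex s)).indicator (fun _ => F (cellWeight ρbar s / (A s).det)) x := by
  unfold imageDensity
  by_cases hx : ∃ s ∈ 𝒯.cells, x ∈ G '' interior (simplex s)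
  · obtain ⟨s, hs, hxs⟩ := hx
    have hother : ∀ t ∈ 𝒯.cells, t ≠ s → x ∉ G '' interior (simplex t) := by
      rintro t ht hts ⟨y, hy, hyx⟩
      obtain ⟨z, hz, hzx⟩ := hxs
      have : y = z := hinj (Mesh.cell_subset ht (interior_subset hy))
        (Mesh.cell_subset hs (interior_subset hz)) (hyx.trans hzx.symm)
      exact Set.disjoint_left.1 (Mesh.disjoint_interior_cells ht hs hts) hy (this ▸ hz)
    rw [Finset.sum_eq_single s (fun t ht hts => Set.indicator_of_notMem (hother t ht hts) _)
      (fun h => absurd hs h),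
      Finset.sum_eq_single s (fun t ht hts => Set.indicator_of_notMem (hother t ht hts) _)
      (fun h => absurd hs h), Set.indicator_of_mem hxs, Set.indicator_of_mem hxs]
  · push Not at hx
    rw [Finset.sum_eq_zero fun s hs => Set.indicator_of_notMem (hx s hs) _,
      Finset.sum_eq_zero fun s hs => Set.indicator_of_notMem (hx s hs) _, hF]

lemma comp_density_ae_eq (hG : IsCellwise 𝒯 G A b) (hGc : ContinuousOn G K) (hK : IsCompact K)
    (hinj : InjOn G K) (F : ℝ → ℝ) (hF : F 0 = 0) :
    (fun x => F (density ((𝒯.refMeasure ρbar).map G) x)) =ᵐ[volume] fun x => ∑ s ∈ 𝒯.cells,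
      (G '' interior (simplex s)).indicator (fun _ => F (cellWeight ρbar s / (A s).det)) x := by
  filter_upwards [hG.density_map_ae_eq hGc hK (ρbar := ρbar)] with x hx
  rw [hx, comp_imageDensity hinj F hF]

lemma integral_refMeasure_fderiv (hG : IsCellwise 𝒯 G A b) (F : ℝ → ℝ → ℝ) :
    Integrable (fun ω => F (fderiv ℝ G ω).det (𝒯.refDensity ρbar ω)) (𝒯.refMeasure ρbar) ∧
    ∫ ω, F (fderiv ℝ G ω).det (𝒯.refDensity ρbar ω) ∂𝒯.refMeasure ρbar
      = ∑ s ∈ 𝒯.cells, cellWeight ρbar s * (volume (simplex s)).toReal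
        * F (A s).det (cellWeight ρbar s) := by
  have hcongr : ∀ s ∈ 𝒯.cells, ∀ ω ∈ interior (simplex s),
      F (fderiv ℝ G ω).det (𝒯.refDensity ρbar ω) = F (A s).det (cellWeight ρbar s) := by
    intro s hs ω hω
    rw [hG.fderiv_eq hs hω, Mesh.refDensity_eq_of_mem hs hω]
  have hint : Integrable (fun ω => F (fderiv ℝ G ω).det (𝒯.refDensity ρbar ω))
      (𝒯.refMeasure ρbar) := by
    rw [Mesh.refMeasure_eq_sum, integrable_finsetSum_measure]
    intro s hs
    refine Integrable.smul_measure ?_ ENNReal.ofReal_ne_top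
    refine IntegrableOn.congr_fun (f := fun _ => F (A s).det (cellWeight ρbar s)) ?_
      (fun ω hω => (hcongr s hs ω hω).symm) isOpen_interior.measurableSet
    exact integrableOn_const (by
      rw [Mesh.volume_interior_simplex]; exact (Mesh.volume_simplex_lt_top s).ne)
  refine ⟨hint, ?_⟩
  rw [Mesh.integral_refMeasure hint]
  refine Finset.sum_congr rfl fun s hs => ?_
  rw [setIntegral_congr_fun isOpen_interior.measurableSet (hcongr s hs), setIntegral_const,
    measureReal_def, Mesh.volume_interior_simplex]
  simp [mul_assoc]

lemma transEntropy_eq (hG : IsCellwise 𝒯 G A b) (hGc : ContinuousOn G K) (hK : IsCompact K)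
    [IsFiniteMeasure (𝒯.refMeasure ρbar)] (h : ℝ → ℝ) {V : Space d → ℝ} (hV : Continuous V) :
    transEntropy h V ρbar 𝒯 G
      = internalPart h 𝒯 ρbar A + ∫ ω, V (G ω) ∂𝒯.refMeasure ρbar := by
  have h1 := hG.integral_refMeasure_fderiv (ρbar := ρbar) (fun a c => hTilde h (a / c))
  unfold transEntropy
  rw [Mesh.setIntegral_mul_refDensity fun ω => hTilde h ((fderiv ℝ G ω).det /
    𝒯.refDensity ρbar ω) + V (G ω), integral_add h1.1
    (Mesh.integrable_refMeasure (f := fun ω => V (G ω)) hK (hV.comp_continuousOn hGc)), h1.2,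
    internalPart]

lemma lintegral_comp_density (hG : IsCellwise 𝒯 G A b) (hGc : ContinuousOn G K)
    (hK : IsCompact K) (hρ : IsP2ac ρbar) (hsupp : ρbar.support = K)
    (hinj : InjOn G K) {h : ℝ → ℝ} (hh0 : h 0 = 0) (hh : ∀ r, 0 ≤ r → 0 ≤ h r) :
    ∫⁻ x, ENNReal.ofReal (h (density ((𝒯.refMeasure ρbar).map G) x))
      = ENNReal.ofReal (internalPart h 𝒯 ρbar A) := by
  have hr : ∀ s ∈ 𝒯.cells, 0 < cellWeight ρbar s / (A s).det := fun s hs =>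
    div_pos (Mesh.cellWeight_pos hρ hsupp hs) (hG.det_pos s hs)
  -- With density `r = c / det` on the image cell, `c |Δ| h̃(1/r)` equals `h r` times the volume
  -- `det |Δ|` of the image.
  have h1 : ∀ s ∈ 𝒯.cells, cellWeight ρbar s * (volume (simplex s)).toReal
      * hTilde h ((A s).det / cellWeight ρbar s)
      = h (cellWeight ρbar s / (A s).det) * ((A s).det * (volume (simplex s)).toReal) := by
    intro s hs
    have := (Mesh.cellWeight_pos hρ hsupp hs).ne'
    rw [hTilde, inv_div]
    field_simp
  rw [internalPart, Finset.sum_congr rfl h1, ENNReal.ofReal_sum_of_nonneg (fun s hs =>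
    mul_nonneg (hh _ (hr s hs).le) (mul_nonneg (hG.det_pos s hs).le ENNReal.toReal_nonneg))]
  have h2 : (fun x => ENNReal.ofReal (h (density ((𝒯.refMeasure ρbar).map G) x)))
      =ᵐ[volume] fun x => ∑ s ∈ 𝒯.cells, (G '' interior (simplex s)).indicator
        (fun _ => ENNReal.ofReal (h (cellWeight ρbar s / (A s).det))) x := by
    filter_upwards [hG.comp_density_ae_eq hGc hK hinj h hh0 (ρbar := ρbar)] with x hx
    rw [hx, ENNReal.ofReal_sum_of_nonneg (fun s hs => Set.indicator_nonneg
      (fun _ _ => hh _ (hr s hs).le) _)]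
    refine Finset.sum_congr rfl fun s _ => ?_
    by_cases h : x ∈ G '' interior (simplex s)
    · rw [Set.indicator_of_mem h, Set.indicator_of_mem h]
    · rw [Set.indicator_of_notMem h, Set.indicator_of_notMem h, ENNReal.ofReal_zero]
  rw [lintegral_congr_ae h2, lintegral_finsetSum' _ (fun s hs =>
    (measurable_const.indicator (hG.isOpen_image hs).measurableSet).aemeasurable)]
  refine Finset.sum_congr rfl fun s hs => ?_
  rw [lintegral_indicator_const (hG.isOpen_image hs).measurableSet,
    hG.volume_image hs interior_subset, Mesh.volume_interior_simplex,
    ENNReal.ofReal_mul (hh _ (hr s hs).le), ENNReal.ofReal_mul (hG.det_pos s hs).le,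
    ENNReal.ofReal_toReal (Mesh.volume_simplex_lt_top s).ne]

lemma internalPart_nonneg (hG : IsCellwise 𝒯 G A b)
    {h : ℝ → ℝ} (hh : ∀ r, 0 ≤ r → 0 ≤ h r) : 0 ≤ internalPart h 𝒯 ρbar A := by
  refine Finset.sum_nonneg fun s hs => ?_
  have h1 := Mesh.cellWeight_nonneg (ρbar := ρbar) s
  have h2 : 0 ≤ (A s).det / cellWeight ρbar s := div_nonneg (hG.det_pos s hs).le h1
  exact mul_nonneg (mul_nonneg h1 ENNReal.toReal_nonneg)
    (mul_nonneg h2 (hh _ (inv_nonneg.2 h2)))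

/-- Links the functional that the scheme minimizes, which sees only the map, with the entropy of the
measure it induces. Without injectivity overlapping images would in general break the identity. -/
lemma entropy_eq (hG : IsCellwise 𝒯 G A b) (hGc : ContinuousOn G K)
    (hK : IsCompact K) (hρ : IsP2ac ρbar) (hsupp : ρbar.support = K)
    (hinj : InjOn G K) {h : ℝ → ℝ} (hh : IsInternalEnergy h) {V : Space d → ℝ} (hV : Continuous V)
    (hV0 : ∀ x, 0 ≤ V x) :
    entropy h V ((𝒯.refMeasure ρbar).map G) = ENNReal.ofReal (transEntropy h V ρbar 𝒯 G) := by
  have := Mesh.isProbabilityMeasure_refMeasure (𝒯 := 𝒯) hρ hsupp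
  rw [hG.transEntropy_eq hGc hK h hV, ENNReal.ofReal_add (hG.internalPart_nonneg hh.nonneg)
    (integral_nonneg fun _ => hV0 _),
    ← hG.lintegral_comp_density hGc hK hρ hsupp hinj hh.zero hh.nonneg, entropy]
  have hae : AEMeasurable G (𝒯.refMeasure ρbar) := Mesh.aemeasurable_refMeasure hK hGc
  have hmeas : Measurable (density ((𝒯.refMeasure ρbar).map G)) :=
    (Measure.measurable_rnDeriv _ _).ennreal_toReal
  have hsplit : ∀ x, ENNReal.ofReal (h (density ((𝒯.refMeasure ρbar).map G) x)
      + V x * density ((𝒯.refMeasure ρbar).map G) x)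
      = ENNReal.ofReal (h (density ((𝒯.refMeasure ρbar).map G) x))
        + ENNReal.ofReal (V x * density ((𝒯.refMeasure ρbar).map G) x) := fun x =>
    ENNReal.ofReal_add (hh.nonneg _ ENNReal.toReal_nonneg)
      (mul_nonneg (hV0 x) ENNReal.toReal_nonneg)
  have hVmeas : Measurable fun x =>
      ENNReal.ofReal (V x * density ((𝒯.refMeasure ρbar).map G) x) :=
    (hV.measurable.mul hmeas).ennreal_ofReal
  simp_rw [hsplit]
  rw [lintegral_add_right _ hVmeas]
  congr 1
  rw [ofReal_integral_eq_lintegral_ofReal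
    (Mesh.integrable_refMeasure (f := fun ω => V (G ω)) hK (hV.comp_continuousOn hGc))
    (Eventually.of_forall fun _ => hV0 _),
    ← lintegral_map' (f := fun x => ENNReal.ofReal (V x))
      hV.measurable.ennreal_ofReal.aemeasurable hae, hG.map_refMeasure hGc hK,
    lintegral_withDensity_eq_lintegral_mul _ hG.measurable_imageDensity.ennreal_ofReal
      hV.measurable.ennreal_ofReal, ← hG.map_refMeasure hGc hK]
  refine lintegral_congr_ae ?_
  filter_upwards [hG.density_map_ae_eq hGc hK (ρbar := ρbar)] with x hx
  rw [hx, mul_comm, ENNReal.ofReal_mul (hG.imageDensity_nonneg x), Pi.mul_apply]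

end IsCellwise

/-! ### Energy estimates -/

section Energy

variable {𝒯 : Mesh K} {ρbar : Measure (Space d)} {h : ℝ → ℝ} {V : Space d → ℝ} {τ : ℝ}
  {G : ℕ → Space d → Space d}

lemma transEntropy_nonneg (hh : IsInternalEnergy h) (hV : Continuous V) (hV0 : ∀ x, 0 ≤ V x)
    (hK : IsCompact K) [IsFiniteMeasure (𝒯.refMeasure ρbar)] {F : Space d → Space d}
    (hF : IsAnsatzMap 𝒯 F) : 0 ≤ transEntropy h V ρbar 𝒯 F := by
  obtain ⟨A, b, hA⟩ := hF.exists_cellwise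
  rw [hA.transEntropy_eq hF.continuousOn hK h hV]
  exact add_nonneg (hA.internalPart_nonneg hh.nonneg) (integral_nonneg fun _ => hV0 _)

lemma stepEnergy_eq (F F' : Space d → Space d) : stepEnergy h V ρbar 𝒯 τ F F'
    = 1 / (2 * τ) * (∫ ω, ‖F ω - F' ω‖ ^ 2 ∂𝒯.refMeasure ρbar) + transEntropy h V ρbar 𝒯 F := by
  rw [stepEnergy, Mesh.setIntegral_mul_refDensity fun ω => ‖F ω - F' ω‖ ^ 2]

namespace IsDiscreteSolution

/-- The previous iterate is an admissible competitor whose distance term is zero. -/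
lemma energy_step (hG : IsDiscreteSolution h V ρbar 𝒯 τ G) (n : ℕ) :
    1 / (2 * τ) * (∫ ω, ‖G (n + 1) ω - G n ω‖ ^ 2 ∂𝒯.refMeasure ρbar)
      + transEntropy h V ρbar 𝒯 (G (n + 1)) ≤ transEntropy h V ρbar 𝒯 (G n) := by
  have := hG.isMin n (G n) (hG.ansatz n)
  rw [stepEnergy_eq, stepEnergy_eq] at this
  simpa using this

lemma energy_sum (hG : IsDiscreteSolution h V ρbar 𝒯 τ G) (N : ℕ) :
    1 / (2 * τ) * ∑ n ∈ Finset.range N, (∫ ω, ‖G (n + 1) ω - G n ω‖ ^ 2 ∂𝒯.refMeasure ρbar)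
      + transEntropy h V ρbar 𝒯 (G N) ≤ transEntropy h V ρbar 𝒯 (G 0) := by
  induction N with
  | zero => simp
  | succ N ih =>
    rw [Finset.sum_range_succ, mul_add]
    linarith [hG.energy_step N]

lemma transEntropy_le (hG : IsDiscreteSolution h V ρbar 𝒯 τ G) (hτ : 0 < τ) (n : ℕ) :
    transEntropy h V ρbar 𝒯 (G n) ≤ transEntropy h V ρbar 𝒯 (G 0) := by
  refine le_trans (le_add_of_nonneg_left ?_) (hG.energy_sum n)
  exact mul_nonneg (by positivity)
    (Finset.sum_nonneg fun _ _ => integral_nonneg fun _ => by positivity)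

lemma sum_dist_le (hG : IsDiscreteSolution h V ρbar 𝒯 τ G) (hτ : 0 < τ)
    (hh : IsInternalEnergy h) (hV : Continuous V) (hV0 : ∀ x, 0 ≤ V x)
    (hK : IsCompact K) [IsFiniteMeasure (𝒯.refMeasure ρbar)] (N : ℕ) :
    ∑ n ∈ Finset.range N, (∫ ω, ‖G (n + 1) ω - G n ω‖ ^ 2 ∂𝒯.refMeasure ρbar)
      ≤ 2 * τ * transEntropy h V ρbar 𝒯 (G 0) := by
  have h1 := hG.energy_sum N
  have h2 := transEntropy_nonneg hh hV hV0 hK (hG.ansatz N) (ρbar := ρbar)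
  have h3 : 1 / (2 * τ) * ∑ n ∈ Finset.range N,
      (∫ ω, ‖G (n + 1) ω - G n ω‖ ^ 2 ∂𝒯.refMeasure ρbar) ≤ transEntropy h V ρbar 𝒯 (G 0) := by
    linarith
  rwa [one_div, inv_mul_le_iff₀ (by positivity)] at h3

lemma integrable_sq_dist (hG : IsDiscreteSolution h V ρbar 𝒯 τ G) (hK : IsCompact K)
    [IsFiniteMeasure (𝒯.refMeasure ρbar)] (m n : ℕ) :
    Integrable (fun ω => ‖G m ω - G n ω‖ ^ 2) (𝒯.refMeasure ρbar) :=
  Mesh.integrable_refMeasure hK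
    (((hG.ansatz m).continuousOn.sub (hG.ansatz n).continuousOn).norm.pow 2)

/-- A discrete Hölder estimate: Cauchy–Schwarz over `j` steps costs a factor `j`, while the total of
the squared steps is of order `τ`. -/
lemma sq_dist_add_le (hG : IsDiscreteSolution h V ρbar 𝒯 τ G) (hτ : 0 < τ)
    (hh : IsInternalEnergy h) (hV : Continuous V) (hV0 : ∀ x, 0 ≤ V x)
    (hK : IsCompact K) [IsFiniteMeasure (𝒯.refMeasure ρbar)] (m j : ℕ) :
    ∫ ω, ‖G (m + j) ω - G m ω‖ ^ 2 ∂𝒯.refMeasure ρbar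
      ≤ 2 * τ * transEntropy h V ρbar 𝒯 (G 0) * j := by
  have hpt : ∀ ω, ‖G (m + j) ω - G m ω‖ ^ 2
      ≤ j * ∑ i ∈ Finset.range j, ‖G (m + i + 1) ω - G (m + i) ω‖ ^ 2 := by
    intro ω
    have h1 : G (m + j) ω - G m ω
        = ∑ i ∈ Finset.range j, (G (m + i + 1) ω - G (m + i) ω) := by
      simpa [add_assoc] using (Finset.sum_range_sub (fun i => G (m + i) ω) j).symm
    rw [h1]
    calc ‖∑ i ∈ Finset.range j, (G (m + i + 1) ω - G (m + i) ω)‖ ^ 2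
        ≤ (∑ i ∈ Finset.range j, ‖G (m + i + 1) ω - G (m + i) ω‖) ^ 2 := by
          gcongr; exact norm_sum_le _ _
      _ ≤ _ := by
          have := sq_sum_le_card_mul_sum_sq (s := Finset.range j)
            (f := fun i => ‖G (m + i + 1) ω - G (m + i) ω‖)
          simpa using this
  have hint := fun i => hG.integrable_sq_dist hK (m + i + 1) (m + i)
  calc ∫ ω, ‖G (m + j) ω - G m ω‖ ^ 2 ∂𝒯.refMeasure ρbar
      ≤ ∫ ω, j * ∑ i ∈ Finset.range j, ‖G (m + i + 1) ω - G (m + i) ω‖ ^ 2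
          ∂𝒯.refMeasure ρbar :=
        integral_mono (hG.integrable_sq_dist hK _ _)
          ((integrable_finsetSum _ fun i _ => hint i).const_mul _) hpt
    _ = j * ∑ i ∈ Finset.range j,
          ∫ ω, ‖G (m + i + 1) ω - G (m + i) ω‖ ^ 2 ∂𝒯.refMeasure ρbar := by
        rw [integral_const_mul, integral_finsetSum _ fun i _ => hint i]
    -- Adding the first `m` steps produces the full sum, which the energy controls.
    _ ≤ j * ∑ i ∈ Finset.range (m + j),
          ∫ ω, ‖G (i + 1) ω - G i ω‖ ^ 2 ∂𝒯.refMeasure ρbar := by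
        rw [Finset.sum_range_add]
        gcongr
        exact le_add_of_nonneg_left
          (Finset.sum_nonneg fun _ _ => integral_nonneg fun _ => by positivity)
    _ ≤ _ := by
        rw [mul_comm]
        gcongr
        exact hG.sum_dist_le hτ hh hV hV0 hK _

lemma sq_dist_le (hG : IsDiscreteSolution h V ρbar 𝒯 τ G) (hτ : 0 < τ)
    (hh : IsInternalEnergy h) (hV : Continuous V) (hV0 : ∀ x, 0 ≤ V x)
    (hK : IsCompact K) [IsFiniteMeasure (𝒯.refMeasure ρbar)] (m n : ℕ) :
    ∫ ω, ‖G m ω - G n ω‖ ^ 2 ∂𝒯.refMeasure ρbar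
      ≤ 2 * τ * transEntropy h V ρbar 𝒯 (G 0) * |(m : ℝ) - n| := by
  rcases le_total m n with hmn | hmn
  · obtain ⟨j, rfl⟩ := Nat.exists_eq_add_of_le hmn
    simp_rw [norm_sub_rev (G m _)]
    have := hG.sq_dist_add_le hτ hh hV hV0 hK m j
    push_cast
    rwa [sub_add_cancel_left, abs_neg, Nat.abs_cast]
  · obtain ⟨j, rfl⟩ := Nat.exists_eq_add_of_le hmn
    have := hG.sq_dist_add_le hτ hh hV hV0 hK n j
    push_cast
    rwa [add_sub_cancel_left, Nat.abs_cast]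

/-- Time steps needed to connect two times. -/
lemma _root_.LagrangianScheme.abs_natCeil_sub_natCeil_mul_le {s t : ℝ} (hτ : 0 < τ) (hs : 0 ≤ s)
    (ht : 0 ≤ t) : τ * |(⌈s / τ⌉₊ : ℝ) - ⌈t / τ⌉₊| ≤ |s - t| + τ := by
  have h1 := Nat.le_ceil (s / τ)
  have h2 := Nat.le_ceil (t / τ)
  have h3 := Nat.ceil_lt_add_one (div_nonneg hs hτ.le)
  have h4 := Nat.ceil_lt_add_one (div_nonneg ht hτ.le)
  have h5 : |(⌈s / τ⌉₊ : ℝ) - ⌈t / τ⌉₊| ≤ |s / τ - t / τ| + 1 := by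
    rw [abs_le]
    constructor
    · linarith [neg_abs_le (s / τ - t / τ)]
    · linarith [le_abs_self (s / τ - t / τ)]
  calc τ * |(⌈s / τ⌉₊ : ℝ) - ⌈t / τ⌉₊| ≤ τ * (|s / τ - t / τ| + 1) := by gcongr
    _ = |s - t| + τ := by
      rw [← sub_div, abs_div, abs_of_pos hτ]
      field_simp

end IsDiscreteSolution

end Energy

/-! ### The internal energy density -/

namespace IsInternalEnergy

variable {h : ℝ → ℝ}

lemma contDiffAt (hh : IsInternalEnergy h) {r : ℝ} (hr : 0 < r) : ContDiffAt ℝ (⊤ : ℕ∞) h r :=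
  hh.contDiff_infty.contDiffAt (Ioi_mem_nhds hr)

lemma hasDerivAt (hh : IsInternalEnergy h) {r : ℝ} (hr : 0 < r) : HasDerivAt h (deriv h r) r :=
  ((hh.contDiffAt hr).differentiableAt (by simp)).hasDerivAt

lemma _root_.LagrangianScheme.derivWithin_Ici_eq {r : ℝ} (hr : 0 < r) :
    derivWithin h (Ici 0) r = deriv h r :=
  derivWithin_of_mem_nhds (Ici_mem_nhds hr)

/-- The tangent line inequality. -/
lemma tangent_le (hh : IsInternalEnergy h) {r s : ℝ} (hr : 0 < r) (hs : 0 ≤ s) :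
    h r + deriv h r * (s - r) ≤ h s := by
  rcases lt_trichotomy r s with hrs | hrs | hrs
  · have := hh.convex.le_slope_of_hasDerivAt hr.le hs hrs (hh.hasDerivAt hr)
    rw [slope_def_field, le_div_iff₀ (by linarith)] at this
    linarith
  · simp [hrs]
  · have := hh.convex.slope_le_of_hasDerivAt hs hr.le hrs (hh.hasDerivAt hr)
    rw [slope_def_field, div_le_iff₀ (by linarith)] at this
    linarith

lemma pressure_nonneg (hh : IsInternalEnergy h) {r : ℝ} (hr : 0 ≤ r) : 0 ≤ pressure h r := by
  rcases hr.eq_or_lt with rfl | hr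
  · simp [pressure, hh.zero]
  · have := hh.tangent_le hr le_rfl
    rw [pressure, derivWithin_Ici_eq hr]
    rw [hh.zero] at this
    linarith

lemma pressure_zero (hh : IsInternalEnergy h) : pressure h 0 = 0 := by simp [pressure, hh.zero]

/-- The product rule gives `h(1/s) - h'(1/s)/s`. This is how the pressure enters the Euler–Lagrange
equation. -/
lemma hasDerivAt_hTilde (hh : IsInternalEnergy h) {s : ℝ} (hs : 0 < s) :
    HasDerivAt (hTilde h) (-pressure h s⁻¹) s := by
  have hs' : 0 < s⁻¹ := inv_pos.2 hs
  have h1 := (hasDerivAt_id s).mul ((hh.hasDerivAt hs').comp s (hasDerivAt_inv hs.ne'))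
  have h2 : 1 * (h ∘ Inv.inv) s + id s * (deriv h s⁻¹ * -(s ^ 2)⁻¹) = -pressure h s⁻¹ := by
    rw [pressure, derivWithin_Ici_eq hs']
    simp only [Function.comp, id]
    field_simp
    ring
  exact h2 ▸ h1

/-- Eventually `h''(s) ≥ 1/s`, so `h' - log` is nondecreasing there. -/
lemma tendsto_deriv (hh : IsInternalEnergy h) : Tendsto (deriv h) atTop atTop := by
  obtain ⟨S, hS⟩ := ((hh.growth.eventually_ge_atTop 1).and (eventually_ge_atTop 1)).exists_forall_of_atTop
  have hd : ∀ r, S ≤ r → 0 < r := fun r hr => by linarith [(hS r hr).2]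
  have hdd : ∀ r, S ≤ r → HasDerivAt (fun s => deriv h s - Real.log s)
      (iteratedDeriv 2 h r - r⁻¹) r := by
    intro r hr
    have h0 := hd r hr
    have h1 : DifferentiableAt ℝ (deriv h) r := by
      have : ContDiffOn ℝ 1 (deriv h) (Ioi 0) :=
        hh.contDiff_infty.deriv_of_isOpen isOpen_Ioi (by norm_cast)
      exact (this.contDiffAt (Ioi_mem_nhds h0)).differentiableAt (by simp)
    have h2 : iteratedDeriv 2 h r = deriv (deriv h) r := by
      rw [iteratedDeriv_succ, iteratedDeriv_one]
    rw [h2]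
    exact h1.hasDerivAt.sub (Real.hasDerivAt_log h0.ne')
  have hmono : MonotoneOn (fun s => deriv h s - Real.log s) (Ici S) := by
    refine monotoneOn_of_deriv_nonneg (convex_Ici S)
      (fun r hr => (hdd r hr).continuousAt.continuousWithinAt)
      (fun r hr => (hdd r (interior_subset hr)).differentiableAt.differentiableWithinAt) ?_
    intro r hr
    have hr' : S ≤ r := interior_subset hr
    rw [(hdd r hr').deriv]
    have h0 := hd r hr'
    have := (hS r hr').1
    rw [sub_nonneg, inv_le_iff_one_le_mul₀' h0]
    exact this
  refine tendsto_atTop_mono' atTop ?_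
    (tendsto_atTop_add_const_right atTop (deriv h S - Real.log S) Real.tendsto_log_atTop)
  filter_upwards [eventually_ge_atTop S] with r hr
  have := hmono (mem_Ici.2 le_rfl) (mem_Ici.2 hr) hr
  simp only at this
  linarith

/-- `h` grows superlinearly. -/
lemma exists_mul_le (hh : IsInternalEnergy h) (M : ℝ) : ∃ R, 0 < R ∧ ∀ s, R ≤ s → M * s ≤ h s := by
  obtain ⟨r, hr1, hr0⟩ :=
    ((hh.tendsto_deriv.eventually_ge_atTop (M + 1)).and (eventually_gt_atTop 0)).exists
  -- The tangent at `r` has slope at least `M + 1`. Once `s ≥ h'(r) r`, the surplus `s` absorbs the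
  -- offset `-h'(r) r` of the tangent.
  refine ⟨max r (deriv h r * r), lt_max_of_lt_left hr0, fun s hs => ?_⟩
  have hs1 := le_trans (le_max_left _ _) hs
  have hs2 := le_trans (le_max_right _ _) hs
  have h1 := hh.tangent_le hr0 (hr0.le.trans hs1)
  have h2 := hh.nonneg r hr0.le
  nlinarith

end IsInternalEnergy

/-! ### Narrow compactness -/

lemma narrowTendsto_iff {μ : ℕ → ProbabilityMeasure (Space d)} {ν : ProbabilityMeasure (Space d)} :
    NarrowTendsto (fun k => (μ k : Measure (Space d))) ν ↔ Tendsto μ atTop (𝓝 ν) :=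
  ProbabilityMeasure.tendsto_iff_forall_integral_tendsto.symm

lemma isTightMeasureSet_range_of_tendsto {μ : ℕ → ProbabilityMeasure (Space d)}
    {ν : ProbabilityMeasure (Space d)} (h : Tendsto μ atTop (𝓝 ν)) :
    IsTightMeasureSet (range fun k => (μ k : Measure (Space d))) := by
  refine isTightMeasureSet_range_of_tendsto_limsup_measure_norm_gt ?_
  have h1 : Tendsto (fun r : ℝ => (ν : Measure (Space d)) {x | r < ‖x‖}) atTop (𝓝 0) := by
    have := tendsto_measure_norm_gt_of_isTightMeasureSet
      (isTightMeasureSet_singleton (μ := (ν : Measure (Space d))))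
    simpa using this
  -- The shift by one fits the closed tail `{r ≤ ‖x‖}`, to which the portmanteau inequality applies,
  -- into the open tail `{r - 1 < ‖x‖}`.
  refine tendsto_of_tendsto_of_tendsto_of_le_of_le tendsto_const_nhds
    (h1.comp (tendsto_atTop_add_const_right atTop (-1) tendsto_id)) (fun _ => zero_le) ?_
  intro r
  have hcl : IsClosed {x : Space d | r ≤ ‖x‖} := isClosed_le continuous_const continuous_norm
  refine le_trans ?_ ((ProbabilityMeasure.limsup_measure_closed_le_of_tendsto h hcl).trans
    (measure_mono ?_))
  · exact limsup_le_limsup (Eventually.of_forall fun n => measure_mono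
      fun x (hx : r < ‖x‖) => hx.le)
  · intro x hx
    have hx' : r ≤ ‖x‖ := hx
    simp only [id, Set.mem_ofPred_eq]
    linarith

lemma exists_subseq_tendsto_of_isTight {E : Type*} [MeasurableSpace E] [TopologicalSpace E]
    [TopologicalSpace.PseudoMetrizableSpace E] [TopologicalSpace.SeparableSpace E]
    [T2Space E] [BorelSpace E] {μ : ℕ → ProbabilityMeasure E}
    (h : IsTightMeasureSet (range fun k => (μ k : Measure E))) :
    ∃ ν, ∃ σ : ℕ → ℕ, StrictMono σ ∧ Tendsto (μ ∘ σ) atTop (𝓝 ν) := by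
  have hc : IsCompact (closure (range μ)) := isCompact_closure_of_isTightMeasureSet (by
    refine h.subset ?_
    rintro _ ⟨_, ⟨k, rfl⟩, rfl⟩
    exact ⟨k, rfl⟩)
  obtain ⟨ν, -, σ, hσ, hν⟩ := hc.tendsto_subseq fun n => subset_closure (mem_range_self n)
  exact ⟨ν, σ, hσ, hν⟩

/-- A sequence of curves of probability measures that is pointwise tight and asymptotically
equicontinuous against Lipschitz functions has a pointwise convergent subsequence. -/
lemma exists_subseq_forall_tendsto {I E : Type*} [PseudoMetricSpace I]
    [TopologicalSpace.SeparableSpace I] [Nonempty I] [MeasurableSpace E] [MetricSpace E]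
    [TopologicalSpace.SeparableSpace E] [BorelSpace E] {r : ℕ → I → ProbabilityMeasure E}
    (htight : ∀ t, IsTightMeasureSet (range fun k => (r k t : Measure E)))
    (hequi : ∀ t, ∀ ε > 0, ∃ δ > 0, ∀ s, dist s t < δ → ∀ᶠ k in atTop, ∀ (L : ℝ≥0) (f : E → ℝ),
      LipschitzWith L f → (∃ C, ∀ x, |f x| ≤ C) → |∫ x, f x ∂(r k s) - ∫ x, f x ∂(r k t)| ≤ L * ε) :
    ∃ σ : ℕ → ℕ, StrictMono σ ∧ ∃ ρ : I → ProbabilityMeasure E,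
      ∀ t, Tendsto (fun k => r (σ k) t) atTop (𝓝 (ρ t)) := by
  have hc : ∀ t, IsCompact (closure (range fun k => r k t)) := fun t =>
    isCompact_closure_of_isTightMeasureSet (by
      refine (htight t).subset ?_
      rintro _ ⟨_, ⟨k, rfl⟩, rfl⟩
      exact ⟨k, rfl⟩)
  -- Extracting a subsequence in the countable product over a dense sequence of times performs the
  -- diagonal argument at once.
  have hprod := isCompact_univ_pi fun n => hc (TopologicalSpace.denseSeq I n)
  obtain ⟨q, -, σ, hσ, hq⟩ := hprod.tendsto_subseq
    (x := fun k n => r k (TopologicalSpace.denseSeq I n))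
    (fun k n _ => subset_closure (mem_range_self k))
  rw [tendsto_pi_nhds] at hq
  -- At an arbitrary time, tightness supplies a candidate along a further subsequence. The whole
  -- sequence converges to it because its integrals of Lipschitz functions are Cauchy, by comparison
  -- with a nearby dense time.
  have hex : ∀ t, ∃ ν : ProbabilityMeasure E, Tendsto (fun k => r (σ k) t) atTop (𝓝 ν) := by
    intro t
    obtain ⟨ν, -, φ, hφ, hν⟩ := (hc t).tendsto_subseq
      (x := fun k => r (σ k) t) (fun k => subset_closure (mem_range_self (σ k)))
    refine ⟨ν, ?_⟩
    rw [tendsto_iff_forall_lipschitz_integral_tendsto] at hν ⊢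
    intro f hfb ⟨L, hfL⟩
    have hfb' : ∃ C, ∀ x, |f x| ≤ C := by
      obtain ⟨C, hC⟩ := hfb
      rcases isEmpty_or_nonempty E with hE | ⟨⟨x0⟩⟩
      · exact ⟨0, fun x => (hE.false x).elim⟩
      · refine ⟨C + |f x0|, fun x => ?_⟩
        have := hC x x0
        rw [Real.dist_eq] at this
        calc |f x| = |(f x - f x0) + f x0| := by ring_nf
          _ ≤ |f x - f x0| + |f x0| := abs_add_le _ _
          _ ≤ _ := by gcongr
    refine tendsto_nhds_of_cauchySeq_of_subseq ?_ hφ.tendsto_atTop (hν f hfb ⟨L, hfL⟩)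
    rw [Metric.cauchySeq_iff']
    intro ε hε
    -- With this tolerance each of the two comparisons with the dense time costs at most `ε / 8`.
    -- The two Cauchy errors of `ε / 4` keep the total below `ε`.
    obtain ⟨δ, hδ, hδs⟩ := hequi t (ε / (8 * (L + 1))) (by positivity)
    obtain ⟨n, hn⟩ := Metric.denseRange_iff.1 (TopologicalSpace.denseRange_denseSeq I) t δ hδ
    rw [dist_comm] at hn
    have hcau := ((tendsto_iff_forall_lipschitz_integral_tendsto.1 (hq n)) f hfb
      ⟨L, hfL⟩).cauchySeq
    obtain ⟨N1, hN1⟩ := Metric.cauchySeq_iff'.1 hcau (ε / 4) (by positivity)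
    obtain ⟨N2, hN2⟩ := (hσ.tendsto_atTop.eventually (hδs _ hn)).exists_forall_of_atTop
    have hLε : (L : ℝ) * (ε / (8 * (L + 1))) ≤ ε / 8 := by
      have hL : (0 : ℝ) ≤ L := L.2
      have h8 : (0 : ℝ) < 8 * (L + 1) := by positivity
      rw [mul_div_assoc', div_le_div_iff₀ h8 (by norm_num)]
      nlinarith
    have hN1' : ∀ k ≥ N1, |(∫ x, f x ∂(r (σ k) (TopologicalSpace.denseSeq I n)))
        - ∫ x, f x ∂(r (σ N1) (TopologicalSpace.denseSeq I n))| < ε / 4 := fun k hk => hN1 k hk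
    refine ⟨max N1 N2, fun k hk => ?_⟩
    have a1 := hN2 k (le_trans (le_max_right _ _) hk) L f hfL hfb'
    have a2 := hN2 (max N1 N2) (le_max_right _ _) L f hfL hfb'
    have a3 := hN1' k (le_trans (le_max_left _ _) hk)
    have a4 := hN1' (max N1 N2) (le_max_left _ _)
    rw [abs_le] at a1 a2
    rw [abs_lt] at a3 a4
    rw [Real.dist_eq, abs_lt]
    constructor <;> linarith [a1.1, a1.2, a2.1, a2.2, a3.1, a3.2, a4.1, a4.2]
  choose ρ hρ using hex
  exact ⟨σ, hσ, ρ, hρ⟩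

lemma sq_add_le_four_mul (a b : ℝ≥0∞) : (a + b) ^ 2 ≤ 4 * (a ^ 2 + b ^ 2) := by
  rcases le_total a b with h | h
  · calc (a + b) ^ 2 ≤ (b + b) ^ 2 := by gcongr
      _ = 4 * b ^ 2 := by ring
      _ ≤ _ := by gcongr; exact le_add_self
  · calc (a + b) ^ 2 ≤ (a + a) ^ 2 := by gcongr
      _ = 4 * a ^ 2 := by ring
      _ ≤ _ := by gcongr; exact le_self_add

/-- Narrow limits of marginals of plans have a plan of at most the limiting cost. -/
lemma exists_limit_plan {a b : ℕ → ProbabilityMeasure (Space d)}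
    {α β : ProbabilityMeasure (Space d)} (ha : Tendsto a atTop (𝓝 α)) (hb : Tendsto b atTop (𝓝 β))
    (p : ℕ → ProbabilityMeasure (Space d × Space d))
    (hpa : ∀ k, (p k : Measure (Space d × Space d)).fst = a k)
    (hpb : ∀ k, (p k : Measure (Space d × Space d)).snd = b k)
    {c : ℕ → ℝ≥0∞} {C : ℝ≥0∞} (hc : Tendsto c atTop (𝓝 C))
    (hcost : ∀ k, ∫⁻ z, edist z.1 z.2 ^ 2 ∂(p k : Measure (Space d × Space d)) ≤ c k) :
    ∃ γ : Measure (Space d × Space d), γ.fst = α ∧ γ.snd = β ∧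
      ∫⁻ z, edist z.1 z.2 ^ 2 ∂γ ≤ C := by
  -- Plans inherit tightness from their marginals through products of compact sets.
  have htight : IsTightMeasureSet (range fun k => (p k : Measure (Space d × Space d))) := by
    rw [isTightMeasureSet_iff_exists_isCompact_measure_compl_le]
    intro ε hε
    obtain ⟨K1, hK1, h1⟩ := isTightMeasureSet_iff_exists_isCompact_measure_compl_le.1
      (isTightMeasureSet_range_of_tendsto ha) (ε / 2) (ENNReal.half_pos hε.ne')
    obtain ⟨K2, hK2, h2⟩ := isTightMeasureSet_iff_exists_isCompact_measure_compl_le.1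
      (isTightMeasureSet_range_of_tendsto hb) (ε / 2) (ENNReal.half_pos hε.ne')
    refine ⟨K1 ×ˢ K2, hK1.prod hK2, ?_⟩
    rintro _ ⟨k, rfl⟩
    have e1 : (p k : Measure (Space d × Space d)) (Prod.fst ⁻¹' K1ᶜ) ≤ ε / 2 := by
      rw [← Measure.fst_apply hK1.measurableSet.compl, hpa]
      exact h1 _ ⟨k, rfl⟩
    have e2 : (p k : Measure (Space d × Space d)) (Prod.snd ⁻¹' K2ᶜ) ≤ ε / 2 := by
      rw [← Measure.snd_apply hK2.measurableSet.compl, hpb]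
      exact h2 _ ⟨k, rfl⟩
    calc (p k : Measure (Space d × Space d)) (K1 ×ˢ K2)ᶜ
        ≤ (p k : Measure (Space d × Space d)) (Prod.fst ⁻¹' K1ᶜ ∪ Prod.snd ⁻¹' K2ᶜ) := by
          refine measure_mono fun z hz => ?_
          simp only [mem_compl_iff, mem_prod, not_and_or] at hz
          exact hz
      _ ≤ ε / 2 + ε / 2 := (measure_union_le _ _).trans (add_le_add e1 e2)
      _ = ε := ENNReal.add_halves ε
  obtain ⟨γ, σ, hσ, hγ⟩ := exists_subseq_tendsto_of_isTight htight
  refine ⟨γ, ?_, ?_, ?_⟩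
  · have h1 := ((ProbabilityMeasure.continuous_map continuous_fst).tendsto γ).comp hγ
    have h2 := tendsto_nhds_unique h1 (by
      refine (ha.comp hσ.tendsto_atTop).congr fun k => ?_
      exact Subtype.ext (hpa (σ k)).symm)
    exact congrArg Subtype.val h2
  · have h1 := ((ProbabilityMeasure.continuous_map continuous_snd).tendsto γ).comp hγ
    have h2 := tendsto_nhds_unique h1 (by
      refine (hb.comp hσ.tendsto_atTop).congr fun k => ?_
      exact Subtype.ext (hpb (σ k)).symm)
    exact congrArg Subtype.val h2
  · have hcont : Continuous fun z : Space d × Space d => dist z.1 z.2 ^ 2 := by fun_prop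
    have hE : ∀ z : Space d × Space d, edist z.1 z.2 ^ 2 = ENNReal.ofReal (dist z.1 z.2 ^ 2) :=
      fun z => by rw [edist_dist, ENNReal.ofReal_pow dist_nonneg]
    -- The cost is nonnegative and continuous but unbounded, so it is only lower semicontinuous
    -- under narrow convergence; this is the inequality needed.
    have hl := lintegral_le_liminf_lintegral_of_forall_isOpen_measure_le_liminf_measure
      (μ := (γ : Measure (Space d × Space d)))
      (μs := fun k => (p (σ k) : Measure (Space d × Space d)))
      (f := fun z : Space d × Space d => dist z.1 z.2 ^ 2) hcont (fun z => sq_nonneg _)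
      (fun U hU => ProbabilityMeasure.le_liminf_measure_open_of_tendsto hγ hU)
    simp_rw [← hE] at hl
    refine hl.trans ?_
    rw [← (hc.comp hσ.tendsto_atTop).liminf_eq]
    exact liminf_le_liminf (Eventually.of_forall fun k => hcost (σ k))

lemma W₂_le_of_plan {μ ν : Measure (Space d)} {γ : Measure (Space d × Space d)} (h1 : γ.fst = μ)
    (h2 : γ.snd = ν) {C : ℝ} (hC : 0 ≤ C)
    (hγ : ∫⁻ z, edist z.1 z.2 ^ 2 ∂γ ≤ ENNReal.ofReal C) :
    W₂ μ ν ≤ ENNReal.ofReal (C ^ (1 / 2 : ℝ)) := by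
  rw [W₂, ← ENNReal.ofReal_rpow_of_nonneg hC (by norm_num)]
  refine ENNReal.rpow_le_rpow ?_ (by norm_num)
  exact (iInf₂_le γ ⟨h1, h2⟩).trans hγ

lemma second_moment_lt_top_of_plan {μ ν : Measure (Space d)} {γ : Measure (Space d × Space d)}
    (h1 : γ.fst = μ) (h2 : γ.snd = ν) (hγ : ∫⁻ z, edist z.1 z.2 ^ 2 ∂γ < ∞)
    (hμ : ∫⁻ x, ‖x‖ₑ ^ 2 ∂μ < ∞) : ∫⁻ x, ‖x‖ₑ ^ 2 ∂ν < ∞ := by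
  have hm : Measurable fun x : Space d => ‖x‖ₑ ^ 2 := by fun_prop
  rw [← h1, Measure.fst, lintegral_map hm measurable_fst] at hμ
  rw [← h2, Measure.snd, lintegral_map hm measurable_snd]
  calc ∫⁻ z, ‖z.2‖ₑ ^ 2 ∂γ ≤ ∫⁻ z, 4 * (‖z.1‖ₑ ^ 2 + edist z.1 z.2 ^ 2) ∂γ := by
        refine lintegral_mono fun z => (pow_le_pow_left' ?_ 2).trans (sq_add_le_four_mul _ _)
        rw [← edist_zero_right, ← edist_zero_right, edist_comm z.1 z.2, add_comm]
        exact edist_triangle _ _ _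
    _ = 4 * (∫⁻ z, ‖z.1‖ₑ ^ 2 ∂γ + ∫⁻ z, edist z.1 z.2 ^ 2 ∂γ) := by
        rw [lintegral_const_mul _ (by fun_prop), lintegral_add_left (by fun_prop)]
    _ < ∞ := ENNReal.mul_lt_top (by simp) (ENNReal.add_lt_top.2 ⟨hμ, hγ⟩)

/-- Narrow limits of densities with bounded superlinear energy are absolutely continuous. -/
lemma absolutelyContinuous_of_tendsto {μ : ℕ → ProbabilityMeasure (Space d)}
    {ν : ProbabilityMeasure (Space d)} (hμν : Tendsto μ atTop (𝓝 ν)) {h : ℝ → ℝ}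
    (hh : IsInternalEnergy h) (hac : ∀ k, (μ k : Measure (Space d)) ≪ volume) {C : ℝ} (hC : 0 ≤ C)
    (hbound : ∀ k, ∫⁻ x, ENNReal.ofReal (h (density (μ k : Measure (Space d)) x)) ≤ ENNReal.ofReal C) :
    (ν : Measure (Space d)) ≪ volume := by
  -- Uniform integrability: a density is at most `R`, or else at most `h / M`. Open sets are used
  -- because their mass is lower semicontinuous under narrow convergence.
  have key : ∀ M : ℝ, 0 < M → ∃ R, 0 < R ∧ ∀ (U : Set (Space d)), IsOpen U →
      (ν : Measure (Space d)) U ≤ ENNReal.ofReal R * volume U + ENNReal.ofReal (M⁻¹ * C) := by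
    intro M hM
    obtain ⟨R, hR, hRh⟩ := hh.exists_mul_le M
    refine ⟨R, hR, fun U hU => ?_⟩
    refine (ProbabilityMeasure.le_liminf_measure_open_of_tendsto hμν hU).trans ?_
    refine liminf_le_of_le (by isBoundedDefault) fun b hb => ?_
    obtain ⟨k, hk⟩ := hb.exists
    refine hk.trans ?_
    have hpt : ∀ᵐ x ∂volume, (μ k : Measure (Space d)).rnDeriv volume x
        ≤ ENNReal.ofReal R + ENNReal.ofReal M⁻¹ * ENNReal.ofReal (h (density (μ k : Measure (Space d)) x)) := by
      filter_upwards [Measure.rnDeriv_lt_top (μ k : Measure (Space d)) volume] with x hx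
      rw [← ENNReal.ofReal_toReal hx.ne]
      change ENNReal.ofReal (density (μ k : Measure (Space d)) x) ≤ _
      have h0 : 0 ≤ density (μ k : Measure (Space d)) x := ENNReal.toReal_nonneg
      rw [← ENNReal.ofReal_mul (inv_nonneg.2 hM.le), ← ENNReal.ofReal_add hR.le
        (mul_nonneg (inv_nonneg.2 hM.le) (hh.nonneg _ h0))]
      refine ENNReal.ofReal_le_ofReal ?_
      rcases le_total R (density (μ k : Measure (Space d)) x) with hx | hx
      · have := hRh _ hx
        rw [← le_inv_mul_iff₀ hM] at this
        linarith
      · exact hx.trans (le_add_of_nonneg_right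
          (mul_nonneg (inv_nonneg.2 hM.le) (hh.nonneg _ h0)))
    calc (μ k : Measure (Space d)) U
        = ∫⁻ x in U, (μ k : Measure (Space d)).rnDeriv volume x :=
          (Measure.setLIntegral_rnDeriv (hac k) U).symm
      _ ≤ ∫⁻ x in U, (ENNReal.ofReal R
            + ENNReal.ofReal M⁻¹ * ENNReal.ofReal (h (density (μ k : Measure (Space d)) x))) :=
          lintegral_mono_ae (ae_restrict_of_ae hpt)
      _ = ENNReal.ofReal R * volume U
            + ENNReal.ofReal M⁻¹ * ∫⁻ x in U, ENNReal.ofReal (h (density (μ k : Measure (Space d)) x)) := by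
          rw [lintegral_add_left measurable_const, lintegral_const_mul' _ _ ENNReal.ofReal_ne_top,
            setLIntegral_const]
      _ ≤ ENNReal.ofReal R * volume U + ENNReal.ofReal M⁻¹ * ENNReal.ofReal C := by
          gcongr
          exact (setLIntegral_le_lintegral _ _).trans (hbound k)
      _ = _ := by rw [← ENNReal.ofReal_mul (inv_nonneg.2 hM.le)]
  intro B hB
  refine le_antisymm (ENNReal.le_of_forall_pos_le_add fun ε hε _ => ?_) zero_le
  rw [zero_add]
  have hε' : (0 : ℝ) < ε := hε
  -- This `M` makes the energy term at most `ε / 2`, and `U` is then chosen so small that `R` times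
  -- its volume is at most `ε / 2`. The `+ 1` keeps `M` positive when `C = 0`.
  obtain ⟨R, hR, hRU⟩ := key (2 * (C + 1) / ε) (by positivity)
  obtain ⟨U, hBU, hU, hUlt⟩ := B.exists_isOpen_lt_of_lt
    (ENNReal.ofReal (ε / (2 * R))) (by rw [hB]; exact ENNReal.ofReal_pos.2 (by positivity))
  calc (ν : Measure (Space d)) B ≤ (ν : Measure (Space d)) U := measure_mono hBU
    _ ≤ ENNReal.ofReal R * volume U + ENNReal.ofReal ((2 * (C + 1) / ε)⁻¹ * C) := hRU U hU
    _ ≤ ENNReal.ofReal R * ENNReal.ofReal (ε / (2 * R))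
          + ENNReal.ofReal ((2 * (C + 1) / ε)⁻¹ * C) := by gcongr
    _ = ENNReal.ofReal (R * (ε / (2 * R)) + (2 * (C + 1) / ε)⁻¹ * C) := by
        rw [← ENNReal.ofReal_mul hR.le, ← ENNReal.ofReal_add (by positivity) (by positivity)]
    _ ≤ ENNReal.ofReal ε := by
        refine ENNReal.ofReal_le_ofReal ?_
        have h1 : R * (ε / (2 * R)) = (ε : ℝ) / 2 := by field_simp
        have h2 : (2 * (C + 1) / (ε : ℝ))⁻¹ * C ≤ ε / 2 := by
          rw [inv_div, div_mul_eq_mul_div, div_le_div_iff₀ (by positivity) (by norm_num)]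
          nlinarith
        linarith
    _ = ε := ENNReal.ofReal_coe_nnreal

/-! ### Existence of limit trajectories -/

/-- Integrate Young's inequality `2 a X ≤ a² + X²`. -/
lemma integral_le_of_integral_sq_le {α : Type*} [MeasurableSpace α] {ν : Measure α}
    [IsProbabilityMeasure ν] {X : α → ℝ} {a : ℝ} (ha : 0 < a) (hX : Integrable X ν)
    (hX2 : Integrable (fun ω => X ω ^ 2) ν) (h : ∫ ω, X ω ^ 2 ∂ν ≤ a ^ 2) : ∫ ω, X ω ∂ν ≤ a := by
  have h1 : ∫ ω, X ω ∂ν ≤ ∫ ω, (2 * a)⁻¹ * (a ^ 2 + X ω ^ 2) ∂ν := by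
    refine integral_mono hX (((integrable_const _).add hX2).const_mul _) fun ω => ?_
    change X ω ≤ (2 * a)⁻¹ * (a ^ 2 + X ω ^ 2)
    rw [le_inv_mul_iff₀ (by positivity)]
    nlinarith [sq_nonneg (a - X ω)]
  rw [integral_const_mul, integral_add (integrable_const _) hX2, integral_const, probReal_univ,
    one_smul] at h1
  refine h1.trans ?_
  rw [inv_mul_le_iff₀ (by positivity)]
  nlinarith

/-- Tightness is stable under perturbations of bounded mean square. -/
lemma isTightMeasureSet_range_map {ν : ℕ → Measure (Space d)} {X Y : ℕ → Space d → Space d}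
    (hX : ∀ k, AEMeasurable (X k) (ν k)) (hY : ∀ k, AEMeasurable (Y k) (ν k)) {D : ℝ≥0∞}
    (hD : D ≠ ∞) (hXY : ∀ k, ∫⁻ ω, edist (X k ω) (Y k ω) ^ 2 ∂ν k ≤ D)
    (h : IsTightMeasureSet (range fun k => (ν k).map (X k))) :
    IsTightMeasureSet (range fun k => (ν k).map (Y k)) := by
  have h0 := tendsto_measure_norm_gt_of_isTightMeasureSet h
  refine isTightMeasureSet_of_tendsto_measure_norm_gt ?_
  have h2 : Tendsto (fun r : ℝ => r / 2) atTop atTop :=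
    tendsto_id.atTop_div_const (by norm_num)
  have h3 : Tendsto (fun r : ℝ => D / ENNReal.ofReal (r / 2) ^ 2) atTop (𝓝 0) := by
    have : Tendsto (fun r : ℝ => ENNReal.ofReal (r / 2) ^ 2) atTop (𝓝 ∞) := by
      have := (ENNReal.continuous_pow 2).continuousAt.tendsto.comp
        (ENNReal.tendsto_ofReal_atTop.comp h2)
      simpa [Function.comp_def] using this
    exact ENNReal.Tendsto.const_div this (Or.inr hD) |>.trans (by simp)
  have h4 := (h0.comp h2).add h3
  rw [add_zero] at h4
  refine tendsto_of_tendsto_of_tendsto_of_le_of_le' tendsto_const_nhds h4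
    (Eventually.of_forall fun _ => zero_le) ?_
  filter_upwards [eventually_gt_atTop 0] with r hr
  refine iSup₂_le ?_
  rintro _ ⟨k, rfl⟩
  have hms : ∀ a : ℝ, MeasurableSet {x : Space d | a < ‖x‖} := fun a =>
    measurableSet_lt measurable_const measurable_norm
  have hle : (ν k).map (X k) {x | r / 2 < ‖x‖}
      ≤ ⨆ μ ∈ range fun k => (ν k).map (X k), μ {x | r / 2 < ‖x‖} :=
    le_biSup (fun μ : Measure (Space d) => μ {x : Space d | r / 2 < ‖x‖}) ⟨k, rfl⟩
  refine le_trans ?_ (add_le_add_left hle _)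
  rw [Measure.map_apply_of_aemeasurable (hX k) (hms _),
    Measure.map_apply_of_aemeasurable (hY k) (hms _)]
  have hr2 : 0 < r / 2 := by positivity
  -- Chebyshev's inequality is enough, since `‖Y‖ > r` and `‖X‖ ≤ r / 2` force a displacement of at
  -- least `r / 2`.
  have hcheb : ν k {ω | ENNReal.ofReal (r / 2) ^ 2 ≤ edist (X k ω) (Y k ω) ^ 2}
      ≤ D / ENNReal.ofReal (r / 2) ^ 2 := by
    refine (meas_ge_le_lintegral_div (((hX k).edist (hY k)).pow_const 2) ?_ ?_).trans
      (ENNReal.div_le_div_right (hXY k) _)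
    · exact pow_ne_zero _ (ENNReal.ofReal_pos.2 hr2).ne'
    · exact ENNReal.pow_ne_top ENNReal.ofReal_ne_top
  refine le_trans ?_ (add_le_add_right hcheb _)
  refine le_trans (measure_mono ?_) (measure_union_le _ _)
  intro ω hω
  have hω' : r < ‖Y k ω‖ := hω
  by_cases hc : r / 2 < ‖X k ω‖
  · exact Or.inl hc
  · refine Or.inr ?_
    change ENNReal.ofReal (r / 2) ^ 2 ≤ edist (X k ω) (Y k ω) ^ 2
    rw [edist_dist]
    gcongr
    have := norm_sub_norm_le (Y k ω) (X k ω)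
    rw [dist_comm, dist_eq_norm]
    linarith

/-- The index used by the interpolation at a time up to `T` lies in the range where injectivity,
angle and diameter conditions are assumed. -/
lemma sub_one_mul_lt_of_le {τ t T : ℝ} (hτ : 0 < τ) (ht0 : 0 ≤ t) (htT : t ≤ T) :
    ((⌈t / τ⌉₊ : ℝ) - 1) * τ < T := by
  have := Nat.ceil_lt_add_one (div_nonneg ht0 hτ.le)
  have h2 : (⌈t / τ⌉₊ : ℝ) - 1 < t / τ := by linarith
  rw [lt_div_iff₀ hτ] at h2
  linarith

/-! ### Regularity in time for one discretization -/

section Scheme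

variable {𝒯 : Mesh K} {ρbar : Measure (Space d)} {h : ℝ → ℝ} {V : Space d → ℝ} {τ : ℝ}
  {G : ℕ → Space d → Space d}

namespace IsDiscreteSolution

lemma aemeasurable (hG : IsDiscreteSolution h V ρbar 𝒯 τ G) (hK : IsCompact K) (n : ℕ) :
    AEMeasurable (G n) (𝒯.refMeasure ρbar) :=
  Mesh.aemeasurable_refMeasure hK (hG.ansatz n).continuousOn

lemma isProbabilityMeasure_interpolation (hG : IsDiscreteSolution h V ρbar 𝒯 τ G)
    (hK : IsCompact K) (hρ : IsP2ac ρbar) (hsupp : ρbar.support = K) (t : ℝ) :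
    IsProbabilityMeasure (interpolation ρbar 𝒯 τ G t) :=
  have := Mesh.isProbabilityMeasure_refMeasure (𝒯 := 𝒯) hρ hsupp
  Measure.isProbabilityMeasure_map (hG.aemeasurable hK _)

lemma lintegral_edist_sq (hG : IsDiscreteSolution h V ρbar 𝒯 τ G) (hK : IsCompact K)
    [IsFiniteMeasure (𝒯.refMeasure ρbar)] (m n : ℕ) :
    ∫⁻ ω, edist (G m ω) (G n ω) ^ 2 ∂𝒯.refMeasure ρbar
      = ENNReal.ofReal (∫ ω, ‖G m ω - G n ω‖ ^ 2 ∂𝒯.refMeasure ρbar) := by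
  rw [ofReal_integral_eq_lintegral_ofReal (hG.integrable_sq_dist hK m n)
    (Eventually.of_forall fun _ => sq_nonneg _)]
  refine lintegral_congr fun ω => ?_
  rw [edist_dist, dist_eq_norm, ENNReal.ofReal_pow (norm_nonneg _)]

/-- The extra `τ` is the rounding error of `⌈· / τ⌉₊`. It disappears in the limit and leaves the
Hölder exponent `1/2`. -/
lemma sq_dist_interpolation_le (hG : IsDiscreteSolution h V ρbar 𝒯 τ G) (hτ : 0 < τ)
    (hh : IsInternalEnergy h) (hV : Continuous V) (hV0 : ∀ x, 0 ≤ V x)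
    (hK : IsCompact K) [IsFiniteMeasure (𝒯.refMeasure ρbar)] {C : ℝ} (hC : 0 ≤ C)
    (hE : transEntropy h V ρbar 𝒯 (G 0) ≤ C) {s t : ℝ} (hs : 0 ≤ s) (ht : 0 ≤ t) :
    ∫ ω, ‖G ⌈s / τ⌉₊ ω - G ⌈t / τ⌉₊ ω‖ ^ 2 ∂𝒯.refMeasure ρbar ≤ 2 * C * (|s - t| + τ) := by
  have h1 := abs_natCeil_sub_natCeil_mul_le hτ hs ht
  have h2 := hG.sq_dist_le hτ hh hV hV0 hK ⌈s / τ⌉₊ ⌈t / τ⌉₊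
  calc _ ≤ 2 * τ * transEntropy h V ρbar 𝒯 (G 0) * |(⌈s / τ⌉₊ : ℝ) - ⌈t / τ⌉₊| := h2
    _ ≤ 2 * τ * C * |(⌈s / τ⌉₊ : ℝ) - ⌈t / τ⌉₊| := by gcongr
    _ = 2 * C * (τ * |(⌈s / τ⌉₊ : ℝ) - ⌈t / τ⌉₊|) := by ring
    _ ≤ _ := by gcongr

lemma integral_interpolation (hG : IsDiscreteSolution h V ρbar 𝒯 τ G) (hK : IsCompact K)
    {E : Type*} [NormedAddCommGroup E] [NormedSpace ℝ E] {f : Space d → E} (hf : Continuous f)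
    [SecondCountableTopology E] (t : ℝ) :
    ∫ x, f x ∂(interpolation ρbar 𝒯 τ G t) = ∫ ω, f (G ⌈t / τ⌉₊ ω) ∂𝒯.refMeasure ρbar :=
  integral_map (hG.aemeasurable hK _) hf.aestronglyMeasurable

lemma integrable_comp (hG : IsDiscreteSolution h V ρbar 𝒯 τ G) (hK : IsCompact K)
    [IsFiniteMeasure (𝒯.refMeasure ρbar)]
    {E : Type*} [NormedAddCommGroup E] {f : Space d → E} (hf : Continuous f) (n : ℕ) :
    Integrable (fun ω => f (G n ω)) (𝒯.refMeasure ρbar) :=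
  Mesh.integrable_refMeasure hK (hf.comp_continuousOn (hG.ansatz n).continuousOn)

/-- Both measures are images of the same reference measure, so the pair `(G m, G n)` couples them
and no optimal plan is needed. -/
lemma abs_integral_sub_le (hG : IsDiscreteSolution h V ρbar 𝒯 τ G) (hK : IsCompact K)
    [IsProbabilityMeasure (𝒯.refMeasure ρbar)] {a : ℝ} (ha : 0 < a) (m n : ℕ)
    (hmn : ∫ ω, ‖G m ω - G n ω‖ ^ 2 ∂𝒯.refMeasure ρbar ≤ a ^ 2) {L : ℝ≥0} {f : Space d → ℝ}
    (hf : LipschitzWith L f) :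
    |∫ ω, f (G m ω) ∂𝒯.refMeasure ρbar - ∫ ω, f (G n ω) ∂𝒯.refMeasure ρbar| ≤ L * a := by
  rw [← integral_sub (hG.integrable_comp hK hf.continuous m)
    (hG.integrable_comp hK hf.continuous n)]
  have hint : Integrable (fun ω => ‖G m ω - G n ω‖) (𝒯.refMeasure ρbar) :=
    Mesh.integrable_refMeasure hK
      ((hG.ansatz m).continuousOn.sub (hG.ansatz n).continuousOn).norm
  calc |∫ ω, (f (G m ω) - f (G n ω)) ∂𝒯.refMeasure ρbar|
      ≤ ∫ ω, |f (G m ω) - f (G n ω)| ∂𝒯.refMeasure ρbar := abs_integral_le_integral_abs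
    _ ≤ ∫ ω, L * ‖G m ω - G n ω‖ ∂𝒯.refMeasure ρbar := by
        refine integral_mono ((hG.integrable_comp hK hf.continuous m).sub
          (hG.integrable_comp hK hf.continuous n)).abs (hint.const_mul _) fun ω => ?_
        have := hf.dist_le_mul (G m ω) (G n ω)
        rwa [Real.dist_eq, dist_eq_norm] at this
    _ = L * ∫ ω, ‖G m ω - G n ω‖ ∂𝒯.refMeasure ρbar := integral_const_mul _ _
    _ ≤ L * a := by
        gcongr
        exact integral_le_of_integral_sq_le ha hint (hG.integrable_sq_dist hK m n) hmn

lemma internal_energy_le (hG : IsDiscreteSolution h V ρbar 𝒯 τ G) (hτ : 0 < τ)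
    (hh : IsInternalEnergy h) (hV : Continuous V) (hV0 : ∀ x, 0 ≤ V x)
    (hK : IsCompact K) (hρ : IsP2ac ρbar) (hsupp : ρbar.support = K) {C : ℝ}
    (hE : transEntropy h V ρbar 𝒯 (G 0) ≤ C) {n : ℕ} (hinj : InjOn (G n) K) :
    ∫⁻ x, ENNReal.ofReal (h (density (inducedMeasure ρbar 𝒯 G n) x)) ≤ ENNReal.ofReal C := by
  have := Mesh.isProbabilityMeasure_refMeasure (𝒯 := 𝒯) hρ hsupp
  obtain ⟨A, b, hA⟩ := (hG.ansatz n).exists_cellwise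
  rw [inducedMeasure, hA.lintegral_comp_density (hG.ansatz n).continuousOn hK hρ hsupp hinj
    hh.zero hh.nonneg]
  refine ENNReal.ofReal_le_ofReal (le_trans ?_ ((hG.transEntropy_le hτ n).trans hE))
  rw [hA.transEntropy_eq (hG.ansatz n).continuousOn hK h hV]
  exact le_add_of_nonneg_right (integral_nonneg fun _ => hV0 _)

lemma absolutelyContinuous (hG : IsDiscreteSolution h V ρbar 𝒯 τ G) (hK : IsCompact K) (n : ℕ) :
    inducedMeasure ρbar 𝒯 G n ≪ volume := by
  obtain ⟨A, b, hA⟩ := (hG.ansatz n).exists_cellwise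
  rw [inducedMeasure, hA.map_refMeasure (hG.ansatz n).continuousOn hK]
  exact withDensity_absolutelyContinuous _ _

end IsDiscreteSolution

end Scheme

/-! ### Compactness of a sequence of discrete solutions -/

section Sequence

variable {h : ℝ → ℝ} {V : Space d → ℝ} {ρbar : Measure (Space d)} {𝒯 : ℕ → Mesh K} {τ : ℕ → ℝ}
  {G : ℕ → ℕ → Space d → Space d} {T : ℝ}

/-- The bound is assumed for the entropy of the initial measures, while the scheme dissipates
`transEntropy`. Injectivity of the initial maps translates one into the other. -/
lemma exists_energy_bound (hh : IsInternalEnergy h) (hV : Continuous V) (hV0 : ∀ x, 0 ≤ V x)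
    (hK : IsCompact K) (hρ : IsP2ac ρbar) (hsupp : ρbar.support = K)
    (hG : ∀ k, IsDiscreteSolution h V ρbar (𝒯 k) (τ k) (G k))
    (hentropy : (⨆ k, entropy h V (inducedMeasure ρbar (𝒯 k) (G k) 0)) < ∞)
    (hinj : ∀ k, InjOn (G k 0) K) :
    ∃ C, 0 ≤ C ∧ ∀ k, transEntropy h V ρbar (𝒯 k) (G k 0) ≤ C := by
  refine ⟨(⨆ k, entropy h V (inducedMeasure ρbar (𝒯 k) (G k) 0)).toReal,
    ENNReal.toReal_nonneg, fun k => ?_⟩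
  obtain ⟨A, b, hA⟩ := ((hG k).ansatz 0).exists_cellwise
  have h1 := le_iSup (fun k => entropy h V (inducedMeasure ρbar (𝒯 k) (G k) 0)) k
  rw [inducedMeasure, hA.entropy_eq ((hG k).ansatz 0).continuousOn hK hρ hsupp (hinj k) hh hV
    hV0] at h1
  exact (ENNReal.ofReal_le_iff_le_toReal hentropy.ne).1 h1

lemma exists_limitTrajectory (hh : IsInternalEnergy h) (hV : Continuous V) (hV0 : ∀ x, 0 ≤ V x)
    {ρ0 : Measure (Space d)} (hρ0 : IsP2ac ρ0)
    (hK : IsCompact K) (hρ : IsP2ac ρbar) (hsupp : ρbar.support = K)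
    (hτ : ∀ k, 0 < τ k) (hτ0 : Tendsto τ atTop (𝓝 0))
    (hG : ∀ k, IsDiscreteSolution h V ρbar (𝒯 k) (τ k) (G k))
    (hinit : NarrowTendsto (fun k => inducedMeasure ρbar (𝒯 k) (G k) 0) ρ0)
    {C : ℝ} (hC : 0 ≤ C) (hE : ∀ k, transEntropy h V ρbar (𝒯 k) (G k 0) ≤ C)
    (hT : 0 < T) (hinj : ∀ (k n : ℕ), ((n : ℝ) - 1) * τ k < T → InjOn (G k n) K) :
    ∃ σ : ℕ → ℕ, StrictMono σ ∧ ∃ ρ : ℝ → Measure (Space d),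
      IsLimitTrajectory T
        (fun k => interpolation ρbar (𝒯 (σ k)) (τ (σ k)) (G (σ k))) ρ := by
  have hprob := fun k => Mesh.isProbabilityMeasure_refMeasure (𝒯 := 𝒯 k) hρ hsupp
  have hip := fun k => (hG k).isProbabilityMeasure_interpolation hK hρ hsupp
  have := hρ0.prob
  have hne : Nonempty (Icc 0 T) := ⟨⟨0, le_rfl, hT.le⟩⟩
  let r : ℕ → Icc 0 T → ProbabilityMeasure (Space d) :=
    fun k t => ⟨interpolation ρbar (𝒯 k) (τ k) (G k) t, hip k t⟩
  let t0 : Icc 0 T := ⟨0, le_rfl, hT.le⟩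
  have hr : ∀ k t, (r k t : Measure (Space d)) = interpolation ρbar (𝒯 k) (τ k) (G k) t :=
    fun _ _ => rfl
  have hr0 : ∀ k, (r k t0 : Measure (Space d)) = inducedMeasure ρbar (𝒯 k) (G k) 0 := by
    intro k
    change inducedMeasure ρbar (𝒯 k) (G k) ⌈(0 : ℝ) / τ k⌉₊ = _
    simp
  let ρ0' : ProbabilityMeasure (Space d) := ⟨ρ0, hρ0.prob⟩
  have hinit' : Tendsto (fun k => r k t0) atTop (𝓝 ρ0') := by
    refine narrowTendsto_iff.1 ?_
    simp_rw [hr0]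
    exact hinit
  have hdist : ∀ k, ∀ s t : Icc 0 T,
      ∫ ω, ‖G k ⌈(s : ℝ) / τ k⌉₊ ω - G k ⌈(t : ℝ) / τ k⌉₊ ω‖ ^ 2 ∂(𝒯 k).refMeasure ρbar
        ≤ 2 * C * (|(s : ℝ) - t| + τ k) := fun k s t =>
    (hG k).sq_dist_interpolation_le (hτ k) hh hV hV0 hK hC (hE k) s.2.1 t.2.1
  obtain ⟨τmax, hτmax⟩ := hτ0.bddAbove_range
  -- Tightness spreads from time zero to `t` because the displacement is bounded in mean square;
  -- `τmax` takes care of the rounding term.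
  have htight : ∀ t, IsTightMeasureSet (range fun k => (r k t : Measure (Space d))) := by
    intro t
    have h0 := isTightMeasureSet_range_of_tendsto hinit'
    simp only [hr, interpolation, inducedMeasure] at h0 ⊢
    refine isTightMeasureSet_range_map (X := fun k => G k ⌈(t0 : ℝ) / τ k⌉₊)
      (fun k => (hG k).aemeasurable hK _) (fun k => (hG k).aemeasurable hK _)
      (D := ENNReal.ofReal (2 * C * (|(t0 : ℝ) - t| + τmax))) ENNReal.ofReal_ne_top ?_ h0
    intro k
    rw [(hG k).lintegral_edist_sq hK]
    refine ENNReal.ofReal_le_ofReal ((hdist k t0 t).trans ?_)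
    gcongr
    exact hτmax ⟨k, rfl⟩
  have hequi : ∀ t, ∀ ε > 0, ∃ δ > 0, ∀ s, dist s t < δ → ∀ᶠ k in atTop, ∀ (L : ℝ≥0)
      (f : Space d → ℝ), LipschitzWith L f → (∃ C, ∀ x, |f x| ≤ C) →
      |∫ x, f x ∂(r k s : Measure (Space d)) - ∫ x, f x ∂(r k t : Measure (Space d))|
        ≤ L * ε := by
    intro t ε hε
    -- Both `|s - t|` and eventually `τ k` are below this number, so `2 C (|s - t| + τ k) ≤ ε ^ 2`.
    -- The `+ 1` covers `C = 0`.
    have hδ : 0 < ε ^ 2 / (4 * (C + 1)) := by positivity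
    refine ⟨_, hδ, fun s hst => ?_⟩
    filter_upwards [hτ0.eventually_lt_const hδ] with k hk L f hf _
    change |∫ x, f x ∂(interpolation ρbar (𝒯 k) (τ k) (G k) s)
      - ∫ x, f x ∂(interpolation ρbar (𝒯 k) (τ k) (G k) t)| ≤ L * ε
    rw [(hG k).integral_interpolation hK hf.continuous,
      (hG k).integral_interpolation hK hf.continuous]
    refine (hG k).abs_integral_sub_le hK hε _ _ ((hdist k s t).trans ?_) hf
    have h1 : |(s : ℝ) - t| < ε ^ 2 / (4 * (C + 1)) := hst
    calc 2 * C * (|(s : ℝ) - t| + τ k)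
        ≤ 2 * (C + 1) * (ε ^ 2 / (4 * (C + 1)) + ε ^ 2 / (4 * (C + 1))) := by
          have := (hτ k).le
          gcongr
          linarith
      _ = ε ^ 2 := by field_simp; ring
  obtain ⟨σ, hσ, ρ, hρlim⟩ := exists_subseq_forall_tendsto htight hequi
  have hτσ := hτ0.comp hσ.tendsto_atTop
  have hρt0 : (ρ t0 : Measure (Space d)) = ρ0 :=
    by
    have : ρ t0 = ρ0' := tendsto_nhds_unique (hρlim t0) (hinit'.comp hσ.tendsto_atTop)
    rw [this]
    rfl
  -- The joint law of the maps at two times is a plan of cost at most `2 C (|s - t| + τ)`, and a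
  -- narrow limit of these plans couples the limits.
  have hplan : ∀ s t : Icc 0 T, ∃ γ : Measure (Space d × Space d),
      γ.fst = ρ s ∧ γ.snd = ρ t ∧
        ∫⁻ z, edist z.1 z.2 ^ 2 ∂γ ≤ ENNReal.ofReal (2 * C * |(s : ℝ) - t|) := by
    intro s t
    have hm : ∀ k, AEMeasurable
        (fun ω => (G (σ k) ⌈(s : ℝ) / τ (σ k)⌉₊ ω, G (σ k) ⌈(t : ℝ) / τ (σ k)⌉₊ ω))
        ((𝒯 (σ k)).refMeasure ρbar) := fun k =>
      ((hG (σ k)).aemeasurable hK _).prodMk ((hG (σ k)).aemeasurable hK _)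
    refine exists_limit_plan (hρlim s) (hρlim t)
      (fun k => ⟨((𝒯 (σ k)).refMeasure ρbar).map
        (fun ω => (G (σ k) ⌈(s : ℝ) / τ (σ k)⌉₊ ω, G (σ k) ⌈(t : ℝ) / τ (σ k)⌉₊ ω)),
        Measure.isProbabilityMeasure_map (hm k)⟩)
      (fun k => Measure.fst_map_prodMk₀ ((hG (σ k)).aemeasurable hK _))
      (fun k => Measure.snd_map_prodMk₀ ((hG (σ k)).aemeasurable hK _))
      (c := fun k => ENNReal.ofReal (2 * C * (|(s : ℝ) - t| + τ (σ k)))) ?_ ?_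
    · refine ENNReal.tendsto_ofReal ?_
      have := (hτσ.const_add |(s : ℝ) - t|).const_mul (2 * C)
      rwa [add_zero] at this
    · intro k
      rw [ProbabilityMeasure.coe_mk, lintegral_map' (by fun_prop) (hm k)]
      change ∫⁻ ω, edist (G (σ k) ⌈(s : ℝ) / τ (σ k)⌉₊ ω) (G (σ k) ⌈(t : ℝ) / τ (σ k)⌉₊ ω) ^ 2
        ∂(𝒯 (σ k)).refMeasure ρbar ≤ _
      rw [(hG (σ k)).lintegral_edist_sq hK]
      exact ENNReal.ofReal_le_ofReal (hdist (σ k) s t)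
  have hproj : ∀ t (ht : t ∈ Icc 0 T), projIcc 0 T hT.le t = ⟨t, ht⟩ := fun t ht =>
    projIcc_of_mem hT.le ht
  -- Limits are available only on the compact interval; the projection extends them to all real
  -- times.
  refine ⟨σ, hσ, fun t => ρ (projIcc 0 T hT.le t), ?_, ?_, ?_⟩
  · intro t ht
    refine ⟨inferInstance, ?_, ?_⟩
    · refine absolutelyContinuous_of_tendsto (hρlim _) hh
        (fun k => (hG (σ k)).absolutelyContinuous hK _) hC fun k => ?_
      exact (hG (σ k)).internal_energy_le (hτ _) hh hV hV0 hK hρ hsupp (hE _)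
        (hinj _ _ (sub_one_mul_lt_of_le (hτ _) (projIcc 0 T hT.le t).2.1
          (projIcc 0 T hT.le t).2.2))
    · obtain ⟨γ, h1, h2, h3⟩ := hplan t0 (projIcc 0 T hT.le t)
      exact second_moment_lt_top_of_plan h1 h2 (h3.trans_lt ENNReal.ofReal_lt_top)
        (by rw [hρt0]; exact hρ0.moment)
  · refine ⟨(2 * C) ^ (1 / 2 : ℝ), fun s hs t ht => ?_⟩
    obtain ⟨γ, h1, h2, h3⟩ := hplan ⟨s, hs⟩ ⟨t, ht⟩
    rw [← Real.mul_rpow (by positivity) (abs_nonneg _), hproj s hs, hproj t ht, abs_sub_comm]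
    exact W₂_le_of_plan h1 h2 (by positivity) h3
  · intro t ht
    have ht' : t ∈ Icc 0 T := ⟨ht.1.le, ht.2⟩
    simp only [hproj t ht']
    exact narrowTendsto_iff.2 (hρlim ⟨t, ht'⟩)

end Sequence

/-! ### Piecewise affine interpolation -/

/-- Vertex values on an affinely independent set are attained by an affine map. -/
lemma exists_affine_extension {s : Finset (Space d)} (hne : s.Nonempty)
    (hs : AffineIndependent ℝ ((↑) : s → Space d)) (w : Space d → Space d) :
    ∃ (B : Space d →L[ℝ] Space d) (c : Space d), ∀ v ∈ s, B v + c = w v := by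
  obtain ⟨v0, hv0⟩ := hne
  have hli := (affineIndependent_iff_linearIndependent_vsub ℝ ((↑) : s → Space d) ⟨v0, hv0⟩).1 hs
  obtain ⟨g, hg⟩ := LinearMap.exists_extend
    ((Module.Basis.span hli).constr ℝ fun i => w (i : s) - w v0)
  refine ⟨LinearMap.toContinuousLinearMap g, w v0 - g v0, fun v hv => ?_⟩
  rcases eq_or_ne v v0 with rfl | hvv
  · simp
  · have h1 : g (v - v0) = w v - w v0 := by
      have h2 := congrArg (fun f => f (Module.Basis.span hli ⟨⟨v, hv⟩, by simpa using hvv⟩)) hg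
      simp only [LinearMap.comp_apply, Module.Basis.constr_basis] at h2
      rw [← h2, Module.Basis.span_apply]
      rfl
    rw [map_sub] at h1
    change g v + (w v0 - g v0) = w v
    rw [add_comm, sub_add_eq_add_sub, add_sub_assoc, h1, add_sub_cancel]

/-- `F` is given by the affine map `ω ↦ B s ω + c s` on each cell `s`. -/
def IsAffineOnCells (𝒯 : Mesh K) (F : Space d → Space d)
    (B : Finset (Space d) → Space d →L[ℝ] Space d) (c : Finset (Space d) → Space d) : Prop :=
  ∀ s ∈ 𝒯.cells, ∀ ω ∈ simplex s, F ω = B s ω + c s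

/-- Two affine maps that agree on a set agree on its convex hull. -/
lemma affine_eq_on_convexHull {B B' : Space d →L[ℝ] Space d} {c c' : Space d} {S : Set (Space d)}
    (h : ∀ v ∈ S, B v + c = B' v + c') : ∀ x ∈ convexHull ℝ S, B x + c = B' x + c' := by
  have hconv : Convex ℝ {x | B x + c = B' x + c'} := by
    intro x hx y hy a b ha hb hab
    simp only [Set.mem_ofPred_eq, map_add, map_smul] at hx hy ⊢
    have e1 : a • (B x + c) + b • (B y + c) = a • B x + b • B y + c := by
      rw [smul_add, smul_add, add_add_add_comm, ← add_smul, hab, one_smul]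
    have e2 : a • (B' x + c') + b • (B' y + c') = a • B' x + b • B' y + c' := by
      rw [smul_add, smul_add, add_add_add_comm, ← add_smul, hab, one_smul]
    rw [← e1, ← e2, hx, hy]
  exact fun x hx => convexHull_min h hconv hx

/-- Affine pieces are chosen on all faces, not only on cells. Any two agree at the common vertices,
hence on the intersection of the faces, so they glue to a continuous map along a finite closed
cover. -/
lemma Mesh.exists_interpolant (𝒯 : Mesh K) (w : Space d → Space d) :
    ∃ F B c, ContinuousOn F K ∧ IsAffineOnCells 𝒯 F B c ∧ ∀ s ∈ 𝒯.cells, ∀ v ∈ s, F v = w v := by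
  classical
  choose! B c hBc using fun s (hs : s ∈ 𝒯.faces) => exists_affine_extension
    (𝒯.toSimplicialComplex.nonempty_of_mem_faces hs) (𝒯.indep hs) w
  let F : Space d → Space d := fun x =>
    if h : ∃ s ∈ 𝒯.faces, x ∈ simplex s then B h.choose x + c h.choose else 0
  have hF : ∀ s ∈ 𝒯.faces, ∀ x ∈ simplex s, F x = B s x + c s := by
    intro s hs x hx
    have h : ∃ s ∈ 𝒯.faces, x ∈ simplex s := ⟨s, hs, hx⟩
    simp only [F, dif_pos h]
    refine affine_eq_on_convexHull (S := (h.choose : Set (Space d)) ∩ s) ?_ x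
      (𝒯.inter_subset_convexHull h.choose_spec.1 hs ⟨h.choose_spec.2, hx⟩)
    rintro v ⟨hv1, hv2⟩
    rw [hBc _ h.choose_spec.1 v hv1, hBc s hs v hv2]
  refine ⟨F, B, c, ?_, fun s hs => hF s (𝒯.mem_cells.1 hs).1, fun s hs v hv => ?_⟩
  · have hK : K = ⋃ s : 𝒯.faces, simplex (s : Finset (Space d)) := by
      refine 𝒯.space_eq.symm.trans ?_
      rw [Geometry.SimplicialComplex.space, Set.biUnion_eq_iUnion]
      rfl
    have := 𝒯.finite_faces.to_subtype
    rw [hK]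
    refine (locallyFinite_of_finite _).continuousOn_iUnion
      (fun s => (isCompact_simplex _).isClosed) fun s => ?_
    refine ContinuousOn.congr (f := fun x => B s x + c s) (by fun_prop) fun x hx => ?_
    exact hF s s.2 x hx
  · have hs' := (𝒯.mem_cells.1 hs).1
    rw [hF s hs' v (mem_simplex_of_mem hv), hBc s hs' v hv]

/-! ### Angles -/

lemma AnglesGE.mono {θ θ' : ℝ} (h : θ' ≤ θ) {G : Space d → Space d} {s : Finset (Space d)}
    (hG : AnglesGE θ G s) : AnglesGE θ' G s :=
  fun i hi j hj hij w hw hw0 => h.trans (hG i hi j hj hij w hw hw0)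

/-- A vector whose angles with all vectors of a subspace are at least `θ` has distance at least
`‖u‖ sin θ` from it. -/
lemma norm_mul_sin_le {E : Type*} [NormedAddCommGroup E] [InnerProductSpace ℝ E]
    {W : Submodule ℝ E} {u : E} {θ : ℝ} (hθ0 : 0 ≤ θ)
    (h : ∀ w ∈ W, w ≠ 0 → θ ≤ InnerProductGeometry.angle u w) {w : E} (hw : w ∈ W) :
    ‖u‖ * Real.sin θ ≤ ‖u + w‖ := by
  rcases eq_or_ne w 0 with rfl | hw0
  · rw [add_zero]
    exact mul_le_of_le_one_right (norm_nonneg _) (Real.sin_le_one θ)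
  have h1 := h w hw hw0
  -- Since `W` also contains `-w`, the angle lies in `[θ, π - θ]`, so that `|cos α| ≤ cos θ`.
  have h2 := h (-w) (W.neg_mem hw) (neg_ne_zero.2 hw0)
  rw [InnerProductGeometry.angle_neg_right] at h2
  set α := InnerProductGeometry.angle u w
  have hc1 : Real.cos α ≤ Real.cos θ :=
    Real.cos_le_cos_of_nonneg_of_le_pi hθ0 (InnerProductGeometry.angle_le_pi _ _) h1
  have hc2 : -Real.cos θ ≤ Real.cos α := by
    have := Real.cos_le_cos_of_nonneg_of_le_pi hθ0
      (by linarith [InnerProductGeometry.angle_nonneg u w]) h2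
    rw [Real.cos_pi_sub] at this
    linarith
  have hsq : Real.cos α ^ 2 ≤ Real.cos θ ^ 2 := sq_le_sq' hc2 hc1
  have hin := InnerProductGeometry.cos_angle_mul_norm_mul_norm u w
  change Real.cos α * (‖u‖ * ‖w‖) = _ at hin
  refine le_of_sq_le_sq ?_ (norm_nonneg _)
  rw [norm_add_sq_real, ← hin, mul_pow, Real.sin_sq]
  -- The difference `‖u + w‖² - ‖u‖² sin² α` is exactly the square `(‖w‖ + ‖u‖ cos α)²`.
  nlinarith [sq_nonneg (‖w‖ + ‖u‖ * Real.cos α),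
    mul_nonneg (sub_nonneg.2 hsq) (sq_nonneg ‖u‖)]

/-- A linear map that is small on the edges at a vertex of a non-degenerate simplex is small. -/
lemma norm_le_of_anglesGE {θ η : ℝ} (hθ0 : 0 < θ) (hθ : θ ≤ Real.pi / 2) (hη : 0 ≤ η)
    {G : Space d → Space d} {s : Finset (Space d)} (hs : s.card = d + 1) (hang : AnglesGE θ G s)
    {v0 : Space d} (hv0 : v0 ∈ s)
    (hspan : Submodule.span ℝ ((fun v => G v - G v0) '' (s : Set (Space d))) = ⊤)
    {N : Space d →L[ℝ] Space d} (hN : ∀ v ∈ s, ‖N (G v - G v0)‖ ≤ η * ‖G v - G v0‖) :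
    ‖N‖ ≤ d * η / Real.sin θ := by
  classical
  have hsin : 0 < Real.sin θ := Real.sin_pos_of_pos_of_lt_pi hθ0 (by linarith [Real.pi_pos])
  refine ContinuousLinearMap.opNorm_le_bound _ (by positivity) fun x => ?_
  have hx : x ∈ Submodule.span ℝ ((fun v => G v - G v0) '' (s.erase v0 : Finset (Space d))) := by
    have hle : (⊤ : Submodule ℝ (Space d))
        ≤ Submodule.span ℝ ((fun v => G v - G v0) '' (s.erase v0 : Finset (Space d))) := by
      rw [← hspan, Submodule.span_le]
      rintro _ ⟨v, hv, rfl⟩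
      rcases eq_or_ne v v0 with rfl | hne
      · simp
      · exact Submodule.subset_span ⟨v, Finset.mem_coe.2 (Finset.mem_erase.2 ⟨hne, hv⟩), rfl⟩
    exact hle trivial
  obtain ⟨a, ha⟩ := (Submodule.mem_span_image_finset_iff_exists_fun ℝ).1 hx
  -- Dividing `x` by its coefficient `a i` exhibits edge `i` plus a vector in the span of the other
  -- edges, and the angle condition bounds such a sum from below.
  have hcoef : ∀ i : (s.erase v0 : Finset (Space d)),
      |a i| * ‖G i - G v0‖ * Real.sin θ ≤ ‖x‖ := by
    intro i
    rcases eq_or_ne (a i) 0 with h0 | h0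
    · rw [h0]; simp
    obtain ⟨hi1, hi2⟩ := Finset.mem_erase.1 i.2
    set W := Submodule.span ℝ ((fun l => G l - G v0) '' ((s : Set (Space d)) \ {v0, ↑i}))
    have hrest : ∑ j ∈ Finset.univ.erase i, a j • (G j - G v0) ∈ W := by
      refine Submodule.sum_mem _ fun j hj => Submodule.smul_mem _ _ (Submodule.subset_span ?_)
      obtain ⟨hj1, hj2⟩ := Finset.mem_erase.1 j.2
      refine ⟨j, ⟨hj2, ?_⟩, rfl⟩
      simp only [mem_insert_iff, mem_singleton_iff, not_or]
      exact ⟨hj1, fun h => (Finset.mem_erase.1 hj).1 (Subtype.ext h)⟩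
    have hx2 : (a i)⁻¹ • x
        = (G i - G v0) + (a i)⁻¹ • ∑ j ∈ Finset.univ.erase i, a j • (G j - G v0) := by
      rw [← ha, ← Finset.add_sum_erase _ _ (Finset.mem_univ i), smul_add, smul_smul,
        inv_mul_cancel₀ h0, one_smul]
    have := norm_mul_sin_le hθ0.le (hang v0 hv0 i hi2 hi1.symm)
      (W.smul_mem (a i)⁻¹ hrest)
    rw [← hx2, norm_smul, norm_inv, Real.norm_eq_abs,
      le_inv_mul_iff₀ (abs_pos.2 h0)] at this
    linarith
  calc ‖N x‖ = ‖∑ i, a i • N (G i - G v0)‖ := by rw [← ha, map_sum]; simp only [map_smul]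
    _ ≤ ∑ i, |a i| * ‖N (G i - G v0)‖ := by
        refine (norm_sum_le _ _).trans (Finset.sum_le_sum fun i _ => ?_)
        rw [norm_smul, Real.norm_eq_abs]
    _ ≤ ∑ i : (s.erase v0 : Finset (Space d)), η * ‖x‖ / Real.sin θ := by
        refine Finset.sum_le_sum fun i _ => ?_
        rw [le_div_iff₀ hsin]
        calc |a i| * ‖N (G i - G v0)‖ * Real.sin θ
            ≤ |a i| * (η * ‖G i - G v0‖) * Real.sin θ := by
              gcongr
              exact hN i (Finset.mem_of_mem_erase i.2)
          _ = η * (|a i| * ‖G i - G v0‖ * Real.sin θ) := by ring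
          _ ≤ η * ‖x‖ := by gcongr; exact hcoef i
    _ = d * η / Real.sin θ * ‖x‖ := by
        rw [Finset.sum_const, Finset.card_univ, Fintype.card_coe, Finset.card_erase_of_mem hv0, hs,
          Nat.add_sub_cancel, nsmul_eq_mul]
        ring

/-! ### The derivative of the determinant -/

/-- The increment has the form `M.comp A` so that `A` factors out and only `det (1 + t M)` is
differentiated; `M` is then a gradient in image coordinates. -/
lemma hasDerivAt_det_add_smul (A M : Space d →L[ℝ] Space d) :
    HasDerivAt (fun t : ℝ => (A + t • M.comp A).det)
      (A.det * LinearMap.trace ℝ (Space d) (M : Space d →ₗ[ℝ] Space d)) 0 := by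
  classical
  let b := (EuclideanSpace.basisFun (Fin d) ℝ).toBasis
  let m := LinearMap.toMatrix b b (M : Space d →ₗ[ℝ] Space d)
  have h1 : ∀ t : ℝ, (A + t • M.comp A).det = (1 + t • m).det * A.det := by
    intro t
    have : A + t • M.comp A = (1 + t • M).comp A := by
      ext x; simp
    rw [this]
    change LinearMap.det (((1 + t • M : Space d →L[ℝ] Space d) : Space d →ₗ[ℝ] Space d)
      ∘ₗ (A : Space d →ₗ[ℝ] Space d)) = _
    rw [LinearMap.det_comp, ← LinearMap.det_toMatrix b]
    congr 2
    change LinearMap.toMatrix b b (LinearMap.id + t • (M : Space d →ₗ[ℝ] Space d)) = _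
    rw [map_add, LinearMap.toMatrix_id, map_smul]
  -- The remainder of `det (1 + t m)` after its linear part is `t ^ 2` times this polynomial.
  let p : Polynomial ℝ :=
    (1 + (Polynomial.X : Polynomial ℝ) • m.map Polynomial.C).det.divX.divX
  have h3 : ∀ t : ℝ, (A + t • M.comp A).det
      = (1 + m.trace * t + p.eval t * t ^ 2) * A.det := fun t => by
    rw [h1, Matrix.det_one_add_smul]
  rw [funext h3]
  have h2 : HasDerivAt (fun t : ℝ => (1 + m.trace * t + p.eval t * t ^ 2) * A.det)
      ((0 + m.trace * 1 + (p.derivative.eval 0 * 0 ^ 2 + p.eval 0 * (2 * 0 ^ 1 * 1))) * A.det)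
      0 := by
    refine HasDerivAt.mul_const ?_ _
    refine ((hasDerivAt_const _ _).add ((hasDerivAt_id _).const_mul _)).add ?_
    exact (p.hasDerivAt 0).mul ((hasDerivAt_id (0 : ℝ)).pow 2)
  convert h2 using 1
  rw [LinearMap.trace_eq_matrix_trace ℝ b]
  simp only [m]
  ring

/-! ### The discrete Euler–Lagrange equation -/

lemma add_zero_smul_comp (A M : Space d →L[ℝ] Space d) : A + (0 : ℝ) • M.comp A = A := by
  ext x; simp

section Variation

variable {𝒯 : Mesh K} {ρbar : Measure (Space d)}

lemma hasDerivAt_integral_potential (hK : IsCompact K) [IsFiniteMeasure (𝒯.refMeasure ρbar)]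
    {V : Space d → ℝ} (hV : ContDiff ℝ 1 V) {G F : Space d → Space d} (hG : ContinuousOn G K)
    (hF : ContinuousOn F K) :
    HasDerivAt (fun t : ℝ => ∫ ω, V (G ω + t • F ω) ∂𝒯.refMeasure ρbar)
      (∫ ω, fderiv ℝ V (G ω) (F ω) ∂𝒯.refMeasure ρbar) 0 := by
  have hV' : Continuous (fderiv ℝ V) := hV.continuous_fderiv (by simp)
  have hcont : ContinuousOn (fun z : ℝ × Space d => fderiv ℝ V (G z.2 + z.1 • F z.2) (F z.2))
      (Icc (-1) 1 ×ˢ K) := by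
    have hG2 : ContinuousOn (fun z : ℝ × Space d => G z.2) (Icc (-1) 1 ×ˢ K) :=
      hG.comp continuousOn_snd fun z hz => hz.2
    have hF2 : ContinuousOn (fun z : ℝ × Space d => F z.2) (Icc (-1) 1 ×ˢ K) :=
      hF.comp continuousOn_snd fun z hz => hz.2
    exact (hV'.comp_continuousOn (hG2.add (continuousOn_fst.smul hF2))).clm_apply hF2
  obtain ⟨C, hC⟩ := (isCompact_Icc.prod hK).exists_bound_of_continuousOn hcont
  have hcω : ∀ t : ℝ, ContinuousOn (fun ω => G ω + t • F ω) K := fun t =>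
    hG.add (hF.const_smul t)
  have h := hasDerivAt_integral_of_dominated_loc_of_deriv_le (μ := 𝒯.refMeasure ρbar)
    (F := fun (t : ℝ) ω => V (G ω + t • F ω)) (x₀ := 0) (s := Icc (-1) 1)
    (F' := fun t ω => fderiv ℝ V (G ω + t • F ω) (F ω)) (bound := fun _ => C)
    (Icc_mem_nhds (by norm_num) (by norm_num))
    (Eventually.of_forall fun t => (Mesh.integrable_refMeasure hK
      (hV.continuous.comp_continuousOn (hcω t))).aestronglyMeasurable)
    (Mesh.integrable_refMeasure hK (hV.continuous.comp_continuousOn (hcω 0)))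
    (Mesh.integrable_refMeasure hK
      ((hV'.comp_continuousOn (hcω 0)).clm_apply hF)).aestronglyMeasurable
    (Mesh.ae_refMeasure_mem.mono fun ω hω t ht => hC (t, ω) ⟨ht, hω⟩)
    (integrable_const C)
    (Eventually.of_forall fun ω t _ => by
      have h1 : HasDerivAt (fun t : ℝ => G ω + t • F ω) (F ω) t := by
        simpa using ((hasDerivAt_id t).smul_const (F ω)).const_add (G ω)
      exact ((hV.differentiable (by simp)) _).hasFDerivAt.comp_hasDerivAt t h1)
  simpa using h.2

lemma hasDerivAt_integral_sq (hK : IsCompact K) [IsFiniteMeasure (𝒯.refMeasure ρbar)]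
    {H F : Space d → Space d} (hH : ContinuousOn H K) (hF : ContinuousOn F K) :
    HasDerivAt (fun t : ℝ => ∫ ω, ‖H ω + t • F ω‖ ^ 2 ∂𝒯.refMeasure ρbar)
      (2 * ∫ ω, inner ℝ (H ω) (F ω) ∂𝒯.refMeasure ρbar) 0 := by
  have h1 : ∀ t : ℝ, ∫ ω, ‖H ω + t • F ω‖ ^ 2 ∂𝒯.refMeasure ρbar
      = (∫ ω, ‖H ω‖ ^ 2 ∂𝒯.refMeasure ρbar)
        + (2 * ∫ ω, inner ℝ (H ω) (F ω) ∂𝒯.refMeasure ρbar) * t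
        + (∫ ω, ‖F ω‖ ^ 2 ∂𝒯.refMeasure ρbar) * t ^ 2 := by
    intro t
    have i1 : Integrable (fun ω => ‖H ω‖ ^ 2) (𝒯.refMeasure ρbar) :=
      Mesh.integrable_refMeasure hK (hH.norm.pow 2)
    have i2 : Integrable (fun ω => inner ℝ (H ω) (F ω)) (𝒯.refMeasure ρbar) :=
      Mesh.integrable_refMeasure hK (hH.inner hF)
    have i3 : Integrable (fun ω => ‖F ω‖ ^ 2) (𝒯.refMeasure ρbar) :=
      Mesh.integrable_refMeasure hK (hF.norm.pow 2)
    have hpt : ∀ ω, ‖H ω + t • F ω‖ ^ 2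
        = ‖H ω‖ ^ 2 + (2 * t) * inner ℝ (H ω) (F ω) + t ^ 2 * ‖F ω‖ ^ 2 := by
      intro ω
      rw [norm_add_sq_real, norm_smul, inner_smul_right, mul_pow, Real.norm_eq_abs, sq_abs]
      ring
    simp_rw [hpt]
    have i12 : Integrable (fun ω => ‖H ω‖ ^ 2 + 2 * t * inner ℝ (H ω) (F ω))
      (𝒯.refMeasure ρbar) := i1.add (i2.const_mul _)
    rw [integral_add i12 (i3.const_mul _), integral_add i1 (i2.const_mul _), integral_const_mul, integral_const_mul]
    ring
  rw [funext h1]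
  have h2 := (((hasDerivAt_id (0 : ℝ)).const_mul
    (2 * ∫ ω, inner ℝ (H ω) (F ω) ∂𝒯.refMeasure ρbar)).const_add
    (∫ ω, ‖H ω‖ ^ 2 ∂𝒯.refMeasure ρbar)).add (((hasDerivAt_id (0 : ℝ)).pow 2).const_mul
    (∫ ω, ‖F ω‖ ^ 2 ∂𝒯.refMeasure ρbar))
  exact h2.congr_deriv (by simp)

/-- Chain rule through `hTilde`: the cell weight cancels, leaving pressure times image volume times
the divergence of the perturbation. -/
lemma hasDerivAt_internalPart {h : ℝ → ℝ} (hh : IsInternalEnergy h) (hρ : IsP2ac ρbar)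
    (hsupp : ρbar.support = K) {A M : Finset (Space d) → Space d →L[ℝ] Space d}
    (hA : ∀ s ∈ 𝒯.cells, 0 < (A s).det) :
    HasDerivAt (fun t : ℝ => internalPart h 𝒯 ρbar fun s => A s + t • (M s).comp (A s))
      (-∑ s ∈ 𝒯.cells, pressure h (cellWeight ρbar s / (A s).det)
        * ((A s).det * (volume (simplex s)).toReal)
        * LinearMap.trace ℝ (Space d) (M s : Space d →ₗ[ℝ] Space d)) 0 := by
  unfold internalPart
  rw [← Finset.sum_neg_distrib]
  refine HasDerivAt.fun_sum fun s hs => ?_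
  have hc := Mesh.cellWeight_pos hρ hsupp hs
  have h1 := (hasDerivAt_det_add_smul (A s) (M s)).div_const (cellWeight ρbar s)
  have h2 : HasDerivAt (hTilde h) (-pressure h ((A s).det / cellWeight ρbar s)⁻¹)
      ((A s + (0 : ℝ) • (M s).comp (A s)).det / cellWeight ρbar s) := by
    rw [add_zero_smul_comp]
    exact hh.hasDerivAt_hTilde (div_pos (hA s hs) hc)
  have h3 := (h2.comp (0 : ℝ) h1).const_mul (cellWeight ρbar s * (volume (simplex s)).toReal)
  rw [inv_div] at h3
  refine h3.congr_deriv ?_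
  field_simp

end Variation

/-- The discrete Euler–Lagrange equation, tested with a piecewise affine field `F`; here `M s` is
the gradient of `F` in image coordinates. -/
lemma IsDiscreteSolution.eulerLagrange {𝒯 : Mesh K} {ρbar : Measure (Space d)} {h : ℝ → ℝ}
    {V : Space d → ℝ} {τ : ℝ} {G : ℕ → Space d → Space d}
    (hG : IsDiscreteSolution h V ρbar 𝒯 τ G) (hτ : 0 < τ) (hh : IsInternalEnergy h)
    (hV : ContDiff ℝ 1 V) (hK : IsCompact K) (hρ : IsP2ac ρbar) (hsupp : ρbar.support = K) (n : ℕ)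
    {A M : Finset (Space d) → Space d →L[ℝ] Space d} {b c : Finset (Space d) → Space d}
    (hA : IsCellwise 𝒯 (G (n + 1)) A b) {F : Space d → Space d} (hFc : ContinuousOn F K)
    (hF : IsAffineOnCells 𝒯 F (fun s => (M s).comp (A s)) c) :
    τ⁻¹ * (∫ ω, inner ℝ (G (n + 1) ω - G n ω) (F ω) ∂𝒯.refMeasure ρbar)
      - ∑ s ∈ 𝒯.cells, pressure h (cellWeight ρbar s / (A s).det)
        * ((A s).det * (volume (simplex s)).toReal)
        * LinearMap.trace ℝ (Space d) (M s : Space d →ₗ[ℝ] Space d)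
      + ∫ ω, fderiv ℝ V (G (n + 1) ω) (F ω) ∂𝒯.refMeasure ρbar = 0 := by
  have := Mesh.isProbabilityMeasure_refMeasure (𝒯 := 𝒯) hρ hsupp
  have hc1 := (hG.ansatz (n + 1)).continuousOn
  have hc0 := (hG.ansatz n).continuousOn
  let g : ℝ → ℝ := fun t =>
    1 / (2 * τ) * (∫ ω, ‖(G (n + 1) ω - G n ω) + t • F ω‖ ^ 2 ∂𝒯.refMeasure ρbar)
      + (internalPart h 𝒯 ρbar (fun s => A s + t • (M s).comp (A s))
        + ∫ ω, V (G (n + 1) ω + t • F ω) ∂𝒯.refMeasure ρbar)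
  have hg := ((hasDerivAt_integral_sq (ρbar := ρbar) (𝒯 := 𝒯) hK (hc1.sub hc0) hFc).const_mul
    (1 / (2 * τ))).add ((hasDerivAt_internalPart (𝒯 := 𝒯) (M := M) hh hρ hsupp hA.det_pos).add
      (hasDerivAt_integral_potential (ρbar := ρbar) (𝒯 := 𝒯) hK hV hc1 hFc))
  -- The perturbed map is admissible for small `t` of either sign, which gives an equation and not
  -- merely an inequality.
  have hpos : ∀ᶠ t : ℝ in 𝓝 0, ∀ s ∈ 𝒯.cells, 0 < (A s + t • (M s).comp (A s)).det := by
    rw [Filter.eventually_all_finset]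
    intro s hs
    refine (hasDerivAt_det_add_smul (A s) (M s)).continuousAt.eventually_const_lt ?_
    simp only [add_zero_smul_comp]
    exact hA.det_pos s hs
  have hstep : ∀ t : ℝ, (∀ s ∈ 𝒯.cells, 0 < (A s + t • (M s).comp (A s)).det) →
      IsAnsatzMap 𝒯 (fun ω => G (n + 1) ω + t • F ω) ∧
      stepEnergy h V ρbar 𝒯 τ (fun ω => G (n + 1) ω + t • F ω) (G n) = g t := by
    intro t ht
    have hcont : ContinuousOn (fun ω => G (n + 1) ω + t • F ω) K := hc1.add (hFc.const_smul t)
    have hcell : IsCellwise 𝒯 (fun ω => G (n + 1) ω + t • F ω)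
        (fun s => A s + t • (M s).comp (A s)) (fun s => b s + t • c s) := by
      refine ⟨ht, fun s hs ω hω => ?_⟩
      simp only [hA.eq s hs ω hω, hF s hs ω hω, add_apply,
        smul_apply, smul_add]
      abel
    refine ⟨⟨hcont, fun s hs => ⟨_, _, ht s hs, hcell.eq s hs⟩⟩, ?_⟩
    rw [stepEnergy_eq, hcell.transEntropy_eq hcont hK h hV.continuous]
    simp only [g, add_sub_right_comm]
  have hmin : IsLocalMin g 0 := by
    have h0 := hstep 0 (by simpa only [add_zero_smul_comp] using hA.det_pos)
    filter_upwards [hpos] with t ht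
    obtain ⟨h1, h2⟩ := hstep t ht
    rw [← h2, ← h0.2]
    simpa using hG.isMin n _ h1
  have := hmin.hasDerivAt_eq_zero hg
  simp only [Pi.sub_apply] at this
  rw [← this]
  field_simp
  ring

/-! ### The one-step consistency estimate -/

/-- Quantitative bounds on a test function `f` with gradient `ξ` and Hessian `D`, where the
derivatives vanish outside of `X`. -/
structure IsTestField (L : ℝ) (X : Set (Space d)) (f : Space d → ℝ) (ξ : Space d → Space d)
    (D : Space d → Space d →L[ℝ] Space d) : Prop where
  continuous : Continuous f
  taylor : ∀ x y, |f y - f x - inner ℝ (ξ x) (y - x)| ≤ L * ‖y - x‖ ^ 2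
  lipschitz : ∀ x y, ‖ξ y - ξ x‖ ≤ L * ‖y - x‖
  taylor_gradient : ∀ x y, ‖ξ y - ξ x - D x (y - x)‖ ≤ L * ‖y - x‖ ^ 2
  lipschitz_hessian : ∀ x y, ‖D y - D x‖ ≤ L * ‖y - x‖
  gradient_eq_zero : ∀ x, x ∉ X → ξ x = 0
  hessian_eq_zero : ∀ x, x ∉ X → D x = 0

lemma continuous_of_norm_sub_le {E F : Type*} [NormedAddCommGroup E] [NormedAddCommGroup F]
    {L : ℝ} (hL : 0 ≤ L) {f : E → F} (h : ∀ x y, ‖f y - f x‖ ≤ L * ‖y - x‖) : Continuous f :=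
  (LipschitzWith.of_dist_le_mul (K := ⟨L, hL⟩) fun x y => by
    rw [dist_eq_norm, dist_eq_norm]; exact h y x).continuous

lemma abs_trace_le (N : Space d →L[ℝ] Space d) :
    |LinearMap.trace ℝ (Space d) (N : Space d →ₗ[ℝ] Space d)| ≤ d * ‖N‖ := by
  rw [LinearMap.trace_eq_sum_inner _ (EuclideanSpace.basisFun (Fin d) ℝ)]
  calc _ ≤ ∑ _i : Fin d, ‖N‖ := by
        refine (Finset.abs_sum_le_sum_abs _ _).trans (Finset.sum_le_sum fun i _ => ?_)
        refine (abs_real_inner_le_norm _ _).trans ?_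
        rw [OrthonormalBasis.norm_eq_one, one_mul]
        refine (N.le_opNorm _).trans ?_
        rw [OrthonormalBasis.norm_eq_one, mul_one]
    _ = d * ‖N‖ := by simp

lemma affine_mem_closedBall {B : Space d →L[ℝ] Space d} {c y : Space d} {r : ℝ}
    {S : Set (Space d)} (h : ∀ v ∈ S, ‖B v + c - y‖ ≤ r) :
    ∀ x ∈ convexHull ℝ S, ‖B x + c - y‖ ≤ r := by
  have hconv : Convex ℝ (B ⁻¹' ((fun z => z + c) ⁻¹' Metric.closedBall y r)) :=
    ((convex_closedBall y r).translate_preimage_left c).linear_preimage (B : Space d →ₗ[ℝ] Space d)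
  intro x hx
  have := convexHull_min (fun v hv => by
    change B v + c ∈ Metric.closedBall y r
    rw [mem_closedBall_iff_norm]; exact h v hv) hconv hx
  rwa [mem_preimage, mem_preimage, mem_closedBall_iff_norm] at this

lemma span_image_vertices {𝒯 : Mesh K} {G : Space d → Space d}
    {A : Finset (Space d) → Space d →L[ℝ] Space d} {b : Finset (Space d) → Space d}
    (hG : IsCellwise 𝒯 G A b) {s : Finset (Space d)} (hs : s ∈ 𝒯.cells) {v0 : Space d}
    (hv0 : v0 ∈ s) :
    Submodule.span ℝ ((fun v => G v - G v0) '' (s : Set (Space d))) = ⊤ := by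
  have h1 : (fun v => G v - G v0) '' (s : Set (Space d))
      = (A s : Space d →ₗ[ℝ] Space d) '' ((fun v => v -ᵥ v0) '' (s : Set (Space d))) := by
    rw [Set.image_image]
    refine Set.image_congr fun v hv => ?_
    rw [hG.eq s hs v (mem_simplex_of_mem hv), hG.eq s hs v0 (mem_simplex_of_mem hv0)]
    simp
  rw [h1, Submodule.span_image, ← vectorSpan_eq_span_vsub_set_right ℝ (Finset.mem_coe.2 hv0),
    ← direction_affineSpan, Mesh.affineSpan_cell hs, AffineSubspace.direction_top,
    Submodule.map_top, LinearMap.range_eq_top]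
  exact ((A s).toContinuousLinearEquivOfDetNeZero (hG.det_pos s hs).ne').surjective

/-! ### Interpolation of a test field on the image mesh -/

section OneStep

variable {𝒯 : Mesh K} {ρbar : Measure (Space d)} {L δ θ : ℝ} {X : Set (Space d)}
  {f : Space d → ℝ} {ξ : Space d → Space d} {D : Space d → Space d →L[ℝ] Space d}
  {G : Space d → Space d}
  {A : Finset (Space d) → Space d →L[ℝ] Space d} {b : Finset (Space d) → Space d}

/-- Compactness supplies boundedness, without which `Metric.diam` could be the default value `0`. -/
lemma dist_image_le (hGc : ContinuousOn G K) {s : Finset (Space d)} (hs : s ∈ 𝒯.cells)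
    (hdiam : Metric.diam (G '' simplex s) ≤ δ) {x y : Space d} (hx : x ∈ G '' simplex s)
    (hy : y ∈ G '' simplex s) : dist x y ≤ δ :=
  (Metric.dist_le_diam_of_mem ((isCompact_simplex s).image_of_continuousOn
    (hGc.mono (Mesh.cell_subset hs))).isBounded hx hy).trans hdiam

/-- The interpolant of a test field on the image mesh, with its error estimates. -/
lemma exists_interpolant_estimates (hL : 0 ≤ L) (hδ : 0 ≤ δ) (hθ0 : 0 < θ) (hθ : θ ≤ Real.pi / 2)
    (htest : IsTestField L X f ξ D) (hG : IsCellwise 𝒯 G A b) (hGc : ContinuousOn G K)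
    (hang : ∀ s ∈ 𝒯.cells, AnglesGE θ G s)
    (hdiam : ∀ s ∈ 𝒯.cells, Metric.diam (G '' simplex s) ≤ δ) :
    ∃ (F : Space d → Space d) (M : Finset (Space d) → Space d →L[ℝ] Space d)
      (c : Finset (Space d) → Space d), ContinuousOn F K ∧ IsAffineOnCells 𝒯 F (fun s => (M s).comp (A s)) c ∧
      (∀ s ∈ 𝒯.cells, ∀ ω ∈ simplex s, ‖F ω - ξ (G ω)‖ ≤ L * δ) ∧
      (∀ s ∈ 𝒯.cells, ∀ ω ∈ simplex s, G ω ∉ Metric.cthickening δ X → F ω = 0 ∧ ξ (G ω) = 0) ∧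
      (∀ s ∈ 𝒯.cells, ∀ x ∈ G '' simplex s,
        |LinearMap.trace ℝ (Space d) (M s : Space d →ₗ[ℝ] Space d)
          - LinearMap.trace ℝ (Space d) (D x : Space d →ₗ[ℝ] Space d)|
          ≤ d * (d * (L * δ) / Real.sin θ + L * δ)) ∧
      (∀ s ∈ 𝒯.cells, ∀ x ∈ G '' simplex s, x ∉ Metric.cthickening δ X → M s = 0 ∧ D x = 0) := by
  -- The field interpolates `ξ ∘ G` at the vertices, and `M s` is its gradient `B s ∘ (A s)⁻¹` in
  -- image coordinates.
  obtain ⟨F, B, c, hFc, hF, hFv⟩ := 𝒯.exists_interpolant fun v => ξ (G v)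
  have hinv : ∀ s ∈ 𝒯.cells, ∃ M : Space d →L[ℝ] Space d, M.comp (A s) = B s := by
    intro s hs
    let e := (A s).toContinuousLinearEquivOfDetNeZero (hG.det_pos s hs).ne'
    refine ⟨(B s).comp (e.symm : Space d →L[ℝ] Space d), ?_⟩
    ext1 x
    change B s (e.symm (e x)) = B s x
    rw [e.symm_apply_apply]
  choose! M hM using hinv
  have hvert : ∀ s ∈ 𝒯.cells, ∀ v ∈ s, B s v + c s = ξ (G v) := fun s hs v hv => by
    rw [← hF s hs v (mem_simplex_of_mem hv), hFv s hs v hv]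
  have hMedge : ∀ s ∈ 𝒯.cells, ∀ v ∈ s, ∀ v0 ∈ s, M s (G v - G v0) = ξ (G v) - ξ (G v0) := by
    intro s hs v hv v0 hv0
    rw [← hvert s hs v hv, ← hvert s hs v0 hv0, hG.eq s hs v (mem_simplex_of_mem hv),
      hG.eq s hs v0 (mem_simplex_of_mem hv0), add_sub_add_right_eq_sub, add_sub_add_right_eq_sub,
      ← map_sub, ← map_sub, ← hM s hs]
    rfl
  -- An image cell of diameter at most `δ` with a point outside the thickening misses `X`
  -- altogether, so all vertex values vanish on it.
  have hfar : ∀ s ∈ 𝒯.cells, ∀ x ∈ G '' simplex s, x ∉ Metric.cthickening δ X →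
      ∀ y ∈ G '' simplex s, y ∉ X := fun s hs x hx hxX y hy hyX =>
    hxX (Metric.mem_cthickening_of_dist_le x y δ X hyX (dist_image_le hGc hs (hdiam s hs) hx hy))
  refine ⟨F, M, c, hFc, fun s hs ω hω => ?_, fun s hs ω hω => ?_, fun s hs ω hω hfarω => ?_,
    fun s hs x hx => ?_, fun s hs x hx hxX => ?_⟩
  · simp only [hF s hs ω hω, hM s hs]
  · rw [hF s hs ω hω]
    refine affine_mem_closedBall (fun v hv => ?_) ω hω
    rw [hvert s hs v hv]
    refine (htest.lipschitz _ _).trans ?_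
    gcongr
    rw [← dist_eq_norm]
    exact dist_image_le hGc hs (hdiam s hs) ⟨v, mem_simplex_of_mem hv, rfl⟩ ⟨ω, hω, rfl⟩
  · have h1 := hfar s hs (G ω) ⟨ω, hω, rfl⟩ hfarω
    refine ⟨?_, htest.gradient_eq_zero _ (h1 _ ⟨ω, hω, rfl⟩)⟩
    rw [hF s hs ω hω, ← norm_le_zero_iff, ← sub_zero (B s ω + c s)]
    refine affine_mem_closedBall (fun v hv => ?_) ω hω
    rw [hvert s hs v hv, htest.gradient_eq_zero _ (h1 _ ⟨v, mem_simplex_of_mem hv, rfl⟩)]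
    simp
  · obtain ⟨v0, hv0⟩ : s.Nonempty := by
      rw [← Finset.card_pos, (𝒯.mem_cells.1 hs).2]; omega
    -- Along an edge the Taylor error `L ‖v - v0‖²`, with image points for `v` and `v0`, is at most
    -- `L δ` times the length of the edge. So `η = L δ`, and the angle bound spreads this to all
    -- directions.
    have hN : ‖M s - D (G v0)‖ ≤ d * (L * δ) / Real.sin θ := by
      refine norm_le_of_anglesGE hθ0 hθ (by positivity) (𝒯.mem_cells.1 hs).2 (hang s hs) hv0
        (span_image_vertices hG hs hv0) fun v hv => ?_
      rw [sub_apply, hMedge s hs v hv v0 hv0]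
      refine (htest.taylor_gradient _ _).trans ?_
      rw [pow_two, mul_assoc]
      gcongr
      rw [← dist_eq_norm]
      exact dist_image_le hGc hs (hdiam s hs) ⟨v, mem_simplex_of_mem hv, rfl⟩
        ⟨v0, mem_simplex_of_mem hv0, rfl⟩
    have hDx : ‖D (G v0) - D x‖ ≤ L * δ := by
      refine (htest.lipschitz_hessian _ _).trans ?_
      gcongr
      rw [← dist_eq_norm]
      exact dist_image_le hGc hs (hdiam s hs) ⟨v0, mem_simplex_of_mem hv0, rfl⟩ hx
    have htr : LinearMap.trace ℝ (Space d) (M s : Space d →ₗ[ℝ] Space d)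
        - LinearMap.trace ℝ (Space d) (D x : Space d →ₗ[ℝ] Space d)
        = LinearMap.trace ℝ (Space d) ((M s - D x : Space d →L[ℝ] Space d) :
            Space d →ₗ[ℝ] Space d) := by
      rw [ContinuousLinearMap.toLinearMap_sub, map_sub]
    rw [htr]
    refine (abs_trace_le _).trans ?_
    gcongr
    calc ‖M s - D x‖ = ‖(M s - D (G v0)) + (D (G v0) - D x)‖ := by rw [sub_add_sub_cancel]
      _ ≤ _ := (norm_add_le _ _).trans (add_le_add hN hDx)
  · have h1 := hfar s hs x hx hxX
    refine ⟨?_, htest.hessian_eq_zero _ (h1 x hx)⟩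
    obtain ⟨v0, hv0⟩ : s.Nonempty := by
      rw [← Finset.card_pos, (𝒯.mem_cells.1 hs).2]; omega
    have hN : ‖M s‖ ≤ d * 0 / Real.sin θ := by
      refine norm_le_of_anglesGE hθ0 hθ le_rfl (𝒯.mem_cells.1 hs).2 (hang s hs) hv0
        (span_image_vertices hG hs hv0) fun v hv => ?_
      rw [hMedge s hs v hv v0 hv0,
        htest.gradient_eq_zero _ (h1 _ ⟨v, mem_simplex_of_mem hv, rfl⟩),
        htest.gradient_eq_zero _ (h1 _ ⟨v0, mem_simplex_of_mem hv0, rfl⟩)]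
      simp
    simpa using hN

lemma integrableOn_image (hGc : ContinuousOn G K)
    {s : Finset (Space d)} (hs : s ∈ 𝒯.cells) {g : Space d → ℝ} (hg : Continuous g) :
    IntegrableOn g (G '' interior (simplex s)) :=
  (hg.continuousOn.integrableOn_compact ((isCompact_simplex s).image_of_continuousOn
    (hGc.mono (Mesh.cell_subset hs)))).mono_set (image_mono interior_subset)

lemma IsCellwise.integral_comp_density_mul (hG : IsCellwise 𝒯 G A b) (hGc : ContinuousOn G K)
    (hK : IsCompact K) (hinj : InjOn G K) {P : ℝ → ℝ} (hP : P 0 = 0) {g : Space d → ℝ}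
    (hg : Continuous g) :
    ∫ x, P (density ((𝒯.refMeasure ρbar).map G) x) * g x
      = ∑ s ∈ 𝒯.cells, P (cellWeight ρbar s / (A s).det)
        * ∫ x in G '' interior (simplex s), g x := by
  have h1 : (fun x => P (density ((𝒯.refMeasure ρbar).map G) x) * g x) =ᵐ[volume]
      fun x => ∑ s ∈ 𝒯.cells, (G '' interior (simplex s)).indicator
        (fun x => P (cellWeight ρbar s / (A s).det) * g x) x := by
    filter_upwards [hG.comp_density_ae_eq hGc hK hinj P hP (ρbar := ρbar)] with x hx
    rw [hx, Finset.sum_mul]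
    refine Finset.sum_congr rfl fun s _ => ?_
    by_cases h : x ∈ G '' interior (simplex s)
    · rw [Set.indicator_of_mem h, Set.indicator_of_mem h]
    · rw [Set.indicator_of_notMem h, Set.indicator_of_notMem h, zero_mul]
  rw [integral_congr_ae h1, integral_finsetSum _ fun s hs =>
    (integrable_indicator_iff (hG.isOpen_image hs).measurableSet).2
      ((integrableOn_image hGc hs hg).const_mul _)]
  refine Finset.sum_congr rfl fun s hs => ?_
  rw [integral_indicator (hG.isOpen_image hs).measurableSet, integral_const_mul]

end OneStep

/-- One step of the scheme satisfies the limit equation up to controlled errors. -/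
lemma IsDiscreteSolution.one_step_estimate {𝒯 : Mesh K} {ρbar : Measure (Space d)} {h : ℝ → ℝ}
    {V : Space d → ℝ} {τ : ℝ} {G : ℕ → Space d → Space d}
    (hG : IsDiscreteSolution h V ρbar 𝒯 τ G) (hτ : 0 < τ) (hh : IsInternalEnergy h)
    (hV : ContDiff ℝ 1 V) (hK : IsCompact K) (hρ : IsP2ac ρbar) (hsupp : ρbar.support = K) (n : ℕ)
    {L δ θ CV : ℝ} (hL : 0 ≤ L) (hδ : 0 ≤ δ) (hθ0 : 0 < θ) (hθ : θ ≤ Real.pi / 2) (hCV : 0 ≤ CV)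
    {X : Set (Space d)} {f : Space d → ℝ} {ξ : Space d → Space d}
    {D : Space d → Space d →L[ℝ] Space d} (htest : IsTestField L X f ξ D)
    (hinj : InjOn (G (n + 1)) K) (hang : ∀ s ∈ 𝒯.cells, AnglesGE θ (G (n + 1)) s)
    (hdiam : ∀ s ∈ 𝒯.cells, Metric.diam (G (n + 1) '' simplex s) ≤ δ)
    (hbV : ∀ x ∈ Metric.cthickening δ X, ‖fderiv ℝ V x‖ ≤ CV)
    {η : Space d → ℝ} (hη : Continuous η) (hη0 : ∀ x, 0 ≤ η x)
    (hη1 : ∀ x ∈ Metric.cthickening δ X, 1 ≤ η x) :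
    |τ⁻¹ * ((∫ ω, f (G (n + 1) ω) ∂𝒯.refMeasure ρbar) - ∫ ω, f (G n ω) ∂𝒯.refMeasure ρbar)
      - (∫ x, pressure h (density (inducedMeasure ρbar 𝒯 G (n + 1)) x)
          * LinearMap.trace ℝ (Space d) (D x : Space d →ₗ[ℝ] Space d))
      + ∫ ω, fderiv ℝ V (G (n + 1) ω) (ξ (G (n + 1) ω)) ∂𝒯.refMeasure ρbar|
      ≤ L * τ⁻¹ * (∫ ω, ‖G (n + 1) ω - G n ω‖ ^ 2 ∂𝒯.refMeasure ρbar)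
        + L * δ * (1 / 2 + (∫ ω, ‖G (n + 1) ω - G n ω‖ ^ 2 ∂𝒯.refMeasure ρbar) / (2 * τ ^ 2))
        + d * (d * (L * δ) / Real.sin θ + L * δ)
          * (∫ x, pressure h (density (inducedMeasure ρbar 𝒯 G (n + 1)) x) * η x)
        + L * δ * CV := by
  have := Mesh.isProbabilityMeasure_refMeasure (𝒯 := 𝒯) hρ hsupp
  have hc1 := (hG.ansatz (n + 1)).continuousOn
  have hc0 := (hG.ansatz n).continuousOn
  obtain ⟨A, b, hA⟩ := (hG.ansatz (n + 1)).exists_cellwise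
  obtain ⟨F, M, c, hFc, hF, hFξ, hFfar, htr, hfar⟩ :=
    exists_interpolant_estimates hL hδ hθ0 hθ htest hA hc1 hang hdiam
  -- The quantity to estimate is this vanishing expression plus four replacement errors: the
  -- increment of `f` by its linearization (`e1`), `ξ ∘ G` by `F` (`e2` and `e4`), and the trace of
  -- `D` by that of `M s` (`e3`).
  have hEL := hG.eulerLagrange hτ hh hV hK hρ hsupp n hA hFc hF
  have hξ : Continuous ξ := continuous_of_norm_sub_le hL htest.lipschitz
  have hD : Continuous D := continuous_of_norm_sub_le hL htest.lipschitz_hessian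
  have hV' : Continuous (fderiv ℝ V) := hV.continuous_fderiv (by simp)
  have hξG : ContinuousOn (fun ω => ξ (G (n + 1) ω)) K := hξ.comp_continuousOn hc1
  have hR := hG.integrable_sq_dist hK (n + 1) n (ρbar := ρbar)
  set R := ∫ ω, ‖G (n + 1) ω - G n ω‖ ^ 2 ∂𝒯.refMeasure ρbar
  set a := ∫ ω, inner ℝ (G (n + 1) ω - G n ω) (F ω) ∂𝒯.refMeasure ρbar
  set a' := ∫ ω, inner ℝ (G (n + 1) ω - G n ω) (ξ (G (n + 1) ω)) ∂𝒯.refMeasure ρbar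
  set S := ∑ s ∈ 𝒯.cells, pressure h (cellWeight ρbar s / (A s).det)
        * ((A s).det * (volume (simplex s)).toReal)
        * LinearMap.trace ℝ (Space d) (M s : Space d →ₗ[ℝ] Space d)
  set κ := d * (d * (L * δ) / Real.sin θ + L * δ)
  have hia : Integrable (fun ω => inner ℝ (G (n + 1) ω - G n ω) (F ω)) (𝒯.refMeasure ρbar) :=
    Mesh.integrable_refMeasure hK ((hc1.sub hc0).inner hFc)
  have hia' : Integrable (fun ω => inner ℝ (G (n + 1) ω - G n ω) (ξ (G (n + 1) ω)))
      (𝒯.refMeasure ρbar) := Mesh.integrable_refMeasure hK ((hc1.sub hc0).inner hξG)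
  have hae : ∀ᵐ ω ∂𝒯.refMeasure ρbar, ∃ s ∈ 𝒯.cells, ω ∈ simplex s :=
    Mesh.ae_refMeasure_mem_interior.mono fun ω ⟨s, hs, hω⟩ => ⟨s, hs, interior_subset hω⟩
  have e1 : |τ⁻¹ * (((∫ ω, f (G (n + 1) ω) ∂𝒯.refMeasure ρbar)
      - ∫ ω, f (G n ω) ∂𝒯.refMeasure ρbar) - a')| ≤ L * τ⁻¹ * R := by
    have hi1 := hG.integrable_comp hK htest.continuous (n + 1) (ρbar := ρbar)
    have hi0 := hG.integrable_comp hK htest.continuous n (ρbar := ρbar)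
    rw [abs_mul, abs_of_pos (inv_pos.2 hτ), mul_comm L, mul_assoc]
    gcongr
    have hi10 : Integrable (fun ω => f (G (n + 1) ω) - f (G n ω)) (𝒯.refMeasure ρbar) :=
      hi1.sub hi0
    rw [← integral_sub hi1 hi0, ← integral_sub hi10 hia', ← integral_const_mul]
    refine abs_integral_le_integral_abs.trans
      (integral_mono (hi10.sub hia').abs (hR.const_mul _) fun ω => ?_)
    have := htest.taylor (G (n + 1) ω) (G n ω)
    rw [← neg_sub (G (n + 1) ω), inner_neg_right, norm_neg,
      real_inner_comm, ← abs_neg] at this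
    refine le_trans (le_of_eq ?_) this
    congr 1
    ring
  have e2 : |τ⁻¹ * (a' - a)| ≤ L * δ * (1 / 2 + R / (2 * τ ^ 2)) := by
    rw [← integral_sub hia' hia, ← integral_const_mul]
    have hrhs : L * δ * (1 / 2 + R / (2 * τ ^ 2))
        = ∫ ω, L * δ * (1 / 2 + ‖G (n + 1) ω - G n ω‖ ^ 2 / (2 * τ ^ 2))
            ∂𝒯.refMeasure ρbar := by
      have hdiv : ∫ ω, ‖G (n + 1) ω - G n ω‖ ^ 2 / (2 * τ ^ 2) ∂𝒯.refMeasure ρbar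
          = R / (2 * τ ^ 2) := integral_div _ _
      rw [integral_const_mul, integral_add (integrable_const _) (hR.div_const _), hdiv,
        integral_const, probReal_univ, one_smul]
    rw [hrhs]
    refine abs_integral_le_integral_abs.trans (integral_mono_ae ((hia'.sub hia).const_mul _).abs
      (((integrable_const _).add (hR.div_const _)).const_mul _) ?_)
    filter_upwards [hae] with ω ⟨s, hs, hω⟩
    rw [← inner_sub_right, abs_mul, abs_of_pos (inv_pos.2 hτ)]
    have h1 : |inner ℝ (G (n + 1) ω - G n ω) (ξ (G (n + 1) ω) - F ω)|
        ≤ ‖G (n + 1) ω - G n ω‖ * (L * δ) := by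
      refine (abs_real_inner_le_norm _ _).trans ?_
      gcongr
      rw [norm_sub_rev]
      exact hFξ s hs ω hω
    -- Young's inequality trades the speed for the kinetic energy, whose time integral the energy
    -- estimate bounds.
    have h2 : τ⁻¹ * ‖G (n + 1) ω - G n ω‖ ≤ 1 / 2 + ‖G (n + 1) ω - G n ω‖ ^ 2 / (2 * τ ^ 2) := by
      have : ‖G (n + 1) ω - G n ω‖ ^ 2 / (2 * τ ^ 2)
          = (τ⁻¹ * ‖G (n + 1) ω - G n ω‖) ^ 2 / 2 := by
        field_simp
      rw [this]
      nlinarith [sq_nonneg (τ⁻¹ * ‖G (n + 1) ω - G n ω‖ - 1)]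
    calc τ⁻¹ * |inner ℝ (G (n + 1) ω - G n ω) (ξ (G (n + 1) ω) - F ω)|
        ≤ τ⁻¹ * (‖G (n + 1) ω - G n ω‖ * (L * δ)) := by gcongr
      _ = L * δ * (τ⁻¹ * ‖G (n + 1) ω - G n ω‖) := by ring
      _ ≤ _ := by gcongr
  have htrc : Continuous fun x => LinearMap.trace ℝ (Space d) (D x : Space d →ₗ[ℝ] Space d) := by
    refine continuous_of_norm_sub_le (L := d * L) (by positivity) fun x y => ?_
    rw [← map_sub, ← ContinuousLinearMap.toLinearMap_sub, mul_assoc]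
    exact (abs_trace_le _).trans (by gcongr; exact htest.lipschitz_hessian x y)
  have hPnn : ∀ s ∈ 𝒯.cells, 0 ≤ pressure h (cellWeight ρbar s / (A s).det) := fun s hs =>
    hh.pressure_nonneg (div_nonneg (Mesh.cellWeight_nonneg s) (hA.det_pos s hs).le)
  have e3 : |S - ∫ x, pressure h (density (inducedMeasure ρbar 𝒯 G (n + 1)) x)
          * LinearMap.trace ℝ (Space d) (D x : Space d →ₗ[ℝ] Space d)|
      ≤ κ * (∫ x, pressure h (density (inducedMeasure ρbar 𝒯 G (n + 1)) x) * η x) := by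
    rw [inducedMeasure, hA.integral_comp_density_mul hc1 hK hinj hh.pressure_zero htrc,
      hA.integral_comp_density_mul hc1 hK hinj hh.pressure_zero hη, ← Finset.sum_sub_distrib,
      Finset.mul_sum]
    refine (Finset.abs_sum_le_sum_abs _ _).trans (Finset.sum_le_sum fun s hs => ?_)
    have hvol : (A s).det * (volume (simplex s)).toReal
        = volume.real (G (n + 1) '' interior (simplex s)) := by
      rw [measureReal_def, hA.volume_image hs interior_subset, Mesh.volume_interior_simplex,
        ENNReal.toReal_mul, ENNReal.toReal_ofReal (hA.det_pos s hs).le]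
    have hconst : IntegrableOn (fun _ : Space d =>
        LinearMap.trace ℝ (Space d) (M s : Space d →ₗ[ℝ] Space d))
        (G (n + 1) '' interior (simplex s)) := integrableOn_image hc1 hs continuous_const
    have hcell : (A s).det * (volume (simplex s)).toReal
        * LinearMap.trace ℝ (Space d) (M s : Space d →ₗ[ℝ] Space d)
        = ∫ _x in G (n + 1) '' interior (simplex s),
          LinearMap.trace ℝ (Space d) (M s : Space d →ₗ[ℝ] Space d) := by
      rw [setIntegral_const, hvol, smul_eq_mul]
    rw [mul_assoc, ← mul_sub, hcell, ← integral_sub hconst (integrableOn_image hc1 hs htrc),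
      abs_mul, abs_of_nonneg (hPnn s hs), mul_left_comm κ]
    refine mul_le_mul_of_nonneg_left ?_ (hPnn s hs)
    rw [← integral_const_mul]
    refine abs_integral_le_integral_abs.trans (setIntegral_mono_on
      (hconst.sub (integrableOn_image hc1 hs htrc)).abs
      ((integrableOn_image hc1 hs hη).const_mul _) (hA.isOpen_image hs).measurableSet
      fun x hx => ?_)
    have hx' := image_mono interior_subset hx
    have hκ : 0 ≤ κ := (abs_nonneg _).trans (htr s hs x hx')
    -- The traces differ only near `X`, where `η ≥ 1`. Hence the pressure is needed only against the
    -- cutoff `η`.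
    by_cases hxX : x ∈ Metric.cthickening δ X
    · exact (htr s hs x hx').trans (le_mul_of_one_le_right hκ (hη1 x hxX))
    · obtain ⟨h1, h2⟩ := hfar s hs x hx' hxX
      rw [h1, h2, sub_self, abs_zero]
      exact mul_nonneg hκ (hη0 x)
  have e4 : |(∫ ω, fderiv ℝ V (G (n + 1) ω) (ξ (G (n + 1) ω)) ∂𝒯.refMeasure ρbar)
      - ∫ ω, fderiv ℝ V (G (n + 1) ω) (F ω) ∂𝒯.refMeasure ρbar| ≤ L * δ * CV := by
    have hVG : ContinuousOn (fun ω => fderiv ℝ V (G (n + 1) ω)) K := hV'.comp_continuousOn hc1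
    rw [← integral_sub (Mesh.integrable_refMeasure hK (hVG.clm_apply hξG))
      (Mesh.integrable_refMeasure hK (hVG.clm_apply hFc))]
    have := norm_integral_le_of_norm_le_const (μ := 𝒯.refMeasure ρbar) (C := L * δ * CV)
      (f := fun ω => fderiv ℝ V (G (n + 1) ω) (ξ (G (n + 1) ω))
        - fderiv ℝ V (G (n + 1) ω) (F ω)) (by
        filter_upwards [hae] with ω ⟨s, hs, hω⟩
        rw [← map_sub]
        by_cases hX : G (n + 1) ω ∈ Metric.cthickening δ X
        · refine (ContinuousLinearMap.le_opNorm _ _).trans ?_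
          rw [mul_comm (L * δ), norm_sub_rev]
          gcongr
          · exact hbV _ hX
          · exact hFξ s hs ω hω
        · obtain ⟨h1, h2⟩ := hFfar s hs ω hω hX
          rw [h1, h2, sub_self, map_zero, norm_zero]
          positivity)
    simpa using this
  rw [abs_le] at e1 e2 e3 e4 ⊢
  constructor <;>
    linarith [e1.1, e1.2, e2.1, e2.2, e3.1, e3.2, e4.1, e4.2]

/-! ### Test functions on space-time -/

/-- Mean value inequality on the ball of radius `‖y - x‖` around `x`; the sharper constant `L / 2`
is not needed. -/
lemma norm_taylor_le {E F : Type*} [NormedAddCommGroup E] [NormedSpace ℝ E]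
    [NormedAddCommGroup F] [NormedSpace ℝ F] {f : E → F} (hf : Differentiable ℝ f) {L : ℝ}
    (hL : 0 ≤ L) (hLip : ∀ x y, ‖fderiv ℝ f y - fderiv ℝ f x‖ ≤ L * ‖y - x‖) (x y : E) :
    ‖f y - f x - fderiv ℝ f x (y - x)‖ ≤ L * ‖y - x‖ ^ 2 := by
  have h := (convex_closedBall x ‖y - x‖).norm_image_sub_le_of_norm_fderiv_le' (f := f)
    (φ := fderiv ℝ f x) (C := L * ‖y - x‖) (x := x) (y := y) (fun z _ => hf z) (fun z hz => by
      refine (hLip x z).trans ?_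
      gcongr
      exact mem_closedBall_iff_norm.1 hz) (Metric.mem_closedBall_self (norm_nonneg _))
    (by rw [mem_closedBall_iff_norm])
  rwa [mul_assoc, ← pow_two] at h

lemma hasFDerivAt_slice {F : Type*} [NormedAddCommGroup F] [NormedSpace ℝ F]
    {g : ℝ × Space d → F} {z : ℝ × Space d} (hg : DifferentiableAt ℝ g z) :
    HasFDerivAt (fun y => g (z.1, y))
      ((fderiv ℝ g z).comp (ContinuousLinearMap.inr ℝ ℝ (Space d))) z.2 :=
  HasFDerivAt.comp (g := g) z.2 hg.hasFDerivAt (hasFDerivAt_prodMk_right z.1 z.2)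

lemma contDiff_sliceDeriv {F : Type*} [NormedAddCommGroup F] [NormedSpace ℝ F]
    {g : ℝ × Space d → F} (hg : ContDiff ℝ (⊤ : ℕ∞) g) :
    ContDiff ℝ (⊤ : ℕ∞) fun z : ℝ × Space d => fderiv ℝ (fun y => g (z.1, y)) z.2 := by
  have : (fun z : ℝ × Space d => fderiv ℝ (fun y => g (z.1, y)) z.2)
      = fun z => (fderiv ℝ g z).comp (ContinuousLinearMap.inr ℝ ℝ (Space d)) :=
    funext fun z => (hasFDerivAt_slice (hg.differentiable (by simp) z)).fderiv
  rw [this]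
  exact (hg.fderiv_right (m := (⊤ : ℕ∞)) (by norm_cast)).clm_comp contDiff_const

lemma sliceDeriv_eq_zero {F : Type*} [NormedAddCommGroup F] [NormedSpace ℝ F]
    {g : ℝ × Space d → F} (hg : ContDiff ℝ (⊤ : ℕ∞) g) {z : ℝ × Space d} (hz : z ∉ tsupport g) :
    fderiv ℝ (fun y => g (z.1, y)) z.2 = 0 := by
  rw [(hasFDerivAt_slice (hg.differentiable (by simp) z)).fderiv]
  have : fderiv ℝ g z = 0 := by
    by_contra h
    exact hz (support_fderiv_subset ℝ h)
  rw [this, ContinuousLinearMap.zero_comp]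

lemma tsupport_subset_of_eq_zero {E F F' : Type*} [TopologicalSpace E] [Zero F] [Zero F']
    {g : E → F} {g' : E → F'} (h : ∀ z, z ∉ tsupport g → g' z = 0) : tsupport g' ⊆ tsupport g :=
  closure_minimal (fun _ hz => by_contra fun hn => hz (h _ hn)) (isClosed_tsupport g)

lemma exists_lipschitz_bound {E F : Type*} [NormedAddCommGroup E] [NormedSpace ℝ E]
    [NormedAddCommGroup F] [NormedSpace ℝ F] {g : E → F} (hg : ContDiff ℝ (⊤ : ℕ∞) g)
    (hc : HasCompactSupport g) : ∃ L, 0 ≤ L ∧ ∀ x y, ‖g y - g x‖ ≤ L * ‖y - x‖ := by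
  obtain ⟨C, hC⟩ := ContDiff.lipschitzWith_of_hasCompactSupport hc hg (by simp)
  refine ⟨C, C.2, fun x y => ?_⟩
  simpa [dist_eq_norm] using hC.dist_le_mul y x

section TestFunction

variable {φ : ℝ × Space d → ℝ}

/-- The spatial gradient of a function on space-time. -/
noncomputable def spaceGradient (φ : ℝ × Space d → ℝ) (z : ℝ × Space d) : Space d :=
  gradient (fun y => φ (z.1, y)) z.2

/-- The spatial Hessian of a function on space-time. -/
noncomputable def spaceHessian (φ : ℝ × Space d → ℝ) (z : ℝ × Space d) : Space d →L[ℝ] Space d :=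
  fderiv ℝ (fun y => spaceGradient φ (z.1, y)) z.2

/-- The spatial Laplacian of a function on space-time. -/
noncomputable def spaceLaplacian (φ : ℝ × Space d → ℝ) (z : ℝ × Space d) : ℝ :=
  LinearMap.trace ℝ (Space d) (spaceHessian φ z : Space d →ₗ[ℝ] Space d)

/-- The time derivative of a function on space-time. -/
noncomputable def timeDeriv (φ : ℝ × Space d → ℝ) (z : ℝ × Space d) : ℝ :=
  deriv (fun s => φ (s, z.2)) z.1

lemma contDiff_spaceGradient (hφ : ContDiff ℝ (⊤ : ℕ∞) φ) :
    ContDiff ℝ (⊤ : ℕ∞) (spaceGradient φ) :=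
  (InnerProductSpace.toDual ℝ (Space d)).symm.contDiff.comp (contDiff_sliceDeriv hφ)

lemma spaceGradient_eq_zero (hφ : ContDiff ℝ (⊤ : ℕ∞) φ) {z : ℝ × Space d}
    (hz : z ∉ tsupport φ) : spaceGradient φ z = 0 := by
  rw [spaceGradient, gradient, sliceDeriv_eq_zero hφ hz, map_zero]

lemma contDiff_spaceHessian (hφ : ContDiff ℝ (⊤ : ℕ∞) φ) :
    ContDiff ℝ (⊤ : ℕ∞) (spaceHessian φ) :=
  contDiff_sliceDeriv (contDiff_spaceGradient hφ)

lemma spaceHessian_eq_zero (hφ : ContDiff ℝ (⊤ : ℕ∞) φ) {z : ℝ × Space d}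
    (hz : z ∉ tsupport φ) : spaceHessian φ z = 0 :=
  sliceDeriv_eq_zero (contDiff_spaceGradient hφ) fun h =>
    hz (tsupport_subset_of_eq_zero (fun _ => spaceGradient_eq_zero hφ) h)

lemma continuous_spaceLaplacian (hφ : ContDiff ℝ (⊤ : ℕ∞) φ) : Continuous (spaceLaplacian φ) := by
  have : spaceLaplacian φ = fun z => ∑ i, inner ℝ (EuclideanSpace.basisFun (Fin d) ℝ i)
      (spaceHessian φ z (EuclideanSpace.basisFun (Fin d) ℝ i)) :=
    funext fun z => LinearMap.trace_eq_sum_inner _ _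
  rw [this]
  have := (contDiff_spaceHessian hφ).continuous
  fun_prop

lemma spaceLaplacian_eq_zero (hφ : ContDiff ℝ (⊤ : ℕ∞) φ) {z : ℝ × Space d}
    (hz : z ∉ tsupport φ) : spaceLaplacian φ z = 0 := by
  rw [spaceLaplacian, spaceHessian_eq_zero hφ hz]
  simp

/-- One side differentiates the gradient, the other iterates `fderiv`. Both second derivatives in a
basis direction `e` come from the same function `y ↦ ⟪e, ∇φ⟫`, so uniqueness of the derivative
identifies them. -/
lemma spaceLaplacian_eq (hφ : ContDiff ℝ (⊤ : ℕ∞) φ) (z : ℝ × Space d) :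
    spaceLaplacian φ z = Laplacian.laplacian (fun y => φ (z.1, y)) z.2 := by
  rw [spaceLaplacian, LinearMap.trace_eq_sum_inner _ (EuclideanSpace.basisFun (Fin d) ℝ),
    InnerProductSpace.laplacian_eq_iteratedFDeriv_orthonormalBasis _
      (EuclideanSpace.basisFun (Fin d) ℝ)]
  refine Finset.sum_congr rfl fun i _ => ?_
  have hslice : ContDiff ℝ (⊤ : ℕ∞) fun y : Space d => φ (z.1, y) :=
    hφ.comp (contDiff_const.prodMk contDiff_id)
  have hd : DifferentiableAt ℝ (fderiv ℝ fun y : Space d => φ (z.1, y)) z.2 :=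
    (hslice.fderiv_right (m := (⊤ : ℕ∞)) (by norm_cast)).differentiable (by simp) _
  set e := EuclideanSpace.basisFun (Fin d) ℝ i
  have h1 : HasFDerivAt (fun y => spaceGradient φ (z.1, y)) (spaceHessian φ z) z.2 :=
    (((contDiff_spaceGradient hφ).comp (contDiff_const.prodMk contDiff_id)).differentiable
      (by simp) z.2).hasFDerivAt
  have h2 : HasFDerivAt (fun y => inner ℝ e (spaceGradient φ (z.1, y)))
      ((innerSL ℝ e).comp (spaceHessian φ z)) z.2 := (innerSL ℝ e).hasFDerivAt.comp z.2 h1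
  have h3 : HasFDerivAt (fun y => fderiv ℝ (fun y => φ (z.1, y)) y e)
      ((ContinuousLinearMap.apply ℝ ℝ e).comp (fderiv ℝ (fderiv ℝ fun y => φ (z.1, y)) z.2)) z.2 :=
    (ContinuousLinearMap.apply ℝ ℝ e).hasFDerivAt.comp z.2 hd.hasFDerivAt
  have h4 : (fun y => inner ℝ e (spaceGradient φ (z.1, y)))
      = fun y => fderiv ℝ (fun y => φ (z.1, y)) y e := by
    ext y
    rw [real_inner_comm, spaceGradient, inner_gradient_left]
  rw [h4] at h2
  rw [iteratedFDeriv_two_apply]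
  exact DFunLike.congr_fun (h2.unique h3) e

/-- Slices of a smooth compactly supported function are test fields, uniformly in time. -/
lemma exists_isTestField (hφ : ContDiff ℝ (⊤ : ℕ∞) φ) (hc : HasCompactSupport φ) :
    ∃ L, 0 ≤ L ∧ (∀ t, IsTestField L (Prod.snd '' tsupport φ) (fun x => φ (t, x))
      (fun x => spaceGradient φ (t, x)) (fun x => spaceHessian φ (t, x))) ∧
      ∀ t τ x, |φ (t + τ, x) - φ (t, x) - τ * timeDeriv φ (t, x)| ≤ L * τ ^ 2 := by
  have hcG : HasCompactSupport (spaceGradient φ) := HasCompactSupport.of_support_subset_isCompact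
    hc fun z hz => by_contra fun h => hz (spaceGradient_eq_zero hφ h)
  have hcH : HasCompactSupport (spaceHessian φ) := HasCompactSupport.of_support_subset_isCompact
    hc fun z hz => by_contra fun h => hz (spaceHessian_eq_zero hφ h)
  obtain ⟨L1, hL1, h1⟩ := exists_lipschitz_bound (contDiff_spaceGradient hφ) hcG
  obtain ⟨L2, hL2, h2⟩ := exists_lipschitz_bound (contDiff_spaceHessian hφ) hcH
  obtain ⟨L3, hL3, h3⟩ := exists_lipschitz_bound
    (hφ.fderiv_right (m := (⊤ : ℕ∞)) (by norm_cast)) (hc.fderiv (𝕜 := ℝ))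
  have hslice : ∀ t x y, ‖((t, y) : ℝ × Space d) - (t, x)‖ = ‖y - x‖ := by
    intro t x y
    rw [Prod.mk_sub_mk, sub_self, Prod.norm_mk, norm_zero, max_eq_right (norm_nonneg _)]
  have hg1 : ∀ t x y, ‖spaceGradient φ (t, y) - spaceGradient φ (t, x)‖ ≤ L1 * ‖y - x‖ :=
    fun t x y => hslice t x y ▸ h1 (t, x) (t, y)
  have hg2 : ∀ t x y, ‖spaceHessian φ (t, y) - spaceHessian φ (t, x)‖ ≤ L2 * ‖y - x‖ :=
    fun t x y => hslice t x y ▸ h2 (t, x) (t, y)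
  have hle1 : L1 ≤ max L1 (max L2 L3) := le_max_left _ _
  have hle2 : L2 ≤ max L1 (max L2 L3) := (le_max_left _ _).trans (le_max_right _ _)
  have hle3 : L3 ≤ max L1 (max L2 L3) := (le_max_right _ _).trans (le_max_right _ _)
  refine ⟨max L1 (max L2 L3), hL1.trans hle1, fun t => ⟨?_, fun x y => ?_, fun x y => ?_,
    fun x y => ?_, fun x y => ?_, fun x hx => ?_, fun x hx => ?_⟩, fun t τ x => ?_⟩
  · exact hφ.continuous.comp (by fun_prop)
  · have hd : Differentiable ℝ fun x : Space d => φ (t, x) :=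
      (hφ.comp (contDiff_const.prodMk contDiff_id)).differentiable (by simp)
    have h := norm_taylor_le hd hL1 (fun x y => by
      refine le_trans (le_of_eq ?_) (hg1 t x y)
      rw [spaceGradient, spaceGradient, gradient, gradient, ← map_sub,
        LinearIsometryEquiv.norm_map]) x y
    rw [spaceGradient, inner_gradient_left]
    rw [Real.norm_eq_abs] at h
    exact h.trans (by gcongr)
  · exact (hg1 t x y).trans (by gcongr)
  · have hd : Differentiable ℝ fun x : Space d => spaceGradient φ (t, x) :=
      ((contDiff_spaceGradient hφ).comp (contDiff_const.prodMk contDiff_id)).differentiable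
        (by simp)
    exact (norm_taylor_le hd hL2 (hg2 t) x y).trans (by gcongr)
  · exact (hg2 t x y).trans (by gcongr)
  · exact spaceGradient_eq_zero hφ fun h => hx ⟨_, h, rfl⟩
  · exact spaceHessian_eq_zero hφ fun h => hx ⟨_, h, rfl⟩
  · have h := norm_taylor_le (hφ.differentiable (by simp)) hL3 h3 (t, x) (t + τ, x)
    have hz : ((t + τ, x) : ℝ × Space d) - (t, x) = (τ, 0) := by simp
    have hdt : timeDeriv φ (t, x) = fderiv ℝ φ (t, x) (1, 0) := by
      have := (hφ.differentiable (by simp) (t, x)).hasFDerivAt.comp_hasDerivAt t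
        ((hasDerivAt_id t).prodMk (hasDerivAt_const t x))
      exact this.deriv
    have hτ : fderiv ℝ φ (t, x) (τ, 0) = τ * timeDeriv φ (t, x) := by
      rw [hdt, ← smul_eq_mul, ← map_smul]
      simp
    rw [hz, hτ, Prod.norm_mk, norm_zero, max_eq_left (norm_nonneg _), Real.norm_eq_abs,
      Real.norm_eq_abs, sq_abs] at h
    exact h.trans (by gcongr)

lemma continuous_timeDeriv (hφ : ContDiff ℝ (⊤ : ℕ∞) φ) : Continuous (timeDeriv φ) := by
  have : timeDeriv φ = fun z => fderiv ℝ φ z (1, 0) := by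
    ext z
    exact ((hφ.differentiable (by simp) (z.1, z.2)).hasFDerivAt.comp_hasDerivAt z.1
        ((hasDerivAt_id z.1).prodMk (hasDerivAt_const z.1 z.2))).deriv
  rw [this]
  exact (hφ.continuous_fderiv (by simp)).clm_apply continuous_const

lemma timeDeriv_eq_zero (hφ : ContDiff ℝ (⊤ : ℕ∞) φ) {z : ℝ × Space d}
    (hz : z ∉ tsupport φ) : timeDeriv φ z = 0 := by
  have h1 : timeDeriv φ z = fderiv ℝ φ z (1, 0) :=
    ((hφ.differentiable (by simp) (z.1, z.2)).hasFDerivAt.comp_hasDerivAt z.1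
        ((hasDerivAt_id z.1).prodMk (hasDerivAt_const z.1 z.2))).deriv
  have : fderiv ℝ φ z = 0 := by
    by_contra h
    exact hz (support_fderiv_subset ℝ h)
  rw [h1, this, zero_apply]

end TestFunction

/-! ### Integration in time -/

/-- The second argument runs through a countable set, so measurability for each index suffices. -/
lemma measurable_natCeil_div {τ : ℝ} {H : ℝ → ℕ → ℝ} (hH : ∀ n, Measurable fun t => H t n) :
    Measurable fun t => H t ⌈t / τ⌉₊ := by
  have h1 : Measurable fun q : ℝ × ℕ => H q.1 q.2 := measurable_from_prod_countable_left hH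
  exact h1.comp (measurable_id.prodMk (Nat.measurable_ceil.comp (measurable_id.div_const τ)))

/-- The integrand equals `r n` on `(nτ, (n + 1)τ]`, where the ceiling is `n + 1`. -/
lemma integral_natCeil_sub_one {τ : ℝ} (hτ : 0 < τ) (r : ℕ → ℝ) (N : ℕ) :
    IntervalIntegrable (fun t => r (⌈t / τ⌉₊ - 1)) volume 0 (N * τ) ∧
      ∫ t in (0 : ℝ)..N * τ, r (⌈t / τ⌉₊ - 1) = τ * ∑ n ∈ Finset.range N, r n := by
  induction N with
  | zero => simp
  | succ N ih =>
    have hle : (N : ℝ) * τ ≤ (N + 1 : ℕ) * τ := by gcongr; simp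
    have hcongr : EqOn (fun _ => r N) (fun t => r (⌈t / τ⌉₊ - 1))
        (uIoc ((N : ℝ) * τ) ((N + 1 : ℕ) * τ)) := by
      intro t ht
      rw [uIoc_of_le hle] at ht
      have : ⌈t / τ⌉₊ = N + 1 := by
        rw [Nat.ceil_eq_iff (by simp)]
        refine ⟨?_, ?_⟩
        · rw [lt_div_iff₀ hτ]; simpa using ht.1
        · rw [div_le_iff₀ hτ]; exact ht.2
      simp [this]
    have h1 : IntervalIntegrable (fun t => r (⌈t / τ⌉₊ - 1)) volume (N * τ) ((N + 1 : ℕ) * τ) :=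
      intervalIntegrable_const.congr hcongr
    refine ⟨ih.1.trans h1, ?_⟩
    rw [← intervalIntegral.integral_add_adjacent_intervals ih.1 h1, ih.2,
      ← intervalIntegral.integral_congr_ae (Eventually.of_forall fun t ht => hcongr ht), intervalIntegral.integral_const,
      Finset.sum_range_succ]
    push_cast
    rw [smul_eq_mul]
    ring

lemma integral_natCeil_sub_one_le {τ T S : ℝ} (hτ : 0 < τ) (r : ℕ → ℝ) (hr : ∀ n, 0 ≤ r n)
    (hS : ∀ N, ∑ n ∈ Finset.range N, r n ≤ S) :
    IntegrableOn (fun t => r (⌈t / τ⌉₊ - 1)) (Ioo 0 T) ∧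
      ∫ t in Ioo 0 T, r (⌈t / τ⌉₊ - 1) ≤ τ * S := by
  obtain ⟨h1, h2⟩ := integral_natCeil_sub_one hτ r ⌈T / τ⌉₊
  have h0 : (0 : ℝ) ≤ ⌈T / τ⌉₊ * τ := by positivity
  have hsub : Ioo 0 T ⊆ Ioc 0 (⌈T / τ⌉₊ * τ) := fun t ht =>
    ⟨ht.1, ht.2.le.trans ((div_le_iff₀ hτ).1 (Nat.le_ceil _))⟩
  rw [intervalIntegrable_iff_integrableOn_Ioc_of_le h0] at h1
  refine ⟨h1.mono_set hsub, ?_⟩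
  calc _ ≤ ∫ t in Ioc 0 (⌈T / τ⌉₊ * τ), r (⌈t / τ⌉₊ - 1) :=
        setIntegral_mono_set h1 (Eventually.of_forall fun _ => hr _) hsub.eventuallyLE
    _ = τ * ∑ n ∈ Finset.range ⌈T / τ⌉₊, r n := by
        rw [← h2, intervalIntegral.integral_of_le h0]
    _ ≤ τ * S := by gcongr; exact hS _

/-- Narrow convergence at almost every time, integrated against a test function. -/
lemma tendsto_integral_of_narrowTendsto {T : ℝ} {m : ℕ → ℝ → Measure (Space d)}
    {ν : ℝ → Measure (Space d)} (hm : ∀ k t, IsProbabilityMeasure (m k t))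
    (hlim : ∀ t ∈ Ioc 0 T, NarrowTendsto (fun k => m k t) (ν t)) {g : ℝ × Space d → ℝ}
    (hg : Continuous g) (hgc : HasCompactSupport g)
    (hmeas : ∀ k, Measurable fun t => ∫ x, g (t, x) ∂m k t) :
    Tendsto (fun k => ∫ t in Ioo 0 T, ∫ x, g (t, x) ∂m k t) atTop
      (𝓝 (∫ t in Ioo 0 T, ∫ x, g (t, x) ∂ν t)) := by
  obtain ⟨C, hC⟩ := hgc.exists_bound_of_continuous hg
  -- A bound for `g` dominates on the bounded interval, and each time slice of `g` is an admissible
  -- test function for narrow convergence.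
  refine tendsto_integral_of_dominated_convergence (fun _ => C)
    (fun k => (hmeas k).aestronglyMeasurable) (integrable_const _)
    (fun k => Eventually.of_forall fun t => ?_) ?_
  · simpa using norm_integral_le_of_norm_le_const (μ := m k t)
      (Eventually.of_forall fun x => hC (t, x))
  · filter_upwards [ae_restrict_mem measurableSet_Ioo] with t ht
    exact hlim t (Ioo_subset_Ioc_self ht) (BoundedContinuousFunction.ofNormedAddCommGroup
      (fun x => g (t, x)) (by fun_prop) C fun x => hC (t, x))

/-! ### Measurability and time integrals of the scheme -/

section Scheme

variable {𝒯 : Mesh K} {ρbar : Measure (Space d)} {h : ℝ → ℝ} {V : Space d → ℝ} {τ : ℝ}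
  {G : ℕ → Space d → Space d}

namespace IsDiscreteSolution

lemma measurable_integral_step (hG : IsDiscreteSolution h V ρbar 𝒯 τ G) (hK : IsCompact K)
    [IsProbabilityMeasure (𝒯.refMeasure ρbar)] {g : ℝ × Space d → ℝ} (hg : Continuous g)
    (hgc : HasCompactSupport g) (j : ℕ → ℕ) :
    Measurable fun t => ∫ ω, g (t, G (j ⌈t / τ⌉₊) ω) ∂𝒯.refMeasure ρbar := by
  obtain ⟨C, hC⟩ := hgc.exists_bound_of_continuous hg
  refine measurable_natCeil_div (H := fun t n => ∫ ω, g (t, G (j n) ω) ∂𝒯.refMeasure ρbar)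
    fun n => (continuous_of_dominated (bound := fun _ => C) (fun t => ?_)
      (fun t => Eventually.of_forall fun ω => hC _) (integrable_const _)
      (Eventually.of_forall fun ω => by fun_prop)).measurable
  exact (hG.integrable_comp hK (f := fun x => g (t, x)) (by fun_prop) _).aestronglyMeasurable

lemma integrableOn_integral_step (hG : IsDiscreteSolution h V ρbar 𝒯 τ G) (hK : IsCompact K)
    [IsProbabilityMeasure (𝒯.refMeasure ρbar)] {g : ℝ × Space d → ℝ} (hg : Continuous g)
    (hgc : HasCompactSupport g) (j : ℕ → ℕ) (T : ℝ) :
    IntegrableOn (fun t => ∫ ω, g (t, G (j ⌈t / τ⌉₊) ω) ∂𝒯.refMeasure ρbar) (Ioo 0 T) := by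
  obtain ⟨C, hC⟩ := hgc.exists_bound_of_continuous hg
  refine Measure.integrableOn_of_bounded (M := C) (by simp)
    (hG.measurable_integral_step hK hg hgc j).aestronglyMeasurable
    (Eventually.of_forall fun t => ?_)
  simpa using norm_integral_le_of_norm_le_const (μ := 𝒯.refMeasure ρbar)
      (Eventually.of_forall fun ω => hC (t, G (j ⌈t / τ⌉₊) ω))

/-- Summation by parts in time. -/
lemma integral_prev_step (hτ : 0 < τ) {a b T : ℝ} (ha : τ < a) (hbT : b < T)
    {φ : ℝ × Space d → ℝ} (hφ : ∀ t x, t ∉ Icc a b → φ (t, x) = 0) :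
    ∫ t in Ioo 0 T, ∫ ω, φ (t, G (⌈t / τ⌉₊ - 1) ω) ∂𝒯.refMeasure ρbar
      = ∫ t in Ioo 0 T, ∫ ω, φ (t + τ, G ⌈t / τ⌉₊ ω) ∂𝒯.refMeasure ρbar := by
  -- Both integrals extend by zero to the whole line. For the shifted one this uses `τ < a`: then `t
  -- + τ ≥ a` forces `t > 0`. Translation by `τ` lowers the ceiling by one.
  rw [setIntegral_eq_integral_of_forall_compl_eq_zero,
    setIntegral_eq_integral_of_forall_compl_eq_zero, ← integral_sub_right_eq_self
      (fun t => ∫ ω, φ (t + τ, G ⌈t / τ⌉₊ ω) ∂𝒯.refMeasure ρbar) τ]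
  · refine integral_congr_ae (Eventually.of_forall fun t => ?_)
    simp only [sub_add_cancel, sub_div, div_self hτ.ne', Nat.ceil_sub_one]
  · intro t ht
    refine integral_eq_zero_of_ae (Eventually.of_forall fun ω => hφ _ _ fun h => ht ?_)
    exact ⟨by linarith [h.1], by linarith [h.2]⟩
  · intro t ht
    refine integral_eq_zero_of_ae (Eventually.of_forall fun ω => hφ _ _ fun h => ht ?_)
    exact ⟨by linarith [h.1], h.2.trans_lt hbT⟩

/-- Almost everywhere the pressure is a finite sum of constants on open image cells, which gives a
bounded measurable representative without measurability of `pressure h`. -/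
lemma exists_pressure_ae_eq (hG : IsDiscreteSolution h V ρbar 𝒯 τ G) (hh : IsInternalEnergy h)
    (hK : IsCompact K) {n : ℕ} (hinj : InjOn (G n) K) :
    ∃ w : Space d → ℝ, Measurable w ∧ (∃ B, ∀ x, ‖w x‖ ≤ B) ∧
      (fun x => pressure h (density (inducedMeasure ρbar 𝒯 G n) x)) =ᵐ[volume] w := by
  obtain ⟨A, b, hA⟩ := (hG.ansatz n).exists_cellwise
  refine ⟨_, ?_, ⟨∑ s ∈ 𝒯.cells, |pressure h (cellWeight ρbar s / (A s).det)|, fun x => ?_⟩,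
    hA.comp_density_ae_eq (hG.ansatz n).continuousOn hK hinj (pressure h) hh.pressure_zero⟩
  · exact Finset.measurable_sum _ fun s hs =>
      measurable_const.indicator (hA.isOpen_image hs).measurableSet
  · exact (norm_sum_le _ _).trans (Finset.sum_le_sum fun s _ => norm_indicator_le_norm_self _ _)

/-- The space-time integral of the pressure against a test function, as an iterated integral. -/
lemma integral_pressure_mul (hG : IsDiscreteSolution h V ρbar 𝒯 τ G) (hτ : 0 < τ)
    (hh : IsInternalEnergy h) (hK : IsCompact K) {T : ℝ} {Ω : Set (Space d)} (hΩ : IsOpen Ω)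
    (hinj : ∀ n : ℕ, ((n : ℝ) - 1) * τ < T → InjOn (G n) K) {ψ : ℝ × Space d → ℝ}
    (hψ : Continuous ψ) (hψc : HasCompactSupport ψ) (hψΩ : tsupport ψ ⊆ univ ×ˢ Ω) :
    IntegrableOn (fun t => ∫ x, pressure h (density (interpolation ρbar 𝒯 τ G t) x) * ψ (t, x))
      (Ioo 0 T) ∧
    ∫ z in Icc 0 T ×ˢ Ω, pressure h (density (interpolation ρbar 𝒯 τ G z.1) z.2) * ψ z
      = ∫ t in Ioo 0 T, ∫ x, pressure h (density (interpolation ρbar 𝒯 τ G t) x) * ψ (t, x) := by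
  -- Injectivity is known only for indices occurring before `T`; for the others the representative
  -- is a dummy zero.
  have hex : ∀ n : ℕ, ∃ (w : Space d → ℝ) (B : ℝ), Measurable w ∧ (∀ x, ‖w x‖ ≤ B) ∧
      (((n : ℝ) - 1) * τ < T →
        (fun x => pressure h (density (inducedMeasure ρbar 𝒯 G n) x)) =ᵐ[volume] w) := by
    intro n
    by_cases hn : ((n : ℝ) - 1) * τ < T
    · obtain ⟨w, h1, ⟨B, h2⟩, h3⟩ := hG.exists_pressure_ae_eq hh hK (hinj n hn)
      exact ⟨w, B, h1, h2, fun _ => h3⟩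
    · exact ⟨0, 0, measurable_zero, by simp, fun h => absurd h hn⟩
  choose w B hwm hB hw using hex
  have hW : Measurable fun z : ℝ × Space d => w ⌈z.1 / τ⌉₊ z.2 := by
    have h1 : Measurable fun q : Space d × ℕ => w q.2 q.1 :=
      measurable_from_prod_countable_left hwm
    exact h1.comp (measurable_snd.prodMk
      (Nat.measurable_ceil.comp (measurable_fst.div_const τ)))
  have hWint : IntegrableOn (fun z : ℝ × Space d => w ⌈z.1 / τ⌉₊ z.2 * ψ z)
      (Icc 0 T ×ˢ univ) (volume.prod volume) := by
    -- Up to time `T` only indices at most `⌈T / τ⌉₊` occur, so a finite sum of their bounds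
    -- dominates.
    refine Integrable.bdd_mul (c := ∑ n ∈ Finset.range (⌈T / τ⌉₊ + 1), |B n|)
      (hψ.integrable_of_hasCompactSupport hψc).integrableOn hW.aestronglyMeasurable ?_
    filter_upwards [ae_restrict_mem (measurableSet_Icc.prod MeasurableSet.univ)] with z hz
    refine ((hB _ _).trans (le_abs_self _)).trans
      (Finset.single_le_sum (f := fun n => |B n|) (fun _ _ => abs_nonneg _) ?_)
    rw [Finset.mem_range, Nat.lt_succ_iff]
    exact Nat.ceil_mono (div_le_div_of_nonneg_right hz.1.2 hτ.le)
  have hae : ∀ᵐ x : Space d, ∀ n : ℕ, ((n : ℝ) - 1) * τ < T →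
      pressure h (density (inducedMeasure ρbar 𝒯 G n) x) = w n x := by
    rw [ae_all_iff]
    intro n
    by_cases hn : ((n : ℝ) - 1) * τ < T
    · filter_upwards [hw n hn] with x hx _ using hx
    · exact Eventually.of_forall fun x h => absurd h hn
  have hinner : ∀ t ∈ Ioo 0 T, ∫ x, w ⌈t / τ⌉₊ x * ψ (t, x)
      = ∫ x, pressure h (density (interpolation ρbar 𝒯 τ G t) x) * ψ (t, x) := by
    intro t ht
    refine integral_congr_ae ?_
    filter_upwards [hae] with x hx
    rw [interpolation, hx _ (sub_one_mul_lt_of_le hτ ht.1.le ht.2.le)]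
  have hWΩ := hWint.mono_set (prod_mono (Subset.refl (Icc 0 T)) (subset_univ Ω))
  constructor
  · have h1 : Integrable (fun z : ℝ × Space d => w ⌈z.1 / τ⌉₊ z.2 * ψ z)
        ((volume.restrict (Icc 0 T)).prod volume) := by
      rw [← Measure.restrict_univ (μ := (volume : Measure (Space d))), Measure.prod_restrict]
      exact hWint
    have h2 : IntegrableOn (fun t => ∫ x, w ⌈t / τ⌉₊ x * ψ (t, x)) (Ioo 0 T) :=
      IntegrableOn.mono_set h1.integral_prod_left Ioo_subset_Icc_self
    exact h2.congr_fun hinner measurableSet_Ioo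
  · have h1 : ∫ z in Icc 0 T ×ˢ Ω, pressure h (density (interpolation ρbar 𝒯 τ G z.1) z.2) * ψ z
        = ∫ z in Icc 0 T ×ˢ Ω, w ⌈z.1 / τ⌉₊ z.2 * ψ z := by
      refine integral_congr_ae ?_
      have hae' := ae_restrict_of_ae (s := Icc 0 T ×ˢ Ω) (Measure.quasiMeasurePreserving_snd
        (μ := (volume : Measure ℝ)) (ν := (volume : Measure (Space d))).ae hae)
      filter_upwards [hae', ae_restrict_mem (measurableSet_Icc.prod hΩ.measurableSet)] with z hz hz'
      rw [interpolation, hz _ (sub_one_mul_lt_of_le hτ hz'.1.1 hz'.1.2)]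
    rw [h1, Measure.volume_eq_prod, setIntegral_prod _ hWΩ, integral_Icc_eq_integral_Ioo]
    refine setIntegral_congr_fun measurableSet_Ioo fun t ht => ?_
    rw [← hinner t ht]
    refine setIntegral_eq_integral_of_forall_compl_eq_zero fun x hx => ?_
    rw [image_eq_zero_of_notMem_tsupport fun hz => hx (hψΩ hz).2, mul_zero]

end IsDiscreteSolution

end Scheme

/-! ### The weak formulation of the scheme and its limit -/

lemma hasCompactSupport_of_eq_zero {E F F' : Type*} [TopologicalSpace E] [R1Space E] [Zero F]
    [Zero F'] {g : E → F} {g' : E → F'} (hc : HasCompactSupport g)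
    (h : ∀ z, z ∉ tsupport g → g' z = 0) : HasCompactSupport g' :=
  HasCompactSupport.of_support_subset_isCompact hc fun z hz => by_contra fun hn => hz (h z hn)

section Scheme

variable {𝒯 : Mesh K} {ρbar : Measure (Space d)} {h : ℝ → ℝ} {V : Space d → ℝ} {τ : ℝ}
  {G : ℕ → Space d → Space d}

/-- The one-step estimate is applied with `φ(t, ·)` frozen at each time and integrated over `t`.
Summation by parts moves the difference quotient from the measures onto `φ`, where `timeDeriv`
replaces it up to `L τ`. -/
lemma IsDiscreteSolution.weak_form_estimate (hG : IsDiscreteSolution h V ρbar 𝒯 τ G) (hτ : 0 < τ)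
    (hh : IsInternalEnergy h) (hV : ContDiff ℝ 1 V) (hV0 : ∀ x, 0 ≤ V x) (hK : IsCompact K)
    (hρ : IsP2ac ρbar) (hsupp : ρbar.support = K) {C : ℝ}
    (hE : transEntropy h V ρbar 𝒯 (G 0) ≤ C) {T : ℝ} (hT : 0 < T) {Ω : Set (Space d)}
    (hΩ : IsOpen Ω) (hinj : ∀ n : ℕ, ((n : ℝ) - 1) * τ < T → InjOn (G n) K)
    {φ : ℝ × Space d → ℝ} (hφ : ContDiff ℝ (⊤ : ℕ∞) φ) (hφc : HasCompactSupport φ) {a b : ℝ}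
    (ha : τ < a) (hb : b < T) (hφΩ : tsupport φ ⊆ Icc a b ×ˢ Ω)
    {L δ θ CV : ℝ} (hL : 0 ≤ L) (hδ : 0 ≤ δ) (hθ0 : 0 < θ) (hθ : θ ≤ Real.pi / 2) (hCV : 0 ≤ CV)
    (htest : ∀ t, IsTestField L (Prod.snd '' tsupport φ) (fun x => φ (t, x))
      (fun x => spaceGradient φ (t, x)) (fun x => spaceHessian φ (t, x)))
    (htime : ∀ t τ x, |φ (t + τ, x) - φ (t, x) - τ * timeDeriv φ (t, x)| ≤ L * τ ^ 2)
    (hang : ∀ n : ℕ, ((n : ℝ) - 1) * τ < T → ∀ s ∈ 𝒯.cells, AnglesGE θ (G n) s)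
    (hdiam : ∀ n : ℕ, ((n : ℝ) - 1) * τ < T → ∀ s ∈ 𝒯.cells, Metric.diam (G n '' simplex s) ≤ δ)
    (hbV : ∀ x ∈ Metric.cthickening δ (Prod.snd '' tsupport φ), ‖fderiv ℝ V x‖ ≤ CV)
    {ψ : ℝ × Space d → ℝ} (hψ : Continuous ψ) (hψc : HasCompactSupport ψ)
    (hψΩ : tsupport ψ ⊆ univ ×ˢ Ω) (hψ0 : ∀ z, 0 ≤ ψ z)
    (hψ1 : ∀ t ∈ Ioo 0 T, ∀ x ∈ Metric.cthickening δ (Prod.snd '' tsupport φ), 1 ≤ ψ (t, x)) :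
    |(∫ t in Ioo 0 T, ∫ x, (timeDeriv φ (t, x) - fderiv ℝ V x (spaceGradient φ (t, x)))
        ∂interpolation ρbar 𝒯 τ G t)
      + ∫ z in Icc 0 T ×ˢ Ω, pressure h (density (interpolation ρbar 𝒯 τ G z.1) z.2)
          * spaceLaplacian φ z|
      ≤ L * τ * T + 2 * L * τ * C + L * δ * (T / 2 + C)
        + d * (d * (L * δ) / Real.sin θ + L * δ)
          * (∫ z in Icc 0 T ×ˢ Ω, pressure h (density (interpolation ρbar 𝒯 τ G z.1) z.2) * ψ z)
        + L * δ * CV * T := by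
  have := Mesh.isProbabilityMeasure_refMeasure (𝒯 := 𝒯) hρ hsupp
  have hV' : Continuous (fderiv ℝ V) := hV.continuous_fderiv (by simp)
  have hct := continuous_timeDeriv hφ
  have hcg := (contDiff_spaceGradient hφ).continuous
  have hcq : Continuous fun z : ℝ × Space d => fderiv ℝ V z.2 (spaceGradient φ z) :=
    (hV'.comp continuous_snd).clm_apply hcg
  have hsq : HasCompactSupport fun z : ℝ × Space d => fderiv ℝ V z.2 (spaceGradient φ z) :=
    hasCompactSupport_of_eq_zero hφc fun z hz => by rw [spaceGradient_eq_zero hφ hz, map_zero]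
  have hst : HasCompactSupport (timeDeriv φ) :=
    hasCompactSupport_of_eq_zero hφc fun z => timeDeriv_eq_zero hφ
  have hsl : HasCompactSupport (spaceLaplacian φ) :=
    hasCompactSupport_of_eq_zero hφc fun z => spaceLaplacian_eq_zero hφ
  have hslΩ : tsupport (spaceLaplacian φ) ⊆ univ ×ˢ Ω :=
    (tsupport_subset_of_eq_zero fun z => spaceLaplacian_eq_zero hφ).trans
      (hφΩ.trans (prod_mono (subset_univ _) Subset.rfl))
  obtain ⟨hpi, hpe⟩ := hG.integral_pressure_mul hτ hh hK hΩ hinj (continuous_spaceLaplacian hφ)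
    hsl hslΩ
  obtain ⟨hηi, hηe⟩ := hG.integral_pressure_mul hτ hh hK hΩ hinj hψ hψc hψΩ
  -- the time integrals in Lagrangian coordinates
  set ν := 𝒯.refMeasure ρbar
  have hshift : Continuous fun z : ℝ × Space d => φ (z.1 + τ, z.2) :=
    hφ.continuous.comp (by fun_prop)
  have hshiftc : HasCompactSupport fun z : ℝ × Space d => φ (z.1 + τ, z.2) := by
    have := hφc.comp_homeomorph ((Homeomorph.addRight τ).prodCongr (Homeomorph.refl (Space d)))
    exact this
  have hiA := hG.integrableOn_integral_step hK hφ.continuous hφc id T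
  have hiB := hG.integrableOn_integral_step hK hφ.continuous hφc (· - 1) T
  have hiA' := hG.integrableOn_integral_step hK hshift hshiftc id T
  have hia := hG.integrableOn_integral_step hK hct hst id T
  have hiq := hG.integrableOn_integral_step hK hcq hsq id T
  simp only [id] at hiA hiA' hia hiq
  have hcomb : ∀ t, ∫ x, (timeDeriv φ (t, x) - fderiv ℝ V x (spaceGradient φ (t, x)))
      ∂interpolation ρbar 𝒯 τ G t = (∫ ω, timeDeriv φ (t, G ⌈t / τ⌉₊ ω) ∂ν)
        - ∫ ω, fderiv ℝ V (G ⌈t / τ⌉₊ ω) (spaceGradient φ (t, G ⌈t / τ⌉₊ ω)) ∂ν := by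
    intro t
    have hc1 : Continuous fun x : Space d => timeDeriv φ (t, x) := by fun_prop
    have hc2 : Continuous fun x => fderiv ℝ V x (spaceGradient φ (t, x)) :=
      hcq.comp (by fun_prop : Continuous fun x : Space d => (t, x))
    refine (hG.integral_interpolation hK (hc1.sub hc2) t).trans ?_
    exact integral_sub (hG.integrable_comp hK hc1 _) (hG.integrable_comp hK hc2 _)
  have hBA := integral_prev_step (ρbar := ρbar) (𝒯 := 𝒯) (G := G) hτ ha hb (φ := φ)
    fun t x ht => image_eq_zero_of_notMem_tsupport fun hz => ht (hφΩ hz).1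
  -- Each step occupies a time interval of length `τ` and the squared steps sum to at most `2 τ C`,
  -- so the integral is at most `2 τ² C`.
  obtain ⟨hiR, hR⟩ := integral_natCeil_sub_one_le (T := T) hτ
    (fun n => ∫ ω, ‖G (n + 1) ω - G n ω‖ ^ 2 ∂ν)
    (fun n => integral_nonneg fun ω => sq_nonneg _) (S := 2 * τ * C) fun N =>
      (hG.sum_dist_le hτ hh hV.continuous hV0 hK N).trans (by gcongr)
  simp_rw [hcomb]
  rw [hpe, hηe, integral_sub hia hiq]
  set A : ℝ → ℝ := fun t => ∫ ω, φ (t, G ⌈t / τ⌉₊ ω) ∂ν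
  set A' : ℝ → ℝ := fun t => ∫ ω, φ (t + τ, G ⌈t / τ⌉₊ ω) ∂ν
  set B : ℝ → ℝ := fun t => ∫ ω, φ (t, G (⌈t / τ⌉₊ - 1) ω) ∂ν
  set α : ℝ → ℝ := fun t => ∫ ω, timeDeriv φ (t, G ⌈t / τ⌉₊ ω) ∂ν
  set q : ℝ → ℝ := fun t => ∫ ω, fderiv ℝ V (G ⌈t / τ⌉₊ ω) (spaceGradient φ (t, G ⌈t / τ⌉₊ ω)) ∂ν
  set P : ℝ → ℝ := fun t =>
    ∫ x, pressure h (density (interpolation ρbar 𝒯 τ G t) x) * spaceLaplacian φ (t, x)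
  set S : ℝ → ℝ := fun t => ∫ x, pressure h (density (interpolation ρbar 𝒯 τ G t) x) * ψ (t, x)
  set R : ℝ → ℝ := fun t =>
    (fun n => ∫ ω, ‖G (n + 1) ω - G n ω‖ ^ 2 ∂ν) (⌈t / τ⌉₊ - 1)
  set κ := d * (d * (L * δ) / Real.sin θ + L * δ)
  have hF : ∀ t ∈ Ioo 0 T, ‖τ⁻¹ * (A t - B t) - P t + q t‖
      ≤ L * τ⁻¹ * R t + L * δ * (1 / 2 + R t / (2 * τ ^ 2)) + κ * S t + L * δ * CV := by
    intro t ht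
    have hn0 : 0 < ⌈t / τ⌉₊ := Nat.ceil_pos.2 (div_pos ht.1 hτ)
    obtain ⟨n, hn⟩ : ∃ n, ⌈t / τ⌉₊ = n + 1 := ⟨⌈t / τ⌉₊ - 1, by omega⟩
    have hlt := sub_one_mul_lt_of_le hτ ht.1.le ht.2.le
    have hest := hG.one_step_estimate hτ hh hV hK hρ hsupp n hL hδ hθ0 hθ hCV (htest t)
      (hinj _ (hn ▸ hlt)) (hang _ (hn ▸ hlt)) (hdiam _ (hn ▸ hlt)) hbV
      (η := fun x => ψ (t, x)) (by fun_prop) (fun x => hψ0 _) (hψ1 t ht)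
    simp only [A, B, P, q, S, R, interpolation, hn, Nat.add_sub_cancel]
    exact hest
  have hc : ∀ c : ℝ, IntegrableOn (fun _ : ℝ => c) (Ioo 0 T) := fun c => integrable_const c
  have hTime : ∀ t, ‖α t - τ⁻¹ * (A' t - A t)‖ ≤ L * τ := by
    intro t
    have i1 := hG.integrable_comp hK (f := fun x => φ (t + τ, x))
      (hφ.continuous.comp (by fun_prop)) ⌈t / τ⌉₊ (ρbar := ρbar)
    have i2 := hG.integrable_comp hK (f := fun x => φ (t, x))
      (hφ.continuous.comp (by fun_prop)) ⌈t / τ⌉₊ (ρbar := ρbar)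
    have i3 := hG.integrable_comp hK (f := fun x => timeDeriv φ (t, x))
      (by fun_prop) ⌈t / τ⌉₊ (ρbar := ρbar)
    have h1 : A' t - A t - τ * α t = ∫ ω, (φ (t + τ, G ⌈t / τ⌉₊ ω) - φ (t, G ⌈t / τ⌉₊ ω)
        - τ * timeDeriv φ (t, G ⌈t / τ⌉₊ ω)) ∂ν := by
      rw [integral_sub (f := fun ω => φ (t + τ, G ⌈t / τ⌉₊ ω) - φ (t, G ⌈t / τ⌉₊ ω))
        (i1.sub i2) (i3.const_mul τ), integral_sub i1 i2, integral_const_mul]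
    have h2 : |A' t - A t - τ * α t| ≤ L * τ ^ 2 := by
      rw [h1]
      simpa using norm_integral_le_of_norm_le_const (μ := ν) (C := L * τ ^ 2)
        (f := fun ω => φ (t + τ, G ⌈t / τ⌉₊ ω) - φ (t, G ⌈t / τ⌉₊ ω)
          - τ * timeDeriv φ (t, G ⌈t / τ⌉₊ ω))
        (Eventually.of_forall fun ω => htime t τ (G ⌈t / τ⌉₊ ω))
    have h3 : α t - τ⁻¹ * (A' t - A t) = -(τ⁻¹ * (A' t - A t - τ * α t)) := by
      field_simp
      ring
    rw [h3, norm_neg, Real.norm_eq_abs, abs_mul, abs_of_pos (inv_pos.2 hτ),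
      inv_mul_le_iff₀ hτ]
    linarith
  have hvol : volume.real (Ioo 0 T) = T := by simp [hT.le]
  have hconst : ∀ c : ℝ, ∫ _t in Ioo 0 T, c = T * c := fun c => by
    rw [setIntegral_const, hvol, smul_eq_mul]
  have j1 : IntegrableOn (fun t => L * τ⁻¹ * R t) (Ioo 0 T) := hiR.const_mul _
  have j2 : IntegrableOn (fun t => 1 / 2 + R t / (2 * τ ^ 2)) (Ioo 0 T) :=
    (hc _).add (hiR.div_const _)
  have j12 : IntegrableOn (fun t => L * τ⁻¹ * R t + L * δ * (1 / 2 + R t / (2 * τ ^ 2)))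
    (Ioo 0 T) := j1.add (j2.const_mul _)
  have j123 : IntegrableOn (fun t => L * τ⁻¹ * R t + L * δ * (1 / 2 + R t / (2 * τ ^ 2))
    + κ * S t) (Ioo 0 T) := j12.add (hηi.const_mul _)
  have hF' := norm_integral_le_of_norm_le (j123.add (hc (L * δ * CV)))
    ((ae_restrict_mem measurableSet_Ioo).mono hF)
  have hbound : ∫ t in Ioo 0 T, (L * τ⁻¹ * R t + L * δ * (1 / 2 + R t / (2 * τ ^ 2)) + κ * S t
      + L * δ * CV) = L * τ⁻¹ * (∫ t in Ioo 0 T, R t)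
        + L * δ * (T * (1 / 2) + (∫ t in Ioo 0 T, R t) / (2 * τ ^ 2))
        + κ * (∫ t in Ioo 0 T, S t) + T * (L * δ * CV) := by
    rw [integral_add j123 (hc _), integral_add j12 (hηi.const_mul _),
      integral_add j1 (j2.const_mul _), integral_const_mul, integral_const_mul,
      integral_const_mul, integral_add (hc _) (hiR.div_const _), integral_div (2 * τ ^ 2) R, hconst,
      hconst]
  have k1 : IntegrableOn (fun t => τ⁻¹ * (A t - B t)) (Ioo 0 T) := (hiA.sub hiB).const_mul _
  have k2 : IntegrableOn (fun t => τ⁻¹ * (A t - B t) - P t) (Ioo 0 T) := k1.sub hpi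
  have hleft : ∫ t in Ioo 0 T, (τ⁻¹ * (A t - B t) - P t + q t)
      = τ⁻¹ * ((∫ t in Ioo 0 T, A t) - ∫ t in Ioo 0 T, B t) - (∫ t in Ioo 0 T, P t)
        + ∫ t in Ioo 0 T, q t := by
    rw [integral_add k2 hiq, integral_sub k1 hpi, integral_const_mul, integral_sub hiA hiB]
  have k3 : IntegrableOn (fun t => τ⁻¹ * (A' t - A t)) (Ioo 0 T) := (hiA'.sub hiA).const_mul _
  have hleft' : ∫ t in Ioo 0 T, (α t - τ⁻¹ * (A' t - A t))
      = (∫ t in Ioo 0 T, α t) - τ⁻¹ * ((∫ t in Ioo 0 T, A' t) - ∫ t in Ioo 0 T, A t) := by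
    rw [integral_sub hia k3, integral_const_mul, integral_sub hiA' hiA]
  have hT' := norm_setIntegral_le_of_norm_le_const (μ := volume) (s := Ioo 0 T) (by simp)
    fun t _ => hTime t
  rw [hvol, hleft', Real.norm_eq_abs] at hT'
  rw [Pi.add_def, hbound, hleft, hBA, Real.norm_eq_abs] at hF'
  -- After summation by parts the two difference quotients cancel, and the target is the time
  -- discretization error minus the integrated one-step error.
  have hsum : (∫ t in Ioo 0 T, α t) - (∫ t in Ioo 0 T, q t) + ∫ t in Ioo 0 T, P t
      = ((∫ t in Ioo 0 T, α t) - τ⁻¹ * ((∫ t in Ioo 0 T, A' t) - ∫ t in Ioo 0 T, A t))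
        - (τ⁻¹ * ((∫ t in Ioo 0 T, A t) - ∫ t in Ioo 0 T, A' t) - (∫ t in Ioo 0 T, P t)
          + ∫ t in Ioo 0 T, q t) := by ring
  have hR1 : L * τ⁻¹ * (∫ t in Ioo 0 T, R t) ≤ 2 * L * τ * C := by
    calc _ ≤ L * τ⁻¹ * (τ * (2 * τ * C)) := by gcongr
      _ = _ := by field_simp
  have hR2 : (∫ t in Ioo 0 T, R t) / (2 * τ ^ 2) ≤ C := by
    rw [div_le_iff₀ (by positivity)]
    linarith
  have hR3 : L * δ * (T * (1 / 2) + (∫ t in Ioo 0 T, R t) / (2 * τ ^ 2))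
      ≤ L * δ * (T / 2 + C) := by
    gcongr
    linarith
  rw [hsum]
  refine (abs_sub _ _).trans ?_
  linarith

end Scheme

/-- Weak-* convergence tested with `ψ` bounds the pressure near the spatial support of the test
function, so no global bound on the pressure is required. -/
lemma exists_cutoff {T : ℝ} {Ω X : Set (Space d)} (hΩ : IsOpen Ω) (hX : IsCompact X)
    (hXΩ : X ⊆ Ω) :
    ∃ δ > 0, ∃ ψ : ℝ × Space d → ℝ, Continuous ψ ∧ HasCompactSupport ψ ∧
      tsupport ψ ⊆ univ ×ˢ Ω ∧ (∀ z, 0 ≤ ψ z) ∧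
      ∀ t ∈ Ioo 0 T, ∀ x ∈ Metric.cthickening δ X, 1 ≤ ψ (t, x) := by
  obtain ⟨δ, hδ, hsub⟩ := hX.exists_cthickening_subset_open hΩ hXΩ
  obtain ⟨ψ, h1, h2, h3, h4⟩ := exists_continuousMap_one_of_isCompact_subset_isOpen
    ((isCompact_Icc (a := (0 : ℝ)) (b := T)).prod (hX.cthickening (r := δ)))
    (isOpen_univ.prod hΩ) (prod_mono (subset_univ _) hsub)
  exact ⟨δ, hδ, ψ, ψ.continuous, h2, h3, fun z => (h4 z).1, fun t ht x hx =>
    (h1 (mk_mem_prod (Ioo_subset_Icc_self ht) hx)).ge⟩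

/-- The limit equation, for a sequence of discrete solutions that possesses a limit trajectory. -/
theorem solvesLimitEq_of_isLimitTrajectory {h : ℝ → ℝ} {V : Space d → ℝ}
    {ρbar : Measure (Space d)} {𝒯 : ℕ → Mesh K} {τ : ℕ → ℝ} {G : ℕ → ℕ → Space d → Space d}
    (hh : IsInternalEnergy h) (hV : ContDiff ℝ 1 V) (hV0 : ∀ x, 0 ≤ V x) (hK : IsCompact K)
    (hρ : IsP2ac ρbar) (hsupp : ρbar.support = K) (hτ : ∀ k, 0 < τ k)
    (hτ0 : Tendsto τ atTop (𝓝 0)) (hG : ∀ k, IsDiscreteSolution h V ρbar (𝒯 k) (τ k) (G k))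
    {C : ℝ} (hE : ∀ k, transEntropy h V ρbar (𝒯 k) (G k 0) ≤ C)
    {T : ℝ} (hT : 0 < T) {Ω : Set (Space d)} (hΩ : IsOpen Ω) {p : ℝ × Space d → ℝ}
    (hpressure : WeakStarTendsto T Ω
      (fun k z => pressure h (density (interpolation ρbar (𝒯 k) (τ k) (G k) z.1) z.2)) p)
    (hinj : ∀ (k n : ℕ), ((n : ℝ) - 1) * τ k < T → InjOn (G k n) K)
    (hangle : ∃ θ > 0, ∀ᶠ k in atTop, ∀ n : ℕ, ((n : ℝ) - 1) * τ k < T →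
      ∀ s ∈ (𝒯 k).cells, AnglesGE θ (G k n) s)
    (hdiam : ∀ ε > 0, ∀ᶠ k in atTop, ∀ n : ℕ, ((n : ℝ) - 1) * τ k < T →
      ∀ s ∈ (𝒯 k).cells, Metric.diam (G k n '' simplex s) ≤ ε)
    {ρ : ℝ → Measure (Space d)}
    (hlim : IsLimitTrajectory T (fun k => interpolation ρbar (𝒯 k) (τ k) (G k)) ρ) :
    SolvesLimitEq T Ω V ρ p := by
  intro φ hφ hφc hφΩ
  have hV' : Continuous (fderiv ℝ V) := hV.continuous_fderiv (by simp)
  set X := Prod.snd '' tsupport φ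
  have hX : IsCompact X := hφc.isCompact.image continuous_snd
  have hXΩ : X ⊆ Ω := by
    rintro _ ⟨z, hz, rfl⟩
    exact (hφΩ hz).2
  obtain ⟨δ, hδ, ψ, hψ, hψc, hψΩ, hψ0, hψ1⟩ := exists_cutoff (T := T) hΩ hX hXΩ
  -- Leaves room of width `a` between the time support and both ends of `(0, T)`; summation by parts
  -- needs `τ k < a`, which holds eventually.
  obtain ⟨a, ha, hasub⟩ := (hφc.isCompact.image continuous_fst).exists_cthickening_subset_open
    (isOpen_Ioo (a := 0) (b := T)) (by rintro _ ⟨z, hz, rfl⟩; exact (hφΩ hz).1)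
  have hφab : tsupport φ ⊆ Icc a (T - a) ×ˢ Ω := by
    intro z hz
    have hmem : ∀ s, |s - z.1| ≤ a → s ∈ Ioo 0 T := fun s hs =>
      hasub (Metric.mem_cthickening_of_dist_le s z.1 a _ ⟨z, hz, rfl⟩ hs)
    have h1 := hmem (z.1 - a) (by simp [abs_of_pos ha])
    have h2 := hmem (z.1 + a) (by simp [abs_of_pos ha])
    exact ⟨⟨by linarith [h1.1], by linarith [h2.2]⟩, (hφΩ hz).2⟩
  obtain ⟨L, hL, htest, htime⟩ := exists_isTestField hφ hφc
  obtain ⟨θ, hθ0, hang⟩ := hangle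
  obtain ⟨CV, hCV⟩ := (hX.cthickening (r := δ)).exists_bound_of_continuousOn hV'.continuousOn
  -- Capping the angle at `π / 2` weakens the angle condition and keeps the sine in the denominator
  -- positive.
  have hpi2 : 0 < min θ (Real.pi / 2) := lt_min hθ0 (by positivity)
  -- the terms of the weak formulation and their limits
  have hcg : Continuous fun z : ℝ × Space d =>
      timeDeriv φ z - fderiv ℝ V z.2 (spaceGradient φ z) :=
    (continuous_timeDeriv hφ).sub
      ((hV'.comp continuous_snd).clm_apply (contDiff_spaceGradient hφ).continuous)
  have hcs : HasCompactSupport fun z : ℝ × Space d =>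
      timeDeriv φ z - fderiv ℝ V z.2 (spaceGradient φ z) :=
    hasCompactSupport_of_eq_zero hφc fun z hz => by
      rw [timeDeriv_eq_zero hφ hz, spaceGradient_eq_zero hφ hz, map_zero, sub_zero]
  have hsl : HasCompactSupport (spaceLaplacian φ) :=
    hasCompactSupport_of_eq_zero hφc fun z => spaceLaplacian_eq_zero hφ
  have hslφ : tsupport (spaceLaplacian φ) ⊆ tsupport φ :=
    tsupport_subset_of_eq_zero fun z => spaceLaplacian_eq_zero hφ
  have hprob := fun k => Mesh.isProbabilityMeasure_refMeasure (𝒯 := 𝒯 k) hρ hsupp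
  have hlim1 := tendsto_integral_of_narrowTendsto
    (fun k t => (hG k).isProbabilityMeasure_interpolation hK hρ hsupp t) hlim.narrow hcg hcs
    (fun k => by
      have heq := funext fun t => (hG k).integral_interpolation hK
        (hcg.comp (by fun_prop : Continuous fun x : Space d => (t, x))) t (ρbar := ρbar)
      exact heq ▸ (hG k).measurable_integral_step hK hcg hcs id)
  have hlim2 := hpressure _ (continuous_spaceLaplacian hφ) hsl
    (hslφ.trans (hφΩ.trans (prod_mono (subset_univ _) Subset.rfl)))
  have hlimψ := hpressure ψ hψ hψc hψΩ
  have hlimit := (hlim1.add hlim2).abs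
  set ℓ := (∫ t in Ioo 0 T, ∫ x, (timeDeriv φ (t, x)
    - fderiv ℝ V x (spaceGradient φ (t, x))) ∂ρ t) + ∫ z in Icc 0 T ×ˢ Ω, p z * spaceLaplacian φ z
  set S := ∫ z in Icc 0 T ×ˢ Ω, p z * ψ z
  -- Here `ε` bounds the image diameters. The limit `k → ∞` is taken for fixed `ε`, which replaces
  -- `τ k` by `0`; the limit `ε → 0` follows.
  have hbound : ∀ ε, 0 < ε → ε ≤ δ → |ℓ| ≤ L * 0 * T + 2 * L * 0 * C + L * ε * (T / 2 + C)
      + d * (d * (L * ε) / Real.sin (min θ (Real.pi / 2)) + L * ε) * S + L * ε * |CV| * T := by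
    intro ε hε hεδ
    have hrhs : Tendsto (fun k => L * τ k * T + 2 * L * τ k * C + L * ε * (T / 2 + C)
        + d * (d * (L * ε) / Real.sin (min θ (Real.pi / 2)) + L * ε)
          * (∫ z in Icc 0 T ×ˢ Ω, pressure h
            (density (interpolation ρbar (𝒯 k) (τ k) (G k) z.1) z.2) * ψ z)
        + L * ε * |CV| * T) atTop (𝓝 (L * 0 * T + 2 * L * 0 * C + L * ε * (T / 2 + C)
      + d * (d * (L * ε) / Real.sin (min θ (Real.pi / 2)) + L * ε) * S + L * ε * |CV| * T)) :=
      (((((hτ0.const_mul L).mul_const T).add ((hτ0.const_mul (2 * L)).mul_const C)).add_const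
        _).add (hlimψ.const_mul _)).add_const _
    refine le_of_tendsto_of_tendsto hlimit hrhs ?_
    filter_upwards [hang, hdiam ε hε, hτ0.eventually_lt_const ha] with k h1 h2 h3
    have hsub := Metric.cthickening_mono hεδ X
    exact (hG k).weak_form_estimate (hτ k) hh hV hV0 hK hρ hsupp (hE k) hT hΩ (hinj k) hφ hφc h3
      (sub_lt_self T ha) hφab hL hε.le hpi2 (min_le_right _ _) (abs_nonneg CV) htest htime
      (fun n hn s hs => (h1 n hn s hs).mono (min_le_left _ _)) h2
      (fun x hx => (hCV x (hsub hx)).trans (le_abs_self _)) hψ hψc hψΩ hψ0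
      (fun t ht x hx => hψ1 t ht x (hsub hx))
  have hℓ : ℓ = 0 := by
    have hcont : Tendsto (fun ε => L * 0 * T + 2 * L * 0 * C + L * ε * (T / 2 + C)
        + d * (d * (L * ε) / Real.sin (min θ (Real.pi / 2)) + L * ε) * S + L * ε * |CV| * T)
        (𝓝[>] 0) (𝓝 0) :=
      (Continuous.tendsto' (by fun_prop) 0 0 (by simp)).mono_left nhdsWithin_le_nhds
    refine abs_nonpos_iff.1 (ge_of_tendsto hcont ?_)
    filter_upwards [Ioc_mem_nhdsGT hδ] with ε hε using hbound ε hε.1 hε.2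
  refine Eq.trans ?_ hℓ
  -- The end points in time are null, which reconciles `Ioo` in the equation with `Icc` in the
  -- weak-* convergence.
  have hset : (Ioo 0 T ×ˢ Ω : Set (ℝ × Space d)) =ᵐ[volume] Icc 0 T ×ˢ Ω :=
    Measure.set_prod_ae_eq Ioo_ae_eq_Icc (ae_eq_refl Ω)
  rw [setIntegral_congr_set hset]
  simp_rw [← spaceLaplacian_eq hφ, inner_gradient_left]
  rfl

end LagrangianScheme

theorem mainTheorem2 {d : ℕ} (hd : 1 ≤ d)
    -- the equation
    (h : ℝ → ℝ) (hh : IsInternalEnergy h)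
    (V : Space d → ℝ) (hV : ContDiff ℝ 2 V) (hV0 : ∀ x, 0 ≤ V x)
    (ρ0 : Measure (Space d)) (hρ0 : IsP2ac ρ0)
    -- the reference density
    (K : Set (Space d)) (hKconv : Convex ℝ K) (hKcomp : IsCompact K)
    (ρbar : Measure (Space d)) (hρbar : IsP2ac ρbar) (hsupp : ρbar.support = K)
    -- a vanishing sequence of discretizations, and discrete solutions
    (𝒯 : ℕ → Mesh K) (τ : ℕ → ℝ) (hτ : ∀ k, 0 < τ k) (hτ0 : Tendsto τ atTop (𝓝 0))
    (hmesh : ∀ ε > 0, ∀ᶠ k in atTop, ∀ s ∈ (𝒯 k).cells, Metric.diam (simplex s) ≤ ε)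
    (G : ℕ → ℕ → Space d → Space d)
    (hG : ∀ k, IsDiscreteSolution h V ρbar (𝒯 k) (τ k) (G k))
    -- approximation of the initial condition
    (hinit : NarrowTendsto (fun k => inducedMeasure ρbar (𝒯 k) (G k) 0) ρ0)
    (hentropy : (⨆ k, entropy h V (inducedMeasure ρbar (𝒯 k) (G k) 0)) < ∞)
    -- the three additional hypotheses
    (T : ℝ) (hT : 0 < T) (Ω : Set (Space d)) (hΩ : IsOpen Ω)
    (p : ℝ × Space d → ℝ) (hp : IntegrableOn p (Icc 0 T ×ˢ Ω))
    (hpressure : WeakStarTendsto T Ω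
      (fun k z => pressure h (density (interpolation ρbar (𝒯 k) (τ k) (G k) z.1) z.2)) p)
    (hinj : ∀ (k n : ℕ), ((n : ℝ) - 1) * τ k < T → InjOn (G k n) K)
    (hangle : ∃ θ > 0, ∀ᶠ k in atTop, ∀ n : ℕ, ((n : ℝ) - 1) * τ k < T →
      ∀ s ∈ (𝒯 k).cells, AnglesGE θ (G k n) s)
    (hdiam : ∀ ε > 0, ∀ᶠ k in atTop, ∀ n : ℕ, ((n : ℝ) - 1) * τ k < T →
      ∀ s ∈ (𝒯 k).cells, Metric.diam (G k n '' simplex s) ≤ ε) :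
    (∃ σ : ℕ → ℕ, StrictMono σ ∧ ∃ ρ : ℝ → Measure (Space d),
      IsLimitTrajectory T
        (fun k => interpolation ρbar (𝒯 (σ k)) (τ (σ k)) (G (σ k))) ρ) ∧
    (∀ σ : ℕ → ℕ, StrictMono σ → ∀ ρ : ℝ → Measure (Space d),
      IsLimitTrajectory T
        (fun k => interpolation ρbar (𝒯 (σ k)) (τ (σ k)) (G (σ k))) ρ →
      SolvesLimitEq T Ω V ρ p) := by
  -- Index `0` always lies in the admissible range, since `(0 - 1) τ < 0 < T`.
  obtain ⟨C, hC, hE⟩ := exists_energy_bound hh hV.continuous hV0 hKcomp hρbar hsupp hG hentropy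
    fun k => hinj k 0 (by have := hτ k; push_cast; linarith)
  refine ⟨exists_limitTrajectory hh hV.continuous hV0 hρ0 hKcomp hρbar hsupp hτ hτ0 hG hinit hC hE
    hT hinj, fun σ hσ ρ hlim => ?_⟩
  have hσ' := hσ.tendsto_atTop
  obtain ⟨θ, hθ, hang⟩ := hangle
  exact solvesLimitEq_of_isLimitTrajectory (𝒯 := fun k => 𝒯 (σ k)) (τ := fun k => τ (σ k))
    (G := fun k => G (σ k)) hh (hV.of_le one_le_two) hV0 hKcomp hρbar hsupp (fun k => hτ _)
    (hτ0.comp hσ') (fun k => hG _) (fun k => hE _) hT hΩ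
    (fun ψ h1 h2 h3 => (hpressure ψ h1 h2 h3).comp hσ') (fun k => hinj _)
    ⟨θ, hθ, hσ'.eventually hang⟩ (fun ε hε => hσ'.eventually (hdiam ε hε)) hlim
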